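/- Let $G$ be a simple complex Lie group (simply connected, say; everything below depends only on its Lie algebra $\mathfrak g$), of rank $r$, with Coxeter number $\gamma$ and dual Coxeter number $g$. Let $\langle\cdot,\cdot\rangle$ be the Weyl-invariant form on the weight space normalised by $\langle\theta,\theta\rangle=2$, where $\theta$ is the highest root; let $\omega_1,\dots,\omega_r$ be the fundamental weights, $\varrho=\sum_i\omega_i$ the Weyl vector, and $\Delta=\det(\langle\omega_i,\omega_j\rangle)_{i,j}$. For an integer $k\ge 0$ put $q=\exp\bigl(i\pi/(g+k)\bigr)$ and $[x]_q=\dfrac{q^x-q^{-x}}{q-q^{-1}}$. The simple objects of $\mathcal A_k(G)$ are labelled by the dominant weights $n=\sum_i n_i\omega_i$ ($n_i\in\mathbb Z_{\ge0}$) with $\langle n,\theta\rangle\le k$; their quantum dimensions and the global dimension are $$\mathrm{qdim}(n)=\prod_{\alpha>0}\frac{[\langle n+\varrho,\alpha\rangle]_q}{[\langle\varrho,\alpha\rangle]_q},\qquad |\mathcal A_k(G)|=\sum_{n}\mathrm{qdim}(n)^2 .$$ For complex $q$ near $1$, $q\ne1$, use principal powers in $[x]_q$, and let $[s]!_q=\prod_{n=1}^s[n]_q$.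 The quantum Lie superfactorial $\mathrm{sf}_G[q]$ is defined, with $\mathcal E$ the multiset of exponents of $G$, by * $\mathrm{sf}_G[q]=\prod_{s\in\mathcal E}[s]!_q$ for $G$ of type $A_r$ $(r\ge1)$, $D_r$ $(r\ge3)$, $E_6$, $E_7$, $E_8$; * $\mathrm{sf}_{B_r}[q]=\prod_{s\in\mathcal E}[s/2]_q\,[s-1]!_q$ $(r\ge2)$; * $\mathrm{sf}_{C_r}[q]=\prod_{s\in\mathcal E}\prod_{n=1}^{s}c_{s,n}$ $(r\ge2)$, where $c_{s,n}=[n/2]_q$ except that $c_{s,n}=[n]_q$ for $n=(s+1)/2$; * $\mathrm{sf}_{F_4}[q]=[\tfrac12]_q^2[1]_q^3[\tfrac32]_q[2]_q^3[\tfrac52]_q^2[3]_q^3[\tfrac72]_q[4]_q^2[\tfrac92]_q[5]_q^2[\tfrac{11}2]_q[6]_q[7]_q[8]_q$; * $\mathrm{sf}_{G_2}[q]=[\tfrac53]_q[\tfrac43]_q[3]_q[2]_q[1]_q[\tfrac13]_q$. Let $\mathrm{sf}_G=c_G\prod_{s\in\mathcal E}s!$, where $c_G=1$ in the types $A,D,E$,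 $c_{B_r}=2^{-r}$, $c_{C_r}=2^{-r(r-1)}$, $c_{F_4}=2^{-12}$ and $c_{G_2}=3^{-3}$. Then $\mathrm{sf}_G$ is the classical limit of the quantum Lie superfactorial, i.e. $\mathrm{sf}_G[q]\to\mathrm{sf}_G$ as $q\to1$ (in particular for $q=\exp(i\pi/(g+k))$, $k\to\infty$), and $$|\mathcal A_k(G)|\ \sim\ \frac{1}{2^{r\gamma}\,\Delta\,\pi^{r\gamma}\,(\mathrm{sf}_G)^2}\;k^{\dim G}\qquad (k\to\infty),$$ in the sense that the quotient of the two sides tends to $1$. -/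

import Mathlib

noncomputable section

/-! ### Quantum numbers -/

/-- The `q`-number `[x]_q = (q^x - q^{-x}) / (q - q⁻¹)`, with the principal branch of the power. -/
def qNumber (q x : ℂ) : ℂ := (q ^ x - q ^ (-x)) / (q - q⁻¹)

/-- The quantum factorial `[s]!_q = [1]_q [2]_q ⋯ [s]_q`. -/
def qFactorial (q : ℂ) (s : ℕ) : ℂ := ∏ n ∈ Finset.Icc 1 s, qNumber q (n : ℂ)

/-! ### Types of simple complex Lie groups and their superfactorials -/

/-- The Cartan–Killing types of the simple complex Lie groups. -/
inductive SimpleLieType : Type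
  | A (r : ℕ) (hr : 1 ≤ r)
  | B (r : ℕ) (hr : 2 ≤ r)
  | C (r : ℕ) (hr : 2 ≤ r)
  | D (r : ℕ) (hr : 3 ≤ r)
  | E₆
  | E₇
  | E₈
  | F₄
  | G₂

namespace SimpleLieType

/-- The rank. -/
def rank : SimpleLieType → ℕ
  | A r _ => r
  | B r _ => r
  | C r _ => r
  | D r _ => r
  | E₆ => 6
  | E₇ => 7
  | E₈ => 8
  | F₄ => 4
  | G₂ => 2

/-- The Cartan matrix, with entries `⟨αᵢ, αⱼ^∨⟩` (so that in type `B` the last simple root is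
short, and in type `C` it is long). -/
def cartanMatrix : (X : SimpleLieType) → Matrix (Fin X.rank) (Fin X.rank) ℤ
  | A r _ => CartanMatrix.A r
  | B r _ => CartanMatrix.B r
  | C r _ => CartanMatrix.C r
  | D r _ => CartanMatrix.D r
  | E₆ => CartanMatrix.E₆
  | E₇ => CartanMatrix.E₇
  | E₈ => CartanMatrix.E₈
  | F₄ => CartanMatrix.F₄
  | G₂ => CartanMatrix.G₂

/-- The multiset of exponents. -/
def exponents : SimpleLieType → Multiset ℕ
  | A r _ => (Multiset.range r).map fun i => i + 1
  | B r _ => (Multiset.range r).map fun i => 2 * i + 1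
  | C r _ => (Multiset.range r).map fun i => 2 * i + 1
  | D r _ => (r - 1) ::ₘ (Multiset.range (r - 1)).map fun i => 2 * i + 1
  | E₆ => {1, 4, 5, 7, 8, 11}
  | E₇ => {1, 5, 7, 9, 11, 13, 17}
  | E₈ => {1, 7, 11, 13, 17, 19, 23, 29}
  | F₄ => {1, 5, 7, 11}
  | G₂ => {1, 5}

/-- The modified quantum factorial of type `B`: `[s/2]_q [s-1]_q [s-2]_q ⋯ [1]_q`. -/
def qFactorialB (q : ℂ) (s : ℕ) : ℂ := qNumber q ((s : ℂ) / 2) * qFactorial q (s - 1)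

/-- The modified quantum factorial of type `C`, for odd `s`: the product of the `[n/2]_q` for
`1 ≤ n ≤ s`, except that the middle factor, `n = (s+1)/2`, is `[n]_q` instead of `[n/2]_q`. -/
def qFactorialC (q : ℂ) (s : ℕ) : ℂ :=
  ∏ n ∈ Finset.Icc 1 s, if 2 * n = s + 1 then qNumber q (n : ℂ) else qNumber q ((n : ℂ) / 2)

/-- The quantum Lie superfactorial `sf_G[q]`. -/
def quantumSuperfactorial (X : SimpleLieType) (q : ℂ) : ℂ :=
  match X with
  | B _ _ => (X.exponents.map (qFactorialB q)).prod
  | C _ _ => (X.exponents.map (qFactorialC q)).prod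
  | F₄ =>
      qNumber q (1 / 2) ^ 2 * qNumber q 1 ^ 3 * qNumber q (3 / 2) * qNumber q 2 ^ 3 *
        qNumber q (5 / 2) ^ 2 * qNumber q 3 ^ 3 * qNumber q (7 / 2) * qNumber q 4 ^ 2 *
        qNumber q (9 / 2) * qNumber q 5 ^ 2 * qNumber q (11 / 2) * qNumber q 6 *
        qNumber q 7 * qNumber q 8
  | G₂ =>
      qNumber q (5 / 3) * qNumber q (4 / 3) * qNumber q 3 * qNumber q 2 * qNumber q 1 *
        qNumber q (1 / 3)
  | _ => (X.exponents.map (qFactorial q)).prod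

/-- The classical Lie superfactorial `sf_G`: the product of the factorials of the exponents,
times a correcting prefactor in the types that are not simply laced. -/
def superfactorial (X : SimpleLieType) : ℚ :=
  let p : ℚ := (X.exponents.map fun s => (s.factorial : ℚ)).prod
  match X with
  | B r _ => p / 2 ^ r
  | C r _ => p / 2 ^ (r * (r - 1))
  | F₄ => p / 2 ^ 12
  | G₂ => p / 3 ^ 3
  | _ => p

end SimpleLieType

/-! ### The data attached to a root system with a base -/

namespace LieLevel

variable {ι M N : Type*} [Fintype ι] [AddCommGroup M] [Module ℂ M] [AddCommGroup N] [Module ℂ N]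
  {P : RootPairing ι ℂ M N} [P.IsRootSystem] [P.IsIrreducible] (b : P.Base)

/-- An irreducible root system has a root of greatest height. -/
theorem exists_highestRoot {ι M N : Type*} [Fintype ι] [AddCommGroup M] [Module ℂ M]
    [AddCommGroup N] [Module ℂ N] {P : RootPairing ι ℂ M N} [P.IsRootSystem] [P.IsIrreducible]
    (b : P.Base) : ∃ i : ι, ∀ j : ι, b.height j ≤ b.height i := by
  have hne : Nonempty ι := by
    by_contra h
    rw [not_nonempty_iff] at h
    have h1 := RootPairing.IsRootSystem.span_root_eq_top (P := P)
    rw [Set.range_eq_empty, Submodule.span_empty] at h1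
    have := RootPairing.IsIrreducible.nontrivial (P := P)
    exact bot_ne_top h1
  exact Finite.exists_max b.height

/-- The highest root `θ` (its index): the root of greatest height. -/
def highestRoot : ι := (exists_highestRoot b).choose

/-- The fundamental quadratic form on the weight space: the Weyl invariant bilinear form
normalised by `⟨θ, θ⟩ = 2` (long roots have squared length `2`). -/
def fundamentalForm : LinearMap.BilinForm ℂ M :=
  (2 / P.RootForm (P.root (highestRoot b)) (P.root (highestRoot b))) • P.RootForm

/-- The fundamental weights, i.e. the basis of the weight space dual to the simple coroots. -/
def fundamentalWeight (i : b.support) : M :=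
  P.toPerfPair.symm (b.toCoweightBasis.coord i)

/-- The weight with coordinates `n` in the basis of fundamental weights. The irreducible
representations are labelled in this way by the tuples of natural numbers (dominant weights). -/
def weight (n : b.support → ℕ) : M := ∑ i, (n i : ℂ) • fundamentalWeight b i

/-- The Weyl vector `ρ`, the sum of the fundamental weights. -/
def weylVector : M := ∑ i, fundamentalWeight b i

/-- The Coxeter number `γ`: one plus the height of the highest root `θ`. -/
def coxeterNumber : ℕ := (b.height (highestRoot b)).toNat + 1

/-- The dual Coxeter number `g`: one plus the height of the coroot `θ^∨` with respect to the
simple coroots. -/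
def dualCoxeterNumber : ℕ := (b.flip.height (highestRoot b)).toNat + 1

/-- The determinant `Δ` of the fundamental quadratic form in the basis of fundamental weights. -/
def formDet : ℂ := by
  classical
  exact Matrix.det (Matrix.of fun i j : b.support =>
    fundamentalForm b (fundamentalWeight b i) (fundamentalWeight b j))

/-- The root of unity `q = exp (i π / (g + k))`. -/
def rootOfUnity (k : ℕ) : ℂ :=
  Complex.exp (Complex.I * Real.pi / ((dualCoxeterNumber b : ℂ) + (k : ℂ)))

/-- The simple objects at level `k`: the dominant weights `λ` whose level `⟨λ, θ⟩` is an integer at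
most `k`. -/
def simpleObjects (k : ℕ) : Set (b.support → ℕ) :=
  {n | ∃ m : ℕ, m ≤ k ∧ fundamentalForm b (weight b n) (P.root (highestRoot b)) = (m : ℂ)}

/-- The quantum dimension at level `k` of the representation of highest weight `λ`: the product
over the positive roots `α` of `[⟨λ + ρ, α⟩]_q / [⟨ρ, α⟩]_q`. -/
def qdim (k : ℕ) (n : b.support → ℕ) : ℂ := by
  classical
  exact ∏ i : ι with b.IsPos i,
    qNumber (rootOfUnity b k) (fundamentalForm b (weight b n + weylVector b) (P.root i)) /
      qNumber (rootOfUnity b k) (fundamentalForm b (weylVector b) (P.root i))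

/-- The global dimension `|A_k(G)|`: the sum of the squares of the quantum dimensions of the simple
objects (a finite set) at level `k`. -/
def globalDim (k : ℕ) : ℂ := ∑ᶠ n ∈ simpleObjects b k, qdim b k n ^ 2

end LieLevel

end

noncomputable section

set_option linter.unusedSectionVars false

/-! ### Classical limits of the superfactorials -/

/-! Put h = g + k and let D(x) be the product over all roots α of 1 − exp(2πi⟨x, α⟩/h), for x in the
weight lattice P. With q = exp(iπ/h), the square of [y]_q is, up to a factor independent of y, the
product (1 − exp(2πiy/h))(1 − exp(−2πiy/h)). Hence qdim(n)² = D(n+ϱ)/D(ϱ) (`qdim_sq`). Since g = ⟨ϱ,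
θ⟩ + 1, the weights n+ϱ are exactly the integral points of the open alcove of level h
(`bijOn_shift`). It remains to sum D over the alcove and to find the size of D(ϱ).

The sum is computed on the finite group P/hQ^∨, where Q^∨ is the coroot lattice, embedded in P by
the normalised form. D is invariant under the Weyl group W and under hQ^∨, and it vanishes on the
walls. The affine Weyl group W ⋉ hQ^∨ moves every weight into the closed alcove (a point of the
orbit nearest to ϱ lies there) and acts freely on the open one (exchange argument on words,
`affWord_eq_one`). So the sum over P/hQ^∨ is |W| times the sum over the alcove. On the other hand D
is the squared modulus of the Weyl denominator, whose coefficients are ±1 on the orbit Wϱ and 0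
elsewhere. For large h, orthogonality of characters gives |W|·[P : hQ^∨] for the full sum. Thus the
alcove sum is the index [P : hQ^∨] = h^r/Δ (`sum_rootProd_alcove`, `index_mul_formDet`), and for all
large k there is the exact formula |A_k(G)| = h^r/(Δ·D(ϱ)) (`globalDim_eq`).

As h → ∞, every pair ±α contributes (2π⟨ϱ, α⟩/h)² to D(ϱ). With N positive roots this gives |A_k(G)|
∼ h^(r+2N) / (Δ (2π)^(2N) (∏⟨ϱ, α⟩)²). The root space decomposition identifies r + 2N with dim G.

The two remaining facts, 2N = rγ and ∏⟨ϱ, α⟩ = sf_G, are checked type by type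
(`card_posRoots_and_prod`). Only the Cartan matrix is given, so the positive roots are first
identified with an explicit list by means of `RootModel`. The limit of sf_G[q] is elementary,
because [x]_q → x. -/

theorem qNumber_tendsto (x : ℂ) :
    Filter.Tendsto (fun q => qNumber q x) (nhdsWithin 1 {1}ᶜ) (nhds x) := by
  have hd : ∀ c : ℂ, HasDerivAt (fun q : ℂ => q ^ c - q ^ (-c)) (2 * c) 1 := by
    intro c
    have h1 := (Complex.hasStrictDerivAt_cpow_const (x := 1) (c := c) (by simp)).hasDerivAt
    have h2 := (Complex.hasStrictDerivAt_cpow_const (x := 1) (c := -c) (by simp)).hasDerivAt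
    convert! h1.sub h2 using 1
    simp; ring
  -- Dividing numerator and denominator by q − 1 turns the q-number into a quotient of two slopes at
  -- 1, with limits 2x and 2.
  have key : ∀ c : ℂ, Filter.Tendsto (fun q : ℂ => (q ^ c - q ^ (-c)) / (q - 1))
      (nhdsWithin 1 {1}ᶜ) (nhds (2 * c)) := by
    intro c
    have := (hasDerivAt_iff_tendsto_slope.1 (hd c))
    refine this.congr fun q => ?_
    simp [slope_def_field]
  have h := (key x).div (key 1) (by simp)
  have e : (2 * x) / (2 * 1 : ℂ) = x := by field_simp
  rw [e] at h
  refine h.congr' ?_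
  filter_upwards [self_mem_nhdsWithin] with q hq
  have hq1 : q - 1 ≠ 0 := sub_ne_zero.2 hq
  simp only [qNumber, Pi.div_apply, Complex.cpow_one, Complex.cpow_neg_one]
  rw [div_div_div_cancel_right₀ hq1]

theorem prod_Icc_natCast (s : ℕ) : ∏ n ∈ Finset.Icc 1 s, (n : ℂ) = s.factorial := by
  rw [← Finset.prod_Ico_id_eq_factorial]; push_cast; rfl

theorem qFactorial_tendsto (s : ℕ) :
    Filter.Tendsto (fun q => qFactorial q s) (nhdsWithin 1 {1}ᶜ) (nhds (s.factorial : ℂ)) := by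
  rw [← prod_Icc_natCast]
  exact tendsto_finsetProd _ fun n _ => qNumber_tendsto n

namespace SimpleLieType

theorem tendsto_multiset_map_prod {l : Filter ℂ} (E : Multiset ℕ) (f : ℂ → ℕ → ℂ) (g : ℕ → ℂ)
    (h : ∀ s ∈ E, Filter.Tendsto (fun q => f q s) l (nhds (g s))) :
    Filter.Tendsto (fun q => (E.map (f q)).prod) l (nhds (E.map g).prod) := by
  induction E using Multiset.induction_on with
  | empty => simpa using tendsto_const_nhds
  | cons a E ih =>
    simp only [Multiset.map_cons, Multiset.prod_cons]
    exact (h a (by simp)).mul (ih fun s hs => h s (by simp [hs]))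

theorem qFactorialB_tendsto (s : ℕ) (hs : 0 < s) :
    Filter.Tendsto (fun q => qFactorialB q s) (nhdsWithin 1 {1}ᶜ)
      (nhds ((s.factorial : ℂ) / 2)) := by
  have : (s.factorial : ℂ) / 2 = (s : ℂ) / 2 * ((s - 1).factorial : ℂ) := by
    rw [← Nat.mul_factorial_pred hs.ne']; push_cast; ring
  rw [this]
  exact (qNumber_tendsto _).mul (qFactorial_tendsto _)

/-- The middle factor n = i + 1 is not halved, so only 2i of the 2i + 1 factors contribute a 1/2. -/
theorem qFactorialC_tendsto (i : ℕ) :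
    Filter.Tendsto (fun q => qFactorialC q (2 * i + 1)) (nhdsWithin 1 {1}ᶜ)
      (nhds (((2 * i + 1).factorial : ℂ) / 2 ^ (2 * i))) := by
  have : ((2 * i + 1).factorial : ℂ) / 2 ^ (2 * i) = ∏ n ∈ Finset.Icc 1 (2 * i + 1),
      (if 2 * n = 2 * i + 1 + 1 then (n : ℂ) else (n : ℂ) / 2) := by
    have h1 : ∀ n ∈ Finset.Icc 1 (2 * i + 1),
        (if 2 * n = 2 * i + 1 + 1 then (n : ℂ) else (n : ℂ) / 2) =
          (n : ℂ) * ((1 / 2) * if n = i + 1 then 2 else 1) := by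
      intro n _
      by_cases hn : n = i + 1
      · rw [if_pos (by omega), if_pos hn]; ring
      · rw [if_neg (by omega), if_neg hn]; ring
    rw [Finset.prod_congr rfl h1, Finset.prod_mul_distrib, Finset.prod_mul_distrib,
      Finset.prod_ite_eq' (Finset.Icc 1 (2 * i + 1)) (i + 1), if_pos (by simp; omega),
      prod_Icc_natCast]
    simp only [Finset.prod_const, Nat.card_Icc]
    push_cast
    simp only [one_div, inv_pow, pow_succ]
    field_simp
  rw [this]
  refine tendsto_finsetProd _ fun n _ => ?_
  split_ifs
  · exact qNumber_tendsto _
  · exact qNumber_tendsto _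

theorem quantumSuperfactorial_tendsto (X : SimpleLieType) :
    Filter.Tendsto X.quantumSuperfactorial (nhdsWithin 1 {1}ᶜ) (nhds (X.superfactorial : ℂ)) := by
  have main : ∀ E : Multiset ℕ, Filter.Tendsto (fun q => (E.map (qFactorial q)).prod)
      (nhdsWithin 1 {1}ᶜ) (nhds (((E.map fun s => (s.factorial : ℚ)).prod : ℚ) : ℂ)) := by
    intro E
    have e : (((E.map fun s => (s.factorial : ℚ)).prod : ℚ) : ℂ) =
        (E.map fun s => (s.factorial : ℂ)).prod := by
      rw [← Rat.coe_castHom (α := ℂ), map_multiset_prod, Multiset.map_map]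
      simp
    rw [e]
    exact tendsto_multiset_map_prod E _ _ fun s _ => qFactorial_tendsto s
  cases X with
  | A r hr => exact main _
  | D r hr => exact main _
  | E₆ => exact main _
  | E₇ => exact main _
  | E₈ => exact main _
  | B r hr =>
    have e : ((B r hr).superfactorial : ℂ) =
        ((B r hr).exponents.map fun s => (s.factorial : ℂ) / 2).prod := by
      simp only [superfactorial, exponents, Multiset.map_map]
      rw [← Rat.coe_castHom (α := ℂ), map_div₀, map_multiset_prod, Multiset.map_map]
      simp [Multiset.prod_map_div]
    rw [e]
    refine tendsto_multiset_map_prod _ _ _ fun s hs => qFactorialB_tendsto s ?_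
    simp only [exponents, Multiset.mem_map] at hs
    obtain ⟨i, -, rfl⟩ := hs
    omega
  | C r hr =>
    have e : ((C r hr).superfactorial : ℂ) =
        ((Multiset.range r).map fun i => (((2 * i + 1).factorial : ℂ) / 2 ^ (2 * i))).prod := by
      simp only [superfactorial, exponents, Multiset.map_map]
      rw [← Rat.coe_castHom (α := ℂ), map_div₀, map_multiset_prod, Multiset.map_map]
      rw [Multiset.prod_map_div]
      congr 1
      · have : ((Multiset.range r).map fun i => (2 : ℂ) ^ (2 * i)).prod =
            ∏ i ∈ Finset.range r, (2 : ℂ) ^ (2 * i) := rfl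
        rw [this, Finset.prod_pow_eq_pow_sum, ← Finset.mul_sum, mul_comm 2,
          Finset.sum_range_id_mul_two]
        simp
    rw [e]
    have := tendsto_multiset_map_prod (l := nhdsWithin 1 {1}ᶜ) (Multiset.range r)
      (fun q i => qFactorialC q (2 * i + 1)) _ fun i _ => qFactorialC_tendsto i
    refine this.congr fun q => ?_
    simp only [quantumSuperfactorial, exponents, Multiset.map_map]
    rfl
  | F₄ =>
    have e : (F₄.superfactorial : ℂ) = (1 / 2) ^ 2 * 1 ^ 3 * (3 / 2) * 2 ^ 3 * (5 / 2) ^ 2 * 3 ^ 3 *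
        (7 / 2) * 4 ^ 2 * (9 / 2) * 5 ^ 2 * (11 / 2) * 6 * 7 * 8 := by
      simp [superfactorial, exponents, Nat.factorial]
      norm_num
    rw [e]
    have t := qNumber_tendsto
    have t2 := fun x n => (qNumber_tendsto x).pow n
    have := (((((((((((((t2 (1 / 2) 2).mul (t2 1 3)).mul (t (3 / 2))).mul
      (t2 2 3)).mul (t2 (5 / 2) 2)).mul (t2 3 3)).mul (t (7 / 2))).mul
      (t2 4 2)).mul (t (9 / 2))).mul (t2 5 2)).mul (t (11 / 2))).mul (t 6)).mul
      (t 7)).mul (t 8)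
    exact this
  | G₂ =>
    have e : (G₂.superfactorial : ℂ) = (5 / 3) * (4 / 3) * 3 * 2 * 1 * (1 / 3) := by
      simp [superfactorial, exponents, Nat.factorial]
      norm_num
    rw [e]
    have t := qNumber_tendsto
    exact (((((t (5 / 3)).mul (t (4 / 3))).mul (t 3)).mul (t 2)).mul (t 1)).mul (t (1 / 3))

end SimpleLieType

/-! ### The root of unity approaches 1 -/

namespace LieLevel

variable {ι M N : Type*} [Fintype ι] [AddCommGroup M] [Module ℂ M] [AddCommGroup N] [Module ℂ N]
  {P : RootPairing ι ℂ M N} [P.IsRootSystem] [P.IsIrreducible] (b : P.Base)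

theorem rootOfUnity_eq (k : ℕ) : rootOfUnity b k =
    Complex.exp (((Real.pi / ((dualCoxeterNumber b + k : ℕ) : ℝ) : ℝ) : ℂ) * Complex.I) := by
  rw [rootOfUnity]; congr 1; push_cast; ring

theorem rootOfUnity_tendsto : Filter.Tendsto (rootOfUnity b) Filter.atTop (nhdsWithin 1 {1}ᶜ) := by
  refine tendsto_nhdsWithin_iff.2 ⟨?_, ?_⟩
  · have h : Filter.Tendsto (fun k : ℕ => Real.pi / ((dualCoxeterNumber b + k : ℕ) : ℝ))
        Filter.atTop (nhds 0) := by
      generalize dualCoxeterNumber b = g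
      have h0 : Filter.Tendsto (fun k : ℕ => ((g + k : ℕ) : ℝ)) Filter.atTop Filter.atTop :=
        tendsto_natCast_atTop_atTop.comp
          (Filter.tendsto_add_atTop_nat g |>.congr fun k => add_comm k g)
      exact Filter.Tendsto.div_atTop tendsto_const_nhds h0
    have h2 : Filter.Tendsto (fun x : ℝ => Complex.exp ((x : ℂ) * Complex.I)) (nhds 0) (nhds 1) := by
      have : Continuous (fun x : ℝ => Complex.exp ((x : ℂ) * Complex.I)) := by fun_prop
      simpa using this.tendsto 0
    refine (h2.comp h).congr fun k => ?_
    rw [rootOfUnity_eq]; rfl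
  -- The limit is taken in a punctured neighbourhood: q ≠ 1 because its imaginary part sin(π/(g+k))
  -- is positive once g + k ≥ 2.
  · filter_upwards [Filter.eventually_gt_atTop 1] with k hk h1
    have hg : 1 ≤ dualCoxeterNumber b := by simp [dualCoxeterNumber]
    rw [Set.mem_singleton_iff, rootOfUnity_eq] at h1
    have h2 := congrArg Complex.im h1
    rw [Complex.exp_ofReal_mul_I_im] at h2
    have hp : (2 : ℝ) ≤ ((dualCoxeterNumber b + k : ℕ) : ℝ) := by exact_mod_cast (by omega)
    refine (Real.sin_pos_of_pos_of_lt_pi (by positivity) ?_).ne' h2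
    rw [div_lt_iff₀ (by linarith)]
    nlinarith [Real.pi_pos]

end LieLevel

/-! ### Integer coefficients of roots and coroots -/

namespace LieLevel

open Module

section Coefficients

variable {ι M N : Type*} [AddCommGroup M] [Module ℂ M] [AddCommGroup N] [Module ℂ N]
  {P : RootPairing ι ℂ M N} (b : P.Base)

/-- The integer coefficients of a root in the basis of simple roots. -/
def coef (i : ι) : b.support → ℤ := fun j => b.toWeightBasisInt.repr (P.rootSpanMem ℤ i) j

theorem root_eq_sum (i : ι) : P.root i = ∑ j : b.support, coef b i j • P.root j := by
  have h := congrArg (Subtype.val) (b.toWeightBasisInt.sum_repr (P.rootSpanMem ℤ i))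
  rw [AddSubmonoidClass.coe_finsetSum] at h
  simp only [Submodule.coe_smul, RootPairing.Base.coe_toWeightBasisInt_apply] at h
  exact h.symm

theorem coef_eq_of_root_eq {i : ι} {c : b.support → ℤ} (h : P.root i = ∑ j, c j • P.root j) :
    coef b i = c := by
  funext j
  exact Fintype.linearIndependent_iffₛ.mp (b.linearIndepOn_root.restrict_scalars' ℤ) _ _
    ((root_eq_sum b i).symm.trans h) j

theorem coef_simple [DecidableEq b.support] (j : b.support) : coef b j = Pi.single j 1 :=
  coef_eq_of_root_eq b <| by simp [Pi.single_apply]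

theorem height_eq_sum_coef (i : ι) : b.height i = ∑ j, coef b i j := by
  classical
  have h : P.root i = ∑ j ∈ b.support,
      (fun j => if h : j ∈ b.support then coef b i ⟨j, h⟩ else 0) j • P.root j := by
    rw [← Finset.sum_coe_sort, root_eq_sum b i]
    exact Finset.sum_congr rfl fun j _ => by simp
  rw [RootPairing.Base.height_eq_sum h, ← Finset.sum_coe_sort]
  exact Finset.sum_congr rfl fun j _ => by simp

theorem coef_nonneg_or_nonpos (i : ι) : (0 ≤ coef b i) ∨ (coef b i ≤ 0) := by
  obtain ⟨f, -, hf, h⟩ := b.exists_root_eq_sum_int i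
  rw [← Finset.sum_coe_sort] at h
  rw [coef_eq_of_root_eq b h]
  rcases hf with hf | hf
  · exact Or.inl fun j => hf.le j
  · exact Or.inr fun j => hf.le j

theorem coef_nonneg {i : ι} (hi : b.IsPos i) : 0 ≤ coef b i := by
  refine (coef_nonneg_or_nonpos b i).resolve_right fun h => ?_
  rw [RootPairing.Base.isPos_iff, height_eq_sum_coef] at hi
  exact absurd (Finset.sum_nonpos fun j _ => h j) (not_le.2 hi)

theorem coef_add {i j k : ι} (h : P.root k = P.root i + P.root j) :
    coef b k = coef b i + coef b j :=
  coef_eq_of_root_eq b <| by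
    simp only [h, Pi.add_apply, add_smul, Finset.sum_add_distrib, ← root_eq_sum]

theorem coef_add_zsmul {i j k : ι} {n : ℤ} (h : P.root k = P.root i + n • P.root j) :
    coef b k = coef b i + n • coef b j :=
  coef_eq_of_root_eq b <| by
    simp only [h, Pi.add_apply, Pi.smul_apply, smul_assoc, add_smul, Finset.sum_add_distrib,
      ← Finset.smul_sum, ← root_eq_sum]

/-- The integer coefficients of a coroot in the basis of simple coroots. -/
def cocoef (i : ι) : b.support → ℤ := coef b.flip i

theorem coroot_eq_sum (i : ι) : P.coroot i = ∑ j : b.support, cocoef b i j • P.coroot j :=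
  root_eq_sum b.flip i

theorem cocoef_simple [DecidableEq b.support] (j : b.support) : cocoef b j = Pi.single j 1 :=
  coef_eq_of_root_eq b.flip (c := Pi.single (M := fun _ : b.support => ℤ) j 1) <| by
    change P.coroot j = ∑ k : b.support, (Pi.single (M := fun _ : b.support => ℤ) j 1) k • P.coroot k
    simp [Pi.single_apply]

/-- The evaluation of the `i`-th coroot on an integral weight, given by its coordinates in the
basis of fundamental weights. -/
def ev (i : ι) : (b.support → ℤ) →ₗ[ℤ] ℤ := ∑ j, cocoef b i j • LinearMap.proj j

theorem ev_apply (i : ι) (x : b.support → ℤ) : ev b i x = ∑ j, cocoef b i j * x j := by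
  simp [ev, LinearMap.sum_apply]

theorem ev_simple (j : b.support) (x : b.support → ℤ) : ev b j x = x j := by
  classical
  simp [ev_apply, cocoef_simple, Pi.single_apply]

variable [P.IsCrystallographic]

/-- The coordinates of a root in the basis of fundamental weights. -/
def rt (i : ι) : b.support → ℤ := fun j => P.pairingIn ℤ i j

end Coefficients

/-! ### Integral weights and reflections in coordinates -/

variable {ι M N : Type*} [Fintype ι] [AddCommGroup M] [Module ℂ M] [AddCommGroup N] [Module ℂ N]
  {P : RootPairing ι ℂ M N} [P.IsRootSystem] (b : P.Base)

/-- The weight with given integral coordinates. -/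
def wt : (b.support → ℤ) →ₗ[ℤ] M := ∑ j, (LinearMap.proj j).smulRight (fundamentalWeight b j)

theorem wt_apply (x : b.support → ℤ) : wt b x = ∑ j, x j • fundamentalWeight b j := by
  simp [wt, LinearMap.sum_apply]

theorem coroot'_fundamentalWeight [DecidableEq b.support] (i j : b.support) :
    P.coroot' i (fundamentalWeight b j) = if i = j then 1 else 0 := by
  have h : P.toLinearMap (fundamentalWeight b j) (P.coroot i) =
      b.toCoweightBasis.coord j (P.coroot i) := by
    rw [fundamentalWeight, LinearMap.apply_symm_toPerfPair_self]
  change P.toLinearMap (fundamentalWeight b j) (P.coroot i) = _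
  rw [h, Basis.coord_apply, RootPairing.Base.toCoweightBasis_repr_coroot, Finsupp.single_apply]

theorem coroot'_simple_wt (j : b.support) (x : b.support → ℤ) : P.coroot' j (wt b x) = x j := by
  classical
  rw [wt_apply, map_sum]
  simp only [map_zsmul, coroot'_fundamentalWeight, smul_ite, smul_zero]
  rw [Finset.sum_ite_eq Finset.univ j, if_pos (Finset.mem_univ j)]
  simp

theorem coroot'_eq_sum (i : ι) (x : M) :
    P.coroot' i x = ∑ j : b.support, cocoef b i j • P.coroot' j x := by
  change P.toLinearMap x (P.coroot i) = ∑ j : b.support, cocoef b i j • P.toLinearMap x (P.coroot j)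
  rw [coroot_eq_sum b i]
  simp

theorem cast_ev (i : ι) (x : b.support → ℤ) : (ev b i x : ℂ) = P.coroot' i (wt b x) := by
  rw [coroot'_eq_sum b, ev_apply]
  simp only [coroot'_simple_wt, Int.cast_sum, Int.cast_mul, zsmul_eq_mul]

theorem eq_of_coroot'_eq {x y : M} (h : ∀ j : b.support, P.coroot' j x = P.coroot' j y) :
    x = y := by
  rw [← sub_eq_zero, P.eq_zero_iff_forall_coroot'_eq_zero]
  intro i
  rw [coroot'_eq_sum b]
  simp only [map_sub, h, sub_self, smul_zero, Finset.sum_const_zero]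

theorem wt_injective : Function.Injective (wt b) := fun x y h => by
  funext j
  have := congrArg (P.coroot' j) h
  rw [coroot'_simple_wt, coroot'_simple_wt] at this
  exact_mod_cast this

variable [P.IsCrystallographic]

theorem wt_rt (i : ι) : wt b (rt b i) = P.root i := by
  refine eq_of_coroot'_eq b fun j => ?_
  rw [coroot'_simple_wt, rt, RootPairing.root_coroot'_eq_pairing]
  exact P.algebraMap_pairingIn ℤ i j

theorem ev_rt (i j : ι) : ev b i (rt b j) = P.pairingIn ℤ j i := by
  have h := cast_ev b i (rt b j)
  rw [wt_rt, RootPairing.root_coroot'_eq_pairing, ← P.algebraMap_pairingIn ℤ j i,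
    eq_intCast] at h
  exact_mod_cast h

theorem ev_rt_self (i : ι) : ev b i (rt b i) = 2 := by rw [ev_rt]; simp

theorem rt_eq_sum (i : ι) : rt b i = ∑ j, coef b i j • rt b j :=
  wt_injective b <| by
    rw [map_sum, wt_rt]; simp only [map_zsmul, wt_rt]; exact root_eq_sum b i

theorem rt_injective : Function.Injective (rt b) := fun i j h => P.root.injective <| by
  rw [← wt_rt b, h, wt_rt]

/-- The reflection in a root, on integral weights. -/
def refl (i : ι) (x : b.support → ℤ) : b.support → ℤ := x - ev b i x • rt b i

theorem wt_refl (i : ι) (x : b.support → ℤ) : wt b (refl b i x) = P.reflection i (wt b x) := by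
  rw [refl, map_sub, map_zsmul, wt_rt, RootPairing.reflection_apply, ← cast_ev, Int.cast_smul_eq_zsmul]

theorem refl_refl (i : ι) (x : b.support → ℤ) : refl b i (refl b i x) = x :=
  wt_injective b <| by rw [wt_refl, wt_refl, RootPairing.reflection_same]

theorem ev_refl (i j : ι) (x : b.support → ℤ) :
    ev b j (refl b i x) = ev b (P.reflectionPerm i j) x := by
  have h : (ev b j (refl b i x) : ℂ) = ev b (P.reflectionPerm i j) x := by
    rw [cast_ev, cast_ev, wt_refl, RootPairing.coroot'_reflection]
  exact_mod_cast h

theorem rt_reflectionPerm (i j : ι) : rt b (P.reflectionPerm i j) = refl b i (rt b j) :=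
  wt_injective b <| by rw [wt_refl, wt_rt, wt_rt, RootPairing.root_reflectionPerm]

theorem rt_neg (i : ι) : rt b (P.reflectionPerm i i) = -rt b i := by
  rw [rt_reflectionPerm, refl, ev_rt_self]; simp [two_smul]

theorem ev_neg (i : ι) (x : b.support → ℤ) : ev b (P.reflectionPerm i i) x = -ev b i x := by
  rw [← ev_refl, refl, map_sub, map_zsmul, ev_rt_self]; simp; ring

theorem root_reflectionPerm_eq (i j : ι) :
    P.root (P.reflectionPerm i j) = P.root j + (-P.pairingIn ℤ j i) • P.root i := by
  rw [RootPairing.root_reflectionPerm, RootPairing.reflection_apply_root' ℤ, neg_smul,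
    sub_eq_add_neg]

/-! ### The canonical invariant form and root lengths -/

/-- The canonical Weyl invariant form on integral weights. -/
def form : LinearMap.BilinForm ℤ (b.support → ℤ) := ∑ i, (ev b i).smulRight (ev b i)

theorem form_apply (x y : b.support → ℤ) : form b x y = ∑ i, ev b i x * ev b i y := by
  simp [form, LinearMap.sum_apply]

theorem form_comm (x y : b.support → ℤ) : form b x y = form b y x := by
  simp [form_apply, mul_comm]

theorem cast_form (x y : b.support → ℤ) : (form b x y : ℂ) = P.RootForm (wt b x) (wt b y) := by
  simp [form_apply, RootPairing.rootForm_apply_apply, cast_ev]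

theorem form_refl_refl (i : ι) (x y : b.support → ℤ) :
    form b (refl b i x) (refl b i y) = form b x y := by
  simp only [form_apply, ev_refl]
  exact Equiv.sum_comp (P.reflectionPerm i) fun j => ev b j x * ev b j y

/-- Reflect both arguments of the form: the value is unchanged while the root changes sign. This is
⟨x, α^∨⟩ = 2(x, α)/(α, α), the bridge between coroot evaluations and the form. -/
theorem two_form_rt (i : ι) (x : b.support → ℤ) :
    2 * form b x (rt b i) = ev b i x * form b (rt b i) (rt b i) := by
  have h := form_refl_refl b i x (rt b i)
  rw [← rt_reflectionPerm, rt_neg, refl] at h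
  simp only [map_sub, map_neg, map_zsmul, LinearMap.sub_apply, LinearMap.smul_apply,
    smul_eq_mul] at h
  linarith

theorem eq_zero_of_ev_eq_zero {x : b.support → ℤ} (h : ∀ i, ev b i x = 0) : x = 0 := by
  funext j
  rw [← ev_simple b j x, h]; rfl

theorem form_self_pos {x : b.support → ℤ} (hx : x ≠ 0) : 0 < form b x x := by
  rw [form_apply]
  refine lt_of_le_of_ne (Finset.sum_nonneg fun i _ => mul_self_nonneg _) fun h => hx ?_
  refine eq_zero_of_ev_eq_zero b fun i => ?_
  have := (Finset.sum_eq_zero_iff_of_nonneg fun i _ => mul_self_nonneg (ev b i x)).1 h.symm i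
    (Finset.mem_univ i)
  exact mul_self_eq_zero.1 this

theorem form_self_nonneg (x : b.support → ℤ) : 0 ≤ form b x x := by
  rw [form_apply]; exact Finset.sum_nonneg fun i _ => mul_self_nonneg _

/-- The squared length of a root for the canonical form. -/
def len (i : ι) : ℤ := form b (rt b i) (rt b i)

theorem len_pos (i : ι) : 0 < len b i := form_self_pos b fun h => by
  have := ev_rt_self b i
  simp [h] at this

theorem len_reflectionPerm (i j : ι) : len b (P.reflectionPerm i j) = len b j := by
  rw [len, rt_reflectionPerm, form_refl_refl, len]

theorem pairingIn_mul_len (i j : ι) :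
    P.pairingIn ℤ i j * len b j = P.pairingIn ℤ j i * len b i := by
  rw [← ev_rt b j i, ← ev_rt b i j, len, len, ← two_form_rt, ← two_form_rt, form_comm]

end LieLevel

namespace LieLevel

variable {ι M N : Type*} [Fintype ι] [AddCommGroup M] [Module ℂ M] [AddCommGroup N] [Module ℂ N]
  {P : RootPairing ι ℂ M N} [P.IsRootSystem] [P.IsIrreducible] [P.IsCrystallographic]
  [P.IsReduced] (b : P.Base)

/-! ### The highest root and reflections in coordinates -/

theorem height_le_highestRoot (i : ι) : b.height i ≤ b.height (highestRoot b) :=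
  (exists_highestRoot b).choose_spec i

theorem height_neg (i : ι) : b.height (P.reflectionPerm i i) = -b.height i :=
  b.height_reflectionPerm_self i

theorem support_nonempty : Nonempty b.support := by
  obtain ⟨i, -⟩ := exists_highestRoot b
  have : Nonempty ι := ⟨i⟩
  exact b.support_nonempty.to_subtype

theorem isPos_highestRoot : b.IsPos (highestRoot b) := by
  obtain ⟨j⟩ := support_nonempty b
  have h := height_le_highestRoot b j
  rw [RootPairing.Base.height_one_of_mem_support j.2] at h
  rw [RootPairing.Base.isPos_iff]; omega

theorem pairingIn_eq_sum (i k : ι) :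
    P.pairingIn ℤ i k = ∑ j, coef b i j * P.pairingIn ℤ j k := by
  rw [← ev_rt b, rt_eq_sum b i, map_sum]
  simp only [map_zsmul, ev_rt, smul_eq_mul]

theorem isPos_or_neg (i : ι) : b.IsPos i ∨ b.IsPos (P.reflectionPerm i i) :=
  RootPairing.Base.IsPos.or_neg b i

theorem not_isPos_neg {i : ι} (h : b.IsPos i) : ¬ b.IsPos (P.reflectionPerm i i) := by
  rw [RootPairing.Base.isPos_iff] at *
  rw [height_neg]; omega

theorem neg_neg_eq (i : ι) :
    P.reflectionPerm (P.reflectionPerm i i) (P.reflectionPerm i i) = i := by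
  apply P.root.injective
  rw [RootPairing.root_reflectionPerm, RootPairing.reflection_apply_self,
    RootPairing.root_reflectionPerm, RootPairing.reflection_apply_self, neg_neg]

/-- A root with no higher neighbour has nonnegative pairing with all positive roots. -/
theorem pairingIn_nonneg_of_forall_height_le {i : ι} (hi : b.IsPos i)
    (h : ∀ k, P.root k = P.root (highestRoot b) + P.root i → False) :
    0 ≤ P.pairingIn ℤ (highestRoot b) i := by
  by_contra! hneg
  have hne : P.root (highestRoot b) ≠ -P.root i := by
    intro h1
    have h2 : highestRoot b = P.reflectionPerm i i := P.root.injective <| by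
      rw [h1, RootPairing.root_reflectionPerm, RootPairing.reflection_apply_self]
    have h3 := isPos_highestRoot b
    rw [h2] at h3
    exact not_isPos_neg b hi h3
  obtain ⟨k, hk⟩ := P.root_add_root_mem_of_pairingIn_neg hneg hne
  exact h k hk

/-- Otherwise the sum of the two roots would be a root higher than θ. -/
theorem pairingIn_highestRoot_nonneg {i : ι} (hi : b.IsPos i) :
    0 ≤ P.pairingIn ℤ (highestRoot b) i := by
  refine pairingIn_nonneg_of_forall_height_le b hi fun k hk => ?_
  have h1 := height_le_highestRoot b k
  rw [b.height_add hk] at h1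
  rw [RootPairing.Base.isPos_iff] at hi
  omega

theorem pairingIn_nonneg_comm {i j : ι} (h : 0 ≤ P.pairingIn ℤ i j) : 0 ≤ P.pairingIn ℤ j i := by
  by_contra! h1
  exact absurd (P.pairingIn_lt_zero_iff ℤ |>.1 h1) (not_lt.2 h)

theorem pairingIn_highestRoot_nonneg' {i : ι} (hi : b.IsPos i) :
    0 ≤ P.pairingIn ℤ i (highestRoot b) :=
  pairingIn_nonneg_comm (pairingIn_highestRoot_nonneg b hi)

/-- A vanishing coefficient spreads along the Dynkin diagram. If the coefficient at i is zero, all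
terms of the pairing of θ with the i-th simple coroot are nonpositive, while the pairing itself is
nonnegative. Hence the coefficients at the neighbours of i vanish too, and since the diagram is
connected, so do all of them. -/
theorem coef_highestRoot_pos (j : b.support) : 0 < coef b (highestRoot b) j := by
  refine lt_of_le_of_ne (coef_nonneg b (isPos_highestRoot b) j) fun h0 => ?_
  have step : ∀ i j : b.support, coef b (highestRoot b) i = 0 → b.cartanMatrix j i ≠ 0 →
      coef b (highestRoot b) j = 0 := by
    intro i j hi hji
    have h1 := pairingIn_highestRoot_nonneg b (RootPairing.Base.isPos_of_mem_support i.2)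
    rw [pairingIn_eq_sum b] at h1
    have h2 : ∀ k ∈ Finset.univ, coef b (highestRoot b) k * P.pairingIn ℤ k i ≤ 0 := by
      intro k _
      by_cases hk : k = i
      · rw [hk, hi, zero_mul]
      · exact mul_nonpos_of_nonneg_of_nonpos (coef_nonneg b (isPos_highestRoot b) k)
          (b.pairingIn_le_zero_of_ne (fun h => hk (Subtype.ext h)) k.2 i.2)
    have h3 := (Finset.sum_eq_zero_iff_of_nonpos h2).1
      (le_antisymm (Finset.sum_nonpos h2) h1) j (Finset.mem_univ j)
    exact (mul_eq_zero.1 h3).resolve_right hji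
  have h1 : ∀ k, coef b (highestRoot b) k = 0 := fun k =>
    RootPairing.Base.induction_on_cartanMatrix b (fun k => coef b (highestRoot b) k = 0) h0.symm step
  have h2 := isPos_highestRoot b
  rw [RootPairing.Base.isPos_iff, height_eq_sum_coef, Finset.sum_eq_zero fun k _ => h1 k] at h2
  exact lt_irrefl _ h2

/-- The highest root dominates all roots coefficientwise. -/
theorem coef_le_highestRoot (i : ι) : coef b i ≤ coef b (highestRoot b) := by
  by_contra hi
  -- A counterexample m of maximal height is positive and dominant, since adding a simple root would
  -- give a higher counterexample. It therefore pairs strictly positively with θ, and θ − m is zero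
  -- or a root. If that root is positive, θ dominates m; if it is negative, m is higher than θ.
  obtain ⟨m, hm, hmax⟩ := (Set.toFinite {i : ι | ¬ coef b i ≤ coef b (highestRoot b)}).exists_maximalFor
    b.height _ ⟨i, hi⟩
  have hθ := coef_highestRoot_pos b
  have hmneg : ¬ coef b m ≤ 0 := fun h => hm (h.trans fun j => (hθ j).le)
  have hm0 : 0 ≤ coef b m := (coef_nonneg_or_nonpos b m).resolve_right hmneg
  have hmpos : b.IsPos m := by
    rw [RootPairing.Base.isPos_iff', height_eq_sum_coef]
    exact Finset.sum_nonneg fun j _ => hm0 j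
  have hdom : ∀ j : b.support, 0 ≤ P.pairingIn ℤ m j := by
    intro j
    by_contra! hneg
    have hjpos := RootPairing.Base.isPos_of_mem_support j.2
    have hne : P.root m ≠ -P.root j := by
      intro h1
      have h2 : m = P.reflectionPerm j j := P.root.injective <| by
        rw [h1, RootPairing.root_reflectionPerm, RootPairing.reflection_apply_self]
      rw [h2] at hmpos
      exact not_isPos_neg b hjpos hmpos
    obtain ⟨k, hk⟩ := P.root_add_root_mem_of_pairingIn_neg hneg hne
    have hc := coef_add b hk
    have hkmem : ¬ coef b k ≤ coef b (highestRoot b) := fun h => hm <| le_trans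
      (by rw [hc]; exact le_add_of_nonneg_right (coef_nonneg b hjpos)) h
    have h3 := hmax hkmem
    rw [b.height_add hk, RootPairing.Base.height_one_of_mem_support j.2] at h3
    have := h3 (by omega)
    omega
  have hpair : 0 < P.pairingIn ℤ (highestRoot b) m := by
    refine lt_of_le_of_ne (pairingIn_highestRoot_nonneg b hmpos) fun h0 => ?_
    rw [pairingIn_eq_sum b] at h0
    have hnn : ∀ j ∈ Finset.univ, 0 ≤ coef b (highestRoot b) j * P.pairingIn ℤ j m := fun j _ =>
      mul_nonneg (hθ j).le (pairingIn_nonneg_comm (hdom j))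
    have h1 : ∀ j : b.support, P.pairingIn ℤ j m = 0 := fun j =>
      (mul_eq_zero.1 ((Finset.sum_eq_zero_iff_of_nonneg hnn).1 h0.symm j
        (Finset.mem_univ j))).resolve_left (hθ j).ne'
    have h2 := pairingIn_eq_sum b m m
    rw [Finset.sum_eq_zero fun j _ => by rw [h1, mul_zero]] at h2
    simp at h2
  rcases eq_or_ne (highestRoot b) m with h | h
  · exact hm (h ▸ le_rfl)
  obtain ⟨k, hk⟩ := P.root_sub_root_mem_of_pairingIn_pos hpair h
  have hc : coef b (highestRoot b) = coef b k + coef b m := coef_add b (by rw [hk]; abel)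
  rcases isPos_or_neg b k with hkp | hkp
  · exact hm (by rw [hc]; exact le_add_of_nonneg_left (coef_nonneg b hkp))
  · have h1 := b.height_sub hk
    rw [RootPairing.Base.isPos_iff, height_neg] at hkp
    have := height_le_highestRoot b m
    omega

theorem form_nonneg_of_dominant {x y : b.support → ℤ} (hx : 0 ≤ x) (c : b.support → ℤ) (hc : 0 ≤ c)
    (hy : y = ∑ j, c j • rt b j) : 0 ≤ form b x y := by
  rw [hy, map_sum]
  refine Finset.sum_nonneg fun j _ => ?_
  rw [map_zsmul]
  refine mul_nonneg (hc j) ?_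
  have := two_form_rt b j x
  rw [ev_simple] at this
  have h2 := mul_nonneg (hx j) (len_pos b j).le
  rw [len] at h2
  linarith

/-- The highest root is long. -/
theorem len_le_highestRoot (i : ι) : len b i ≤ len b (highestRoot b) := by
  -- Among the roots of one length, one of maximal height is dominant. Since θ is dominant too and θ
  -- − m is a nonnegative combination of simple roots, (θ, θ) ≥ (θ, m) ≥ (m, m).
  obtain ⟨m, hm, hmax⟩ := (Set.toFinite {k : ι | len b k = len b i}).exists_maximalFor
    b.height _ ⟨i, rfl⟩
  have hdom : 0 ≤ rt b m := by
    intro j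
    by_contra! hneg
    have hneg' : P.pairingIn ℤ m j < 0 := hneg
    have h1 : len b (P.reflectionPerm j m) = len b i := (len_reflectionPerm b _ _).trans hm
    have h2 := b.height_add_zsmul (root_reflectionPerm_eq (j : ι) m)
    rw [RootPairing.Base.height_one_of_mem_support j.2, smul_eq_mul, mul_one] at h2
    have := hmax h1 (by rw [h2]; omega)
    rw [h2] at this
    omega
  have hθdom : 0 ≤ rt b (highestRoot b) := fun j =>
    pairingIn_highestRoot_nonneg b (RootPairing.Base.isPos_of_mem_support j.2)
  have hsub : rt b (highestRoot b) - rt b m = ∑ j, (coef b (highestRoot b) - coef b m) j • rt b j := by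
    rw [rt_eq_sum b (highestRoot b), rt_eq_sum b m]
    simp only [Pi.sub_apply, sub_smul, Finset.sum_sub_distrib]
  have hc : 0 ≤ coef b (highestRoot b) - coef b m := sub_nonneg.2 (coef_le_highestRoot b m)
  have h1 := form_nonneg_of_dominant b hdom _ hc hsub
  have h2 := form_nonneg_of_dominant b hθdom _ hc hsub
  rw [map_sub] at h1 h2
  rw [form_comm b (rt b m) (rt b (highestRoot b))] at h1
  rw [← show len b m = len b i from hm]
  simp only [len]
  linarith

/-- Because θ is long, the list of possible pairs of Cartan integers allows nothing below −1 except
−2 at −θ. This bounds the change of level of an affine root under the affine simple reflection. -/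
theorem neg_one_le_pairingIn_highestRoot {i : ι}
    (hi : i ≠ P.reflectionPerm (highestRoot b) (highestRoot b)) :
    -1 ≤ P.pairingIn ℤ i (highestRoot b) := by
  have h1 := P.pairingIn_pairingIn_mem_set_of_isCrystal_of_isRed i (highestRoot b)
  have h2 := pairingIn_mul_len b i (highestRoot b)
  have h3 := len_le_highestRoot b i
  have h4 := len_pos b i
  have hne : ∀ h : P.pairingIn ℤ i (highestRoot b) = -2 ∧ P.pairingIn ℤ (highestRoot b) i = -2,
      False := by
    rintro ⟨ha, hb⟩
    have hz : P.reflectionPerm (highestRoot b) (highestRoot b) ≠ i := Ne.symm hi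
    by_cases hii : P.root i = P.root (highestRoot b)
    · rw [P.root.injective hii] at ha; simp at ha
    · have hni : P.root i ≠ -P.root (highestRoot b) := fun h => hi <| P.root.injective <| by
        rw [h, RootPairing.root_reflectionPerm, RootPairing.reflection_apply_self]
      have h5 := P.pairingIn_pairingIn_mem_set_of_isCrystal_of_isRed' i (highestRoot b) hii hni
      rw [ha, hb] at h5
      simp at h5
  simp only [Set.mem_insert_iff, Set.mem_singleton_iff, Prod.mk.injEq] at h1
  rcases h1 with h | h | h | h | h | h | h | h | h | h | h | h | h <;>
    first
    | exact (hne h).elim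
    | (obtain ⟨ha, hb⟩ := h; rw [ha, hb] at h2; rw [ha]; linarith)
    | (obtain ⟨ha, hb⟩ := h; rw [ha, hb] at h2; omega)

/-! ### Long roots and the lattice they span -/

/-- The roots obtained from the highest root by simple reflections. -/
inductive IsLongRoot : ι → Prop
  | highest : IsLongRoot (highestRoot b)
  | step (j k : ι) (hj : j ∈ b.support) (hk : IsLongRoot k) : IsLongRoot (P.reflectionPerm j k)

variable {b} in
theorem IsLongRoot.len_eq {k : ι} (hk : IsLongRoot b k) : len b k = len b (highestRoot b) := by
  induction hk with
  | highest => rfl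
  | step j k hj hk ih => rw [len_reflectionPerm, ih]

theorem reflectionPerm_reflectionPerm_apply (i j k : ι) :
    P.reflectionPerm (P.reflectionPerm j i) k =
      P.reflectionPerm j (P.reflectionPerm i (P.reflectionPerm j k)) := by
  apply P.root.injective
  simp only [RootPairing.root_reflectionPerm, RootPairing.reflection_reflectionPerm]
  rfl

variable {b} in
theorem IsLongRoot.reflectionPerm {k : ι} (hk : IsLongRoot b k) (i : ι) :
    IsLongRoot b (P.reflectionPerm i k) := by
  revert k
  refine RootPairing.Base.induction_reflect (b := b) i
    (p := fun i => ∀ {k : ι}, IsLongRoot b k → IsLongRoot b (P.reflectionPerm i k)) ?_ ?_ ?_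
  · intro i hi k hk
    rw [reflectionPerm_reflectionPerm_apply]
    exact hi (hi (hi hk))
  · intro i hi k hk
    exact hk.step _ _ hi
  · intro i j hi hj k hk
    rw [reflectionPerm_reflectionPerm_apply]
    exact (hi (hk.step _ _ hj)).step _ _ hj

/-- The span of these roots is nonzero and stable under all reflections, hence everything by
irreducibility, and a coroot cannot vanish on the whole space. -/
theorem exists_isLongRoot_pairingIn_ne_zero (i : ι) :
    ∃ k, IsLongRoot b k ∧ P.pairingIn ℤ k i ≠ 0 := by
  by_contra! h
  set q : Submodule ℂ M := Submodule.span ℂ (P.root '' {k | IsLongRoot b k}) with hq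
  have h1 : q = ⊤ := by
    refine RootPairing.IsIrreducible.eq_top_of_invtSubmodule_reflection (P := P) q (fun j => ?_) ?_
    · rw [Module.End.mem_invtSubmodule, hq, Submodule.span_le]
      rintro - ⟨k, hk, rfl⟩
      refine Submodule.subset_span ⟨P.reflectionPerm j k, hk.reflectionPerm j, ?_⟩
      rw [RootPairing.root_reflectionPerm]; rfl
    · exact q.ne_bot_iff.2 ⟨_, Submodule.subset_span ⟨_, IsLongRoot.highest, rfl⟩, P.ne_zero _⟩
  have h2 : q ≤ LinearMap.ker (P.coroot' i) := by
    rw [hq, Submodule.span_le]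
    rintro - ⟨k, hk, rfl⟩
    change P.coroot' i (P.root k) = 0
    rw [RootPairing.root_coroot'_eq_pairing, ← P.algebraMap_pairingIn ℤ, h k hk, map_zero]
  have h3 : P.coroot' i (P.root i) = 0 := h2 (h1 ▸ Submodule.mem_top)
  rw [RootPairing.root_coroot'_eq_pairing] at h3
  simp at h3

/-- The squared lengths of the roots divide that of the highest root, and the corresponding
multiple of a root lies in the lattice of the long roots. -/
theorem exists_mul_len_eq (i : ι) : ∃ p : ℕ, 0 < p ∧ len b (highestRoot b) = p * len b i ∧
    p • rt b i ∈ AddSubgroup.closure (rt b '' {k | IsLongRoot b k}) := by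
  obtain ⟨k, hk, hki⟩ := exists_isLongRoot_pairingIn_ne_zero b i
  have hlen := hk.len_eq
  have hmem : ∀ n : ℤ, n = P.pairingIn ℤ k i ∨ n = -P.pairingIn ℤ k i →
      n • rt b i ∈ AddSubgroup.closure (rt b '' {k | IsLongRoot b k}) := by
    -- A long root minus its reflection in the root i is the Cartan integer times that root.
    have h1 : rt b k - rt b (P.reflectionPerm i k) ∈
        AddSubgroup.closure (rt b '' {k | IsLongRoot b k}) :=
      AddSubgroup.sub_mem _ (AddSubgroup.subset_closure ⟨k, hk, rfl⟩)
        (AddSubgroup.subset_closure ⟨_, hk.reflectionPerm i, rfl⟩)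
    rw [rt_reflectionPerm, refl, ev_rt, sub_sub_cancel] at h1
    rintro n (rfl | rfl)
    · exact h1
    · rw [neg_smul]; exact AddSubgroup.neg_mem _ h1
  by_cases hp : P.root i = P.root k ∨ P.root i = -P.root k
  · refine ⟨1, one_pos, ?_, ?_⟩
    · rcases hp with hp | hp
      · rw [P.root.injective hp, hlen]; simp
      · have : i = P.reflectionPerm k k := P.root.injective <| by
          rw [hp, RootPairing.root_reflectionPerm, RootPairing.reflection_apply_self]
        rw [this, len_reflectionPerm, hlen]; simp
    · have hk' : rt b k ∈ AddSubgroup.closure (rt b '' {k | IsLongRoot b k}) :=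
        AddSubgroup.subset_closure ⟨k, hk, rfl⟩
      rw [one_smul]
      rcases hp with hp | hp
      · rwa [P.root.injective hp]
      · have : i = P.reflectionPerm k k := P.root.injective <| by
          rw [hp, RootPairing.root_reflectionPerm, RootPairing.reflection_apply_self]
        rw [this, rt_neg]
        exact AddSubgroup.neg_mem _ hk'
  · push Not at hp
    have h1 := P.pairingIn_pairingIn_mem_set_of_isCrystal_of_isRed' i k hp.1 hp.2
    have h2 := pairingIn_mul_len b i k
    have h3 := len_le_highestRoot b i
    have h4 := len_pos b i
    -- For roots that are neither proportional nor orthogonal, with k the longer one, the Cartan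
    -- integer ⟨k, i^∨⟩ is, up to sign, the ratio of the squared lengths.
    refine ⟨(P.pairingIn ℤ k i).natAbs, Int.natAbs_pos.2 hki, ?_, ?_⟩
    · rw [hlen] at h2
      simp only [Set.mem_insert_iff, Set.mem_singleton_iff, Prod.mk.injEq] at h1
      rcases h1 with h | h | h | h | h | h | h | h | h | h | h <;> obtain ⟨ha, hb⟩ := h <;>
        rw [ha, hb] at h2 <;> rw [hb] <;> first | exact (hki hb).elim | (simp; linarith)
    · rw [← natCast_zsmul]
      exact hmem _ (by omega)

/-! ### Length ratios and the normalised pairing -/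

/-- The ratio of the squared lengths of the highest root and of a given root. -/
def ratio (i : ι) : ℕ := (exists_mul_len_eq b i).choose

theorem ratio_pos (i : ι) : 0 < ratio b i := (exists_mul_len_eq b i).choose_spec.1

theorem ratio_mul_len (i : ι) : (ratio b i : ℤ) * len b i = len b (highestRoot b) :=
  (exists_mul_len_eq b i).choose_spec.2.1.symm

theorem ratio_smul_rt_mem (i : ι) :
    ratio b i • rt b i ∈ AddSubgroup.closure (rt b '' {k | IsLongRoot b k}) :=
  (exists_mul_len_eq b i).choose_spec.2.2

theorem ratio_eq_of_len_eq {i j : ι} (h : len b i = len b j) : ratio b i = ratio b j := by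
  have h1 := ratio_mul_len b i
  rw [← ratio_mul_len b j, h] at h1
  exact_mod_cast mul_right_cancel₀ (len_pos b j).ne' h1

theorem ratio_reflectionPerm (i j : ι) : ratio b (P.reflectionPerm i j) = ratio b j :=
  ratio_eq_of_len_eq b (len_reflectionPerm b i j)

theorem ratio_highestRoot : ratio b (highestRoot b) = 1 := by
  have h1 := ratio_mul_len b (highestRoot b)
  have := mul_right_cancel₀ (len_pos b (highestRoot b)).ne' (h1.trans (one_mul _).symm)
  exact_mod_cast this

/-- The normalised pairing of a root with an integral weight. -/
def pr (i : ι) (x : b.support → ℤ) : ℚ := ev b i x / ratio b i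

/-- The pairing is with the root, not the coroot, for the form with ⟨θ, θ⟩ = 2. Under that form the
coroot of i is represented by `ratio b i` times the root. -/
theorem pr_eq_form (i : ι) (x : b.support → ℤ) :
    pr b i x = 2 * form b x (rt b i) / len b (highestRoot b) := by
  have h1 : (0 : ℚ) < ratio b i := by exact_mod_cast ratio_pos b i
  have h2 : (0 : ℚ) < len b i := by exact_mod_cast len_pos b i
  rw [pr, ← ratio_mul_len b i]
  have h3 : (2 * form b x (rt b i) : ℚ) = ev b i x * len b i := by
    exact_mod_cast two_form_rt b i x
  rw [h3]; push_cast; field_simp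

theorem pr_simple (j : b.support) (x : b.support → ℤ) : pr b j x = x j / ratio b j := by
  rw [pr, ev_simple]

theorem pr_eq_sum (i : ι) (x : b.support → ℤ) :
    pr b i x = ∑ j, (coef b i j : ℚ) * ((x j : ℚ) / ratio b j) := by
  rw [pr_eq_form, rt_eq_sum, map_sum]
  push_cast
  rw [Finset.mul_sum, Finset.sum_div]
  refine Finset.sum_congr rfl fun j _ => ?_
  rw [← pr_simple, pr_eq_form, map_zsmul]
  push_cast [smul_eq_mul]; ring

theorem pr_highestRoot (x : b.support → ℤ) : pr b (highestRoot b) x = ev b (highestRoot b) x := by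
  rw [pr, ratio_highestRoot]; simp

theorem pr_refl (i j : ι) (x : b.support → ℤ) :
    pr b j (refl b i x) = pr b (P.reflectionPerm i j) x := by
  rw [pr, pr, ev_refl, ratio_reflectionPerm]

theorem pr_neg (i : ι) (x : b.support → ℤ) : pr b (P.reflectionPerm i i) x = -pr b i x := by
  rw [pr, pr, ev_neg, ratio_reflectionPerm]; push_cast; ring

theorem pr_add (i : ι) (x y : b.support → ℤ) : pr b i (x + y) = pr b i x + pr b i y := by
  simp only [pr, map_add]; push_cast; ring

theorem pr_zsmul (i : ι) (n : ℤ) (x : b.support → ℤ) : pr b i (n • x) = n * pr b i x := by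
  simp only [pr, map_zsmul, smul_eq_mul]; push_cast; ring

theorem pr_rt_comm (i j : ι) : pr b i (rt b j) = pr b j (rt b i) := by
  rw [pr_eq_form, pr_eq_form, form_comm]

theorem pr_ratio_smul_rt (i j : ι) : pr b i (ratio b j • rt b j) = P.pairingIn ℤ i j := by
  have h1 : (0 : ℚ) < ratio b j := by exact_mod_cast ratio_pos b j
  rw [← natCast_zsmul, pr_zsmul, pr_rt_comm, pr, ev_rt]; push_cast; field_simp

theorem pr_rt_highestRoot (i : ι) : pr b i (rt b (highestRoot b)) = P.pairingIn ℤ i (highestRoot b) := by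
  have := pr_ratio_smul_rt b i (highestRoot b)
  rwa [ratio_highestRoot, one_smul] at this

theorem pr_pos {i : ι} (hi : b.IsPos i) {x : b.support → ℤ} (hx : ∀ j, 0 < x j) : 0 < pr b i x := by
  rw [pr_eq_sum]
  have hpos : ∀ j : b.support, (0 : ℚ) < x j / ratio b j := fun j =>
    div_pos (by exact_mod_cast hx j) (by exact_mod_cast ratio_pos b j)
  have hnn : ∀ j ∈ Finset.univ, (0 : ℚ) ≤ coef b i j * (x j / ratio b j) := fun j _ =>
    mul_nonneg (by exact_mod_cast coef_nonneg b hi j) (hpos j).le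
  refine lt_of_le_of_ne (Finset.sum_nonneg hnn) fun h => ?_
  have h1 : ∀ j, coef b i j = 0 := fun j => by
    have := ((Finset.sum_eq_zero_iff_of_nonneg hnn).1 h.symm j (Finset.mem_univ j))
    exact_mod_cast (mul_eq_zero.1 this).resolve_right (hpos j).ne'
  rw [RootPairing.Base.isPos_iff, height_eq_sum_coef, Finset.sum_eq_zero fun k _ => h1 k] at hi
  exact lt_irrefl _ hi

theorem pr_le_highestRoot (i : ι) {x : b.support → ℤ} (hx : ∀ j, 0 ≤ x j) :
    pr b i x ≤ pr b (highestRoot b) x := by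
  rw [pr_eq_sum, pr_eq_sum]
  refine Finset.sum_le_sum fun j _ => mul_le_mul_of_nonneg_right ?_ ?_
  · exact_mod_cast coef_le_highestRoot b i j
  · exact div_nonneg (by exact_mod_cast hx j) (by positivity)

/-! ### Simple affine reflections and affine roots -/

theorem refl_add (i : ι) (x y : b.support → ℤ) : refl b i (x + y) = refl b i x + refl b i y := by
  simp only [refl, map_add, add_smul]; abel

theorem refl_zsmul (i : ι) (n : ℤ) (x : b.support → ℤ) : refl b i (n • x) = n • refl b i x := by
  simp only [refl, map_zsmul, smul_eq_mul, smul_sub, mul_smul]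

theorem refl_rt_self (i : ι) : refl b i (rt b i) = -rt b i := by
  rw [← rt_reflectionPerm, rt_neg]

theorem affineReflection_involutive (h : ℤ) :
    Function.Involutive fun x => refl b (highestRoot b) x + h • rt b (highestRoot b) := fun x => by
  simp only [refl_add, refl_refl, refl_zsmul, refl_rt_self]
  simp

/-- The reflection in a root, as a permutation of the integral weights. -/
def reflPerm (i : ι) : Equiv.Perm (b.support → ℤ) :=
  Function.Involutive.toPerm (refl b i) (refl_refl b i)

/-- The reflections in the walls of the alcove of level `h`. -/
def affRefl (h : ℤ) : Option b.support → Equiv.Perm (b.support → ℤ)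
  | some j => reflPerm b j
  | none => Function.Involutive.toPerm _ (affineReflection_involutive b h)

theorem reflPerm_apply (i : ι) (x : b.support → ℤ) : reflPerm b i x = refl b i x := rfl

theorem affRefl_some (h : ℤ) (j : b.support) (x : b.support → ℤ) :
    affRefl b h (some j) x = refl b j x := rfl

theorem affRefl_none (h : ℤ) (x : b.support → ℤ) :
    affRefl b h none x = refl b (highestRoot b) x + h • rt b (highestRoot b) := rfl

theorem affRefl_affRefl (h : ℤ) (j : Option b.support) (x : b.support → ℤ) :
    affRefl b h j (affRefl b h j x) = x := by
  cases j with
  | none => exact affineReflection_involutive b h x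
  | some j => exact refl_refl b j x

theorem affRefl_mul_self (h : ℤ) (j : Option b.support) : affRefl b h j * affRefl b h j = 1 :=
  Equiv.ext fun x => affRefl_affRefl b h j x

/-! Affine roots are pairs `(i, n)`, standing for the function `x ↦ ⟨x, αᵢ⟩ - n h`. -/

/-- The action of the simple affine reflections on affine roots. -/
def affAct : Option b.support → ι × ℤ → ι × ℤ
  | some j, a => (P.reflectionPerm j a.1, a.2)
  | none, a => (P.reflectionPerm (highestRoot b) a.1, a.2 - P.pairingIn ℤ a.1 (highestRoot b))

/-- The value of an affine root at a weight. -/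
def affVal (h : ℤ) (a : ι × ℤ) (x : b.support → ℤ) : ℚ := pr b a.1 x - a.2 * h

/-- The positive affine roots. -/
def AffPos (a : ι × ℤ) : Prop := a.2 < 0 ∨ a.2 = 0 ∧ b.IsPos a.1

/-- The simple affine roots. -/
def affSimple : Option b.support → ι × ℤ
  | some j => (j, 0)
  | none => (P.reflectionPerm (highestRoot b) (highestRoot b), -1)

/-- The negative of an affine root. -/
def affNeg (P : RootPairing ι ℂ M N) (a : ι × ℤ) : ι × ℤ := (P.reflectionPerm a.1 a.1, -a.2)

/-- This compatibility dictates the shift of the level in `affAct`. -/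
theorem affVal_affAct (h : ℤ) (j : Option b.support) (a : ι × ℤ) (x : b.support → ℤ) :
    affVal b h (affAct b j a) x = affVal b h a (affRefl b h j x) := by
  cases j with
  | none =>
    simp only [affVal, affAct, affRefl_none, pr_add, pr_zsmul, pr_refl, pr_rt_highestRoot]
    push_cast; ring
  | some j => simp only [affVal, affAct, affRefl_some, pr_refl]

theorem affVal_affNeg (h : ℤ) (a : ι × ℤ) (x : b.support → ℤ) :
    affVal b h (affNeg P a) x = -affVal b h a x := by
  simp only [affVal, affNeg, pr_neg]; push_cast; ring

theorem affPos_affNeg (a : ι × ℤ) : AffPos b (affNeg P a) ↔ ¬ AffPos b a := by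
  have h1 := isPos_or_neg b a.1
  have h2 := fun h : b.IsPos a.1 => not_isPos_neg b h
  simp only [AffPos, affNeg, neg_eq_zero, neg_lt_zero]
  rcases lt_trichotomy a.2 0 with h | h | h
  · simp [h, h.not_gt, h.ne]
  · simp only [h, lt_irrefl, true_and, false_or]; tauto
  · simp [h, h.not_gt, h.ne']

theorem reflectionPerm_neg (i j : ι) : P.reflectionPerm j (P.reflectionPerm i i) =
    P.reflectionPerm (P.reflectionPerm j i) (P.reflectionPerm j i) := by
  apply P.root.injective
  rw [RootPairing.root_reflectionPerm, RootPairing.root_reflectionPerm,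
    RootPairing.reflection_apply_self, map_neg, ← RootPairing.root_reflectionPerm,
    RootPairing.root_reflectionPerm (i := P.reflectionPerm j i), RootPairing.reflection_apply_self]

theorem affAct_affNeg (j : Option b.support) (a : ι × ℤ) :
    affAct b j (affNeg P a) = affNeg P (affAct b j a) := by
  cases j with
  | none =>
    simp only [affAct, affNeg, reflectionPerm_neg, Prod.mk.injEq, true_and]
    rw [← ev_rt b (highestRoot b), rt_neg, map_neg, ev_rt]; ring
  | some j => simp only [affAct, affNeg, reflectionPerm_neg]

theorem affAct_affSimple (j : Option b.support) :
    affAct b j (affSimple b j) = affNeg P (affSimple b j) := by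
  cases j with
  | none =>
    simp only [affAct, affNeg, affSimple, Prod.mk.injEq]
    refine ⟨reflectionPerm_neg _ _, ?_⟩
    rw [← ev_rt b (highestRoot b), rt_neg, map_neg, ev_rt_self]; norm_num
  | some j => simp only [affAct, affNeg, affSimple, neg_zero]

theorem affPos_affSimple (j : Option b.support) : AffPos b (affSimple b j) := by
  cases j with
  | none => exact Or.inl (by simp [affSimple])
  | some j => exact Or.inr ⟨rfl, RootPairing.Base.isPos_of_mem_support j.2⟩

/-- A simple affine reflection permutes the positive affine roots other than its own. -/
theorem affPos_affAct {j : Option b.support} {a : ι × ℤ} (ha : AffPos b a)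
    (hne : a ≠ affSimple b j) : AffPos b (affAct b j a) := by
  obtain ⟨i, n⟩ := a
  cases j with
  | some j =>
    rcases ha with ha | ⟨ha, hp⟩
    · exact Or.inl ha
    · exact Or.inr ⟨ha, hp.reflectionPerm j.2 fun h => hne (Prod.ext h ha)⟩
  | none =>
    simp only [AffPos, affAct] at ha ⊢
    rcases ha with ha | ⟨ha, hp⟩
    · by_cases hi : i = P.reflectionPerm (highestRoot b) (highestRoot b)
      · subst hi
        rw [reflectionPerm_neg, neg_neg_eq, ← ev_rt b (highestRoot b), rt_neg, map_neg, ev_rt_self]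
        have hn : n ≠ -1 := fun h => hne (by rw [h]; rfl)
        rcases eq_or_ne n (-2) with h | h
        · exact Or.inr ⟨by omega, isPos_highestRoot b⟩
        · exact Or.inl (by omega)
      · have h1 := neg_one_le_pairingIn_highestRoot b hi
        rcases eq_or_ne (P.pairingIn ℤ i (highestRoot b)) (-1) with h2 | h2
        · rcases eq_or_ne n (-1) with h3 | h3
          -- Level 0 is reached here with root part the sum of the given root and θ. Its height is
          -- nonnegative because the negative of the given root is no higher than θ.
          · refine Or.inr ⟨by omega, ?_⟩
            have h4 := b.height_add_zsmul (root_reflectionPerm_eq (highestRoot b) i)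
            rw [h2, neg_neg, one_smul] at h4
            rw [RootPairing.Base.isPos_iff', h4]
            have h5 := height_le_highestRoot b (P.reflectionPerm i i)
            rw [height_neg] at h5
            omega
          · exact Or.inl (by omega)
        · exact Or.inl (by omega)
    · have h1 := pairingIn_highestRoot_nonneg' b hp
      rcases h1.lt_or_eq with h1 | h1
      · exact Or.inl (by omega)
      · refine Or.inr ⟨by omega, ?_⟩
        have h4 := b.height_add_zsmul (root_reflectionPerm_eq (highestRoot b) i)
        rw [← h1, neg_zero, zero_smul, add_zero] at h4
        rw [RootPairing.Base.isPos_iff, h4]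
        exact hp

/-- The reflection in the hyperplane of an affine root. -/
def affineReflection (h : ℤ) (a : ι × ℤ) (x : b.support → ℤ) : b.support → ℤ :=
  x - (ev b a.1 x - a.2 * h * ratio b a.1) • rt b a.1

theorem affineReflection_affSimple (h : ℤ) (j : Option b.support) (x : b.support → ℤ) :
    affineReflection b h (affSimple b j) x = affRefl b h j x := by
  cases j with
  | none =>
    simp only [affineReflection, affSimple, affRefl_none, ev_neg, rt_neg, ratio_reflectionPerm,
      ratio_highestRoot, refl]
    push_cast
    module
  | some j => simp [affineReflection, affSimple, affRefl_some, refl]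

theorem ev_rt_highestRoot (i : ι) :
    ev b i (rt b (highestRoot b)) = ratio b i * P.pairingIn ℤ i (highestRoot b) := by
  have h1 := pr_rt_highestRoot b i
  have h2 : (0 : ℚ) < ratio b i := by exact_mod_cast ratio_pos b i
  rw [pr, div_eq_iff h2.ne'] at h1
  rw [mul_comm]; exact_mod_cast h1

/-- Conjugation by a simple affine reflection carries the hyperplane of an affine root to that of
its image. This is the source of the cancellation in the exchange argument. -/
theorem affineReflection_affAct (h : ℤ) (j : Option b.support) (a : ι × ℤ) (x : b.support → ℤ) :
    affineReflection b h (affAct b j a) x =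
      affRefl b h j (affineReflection b h a (affRefl b h j x)) := by
  have hsub : ∀ (i k : ι) (c : ℤ) (y : b.support → ℤ),
      refl b k (y - c • rt b i) = refl b k y - c • rt b (P.reflectionPerm k i) := by
    intro i k c y
    rw [sub_eq_add_neg, ← neg_smul, refl_add, refl_zsmul, rt_reflectionPerm, neg_smul,
      ← sub_eq_add_neg]
  cases j with
  | none =>
    simp only [affineReflection, affAct, affRefl_none, ratio_reflectionPerm, ← ev_refl, hsub,
      map_add, map_zsmul, ev_rt_highestRoot, refl_add, refl_zsmul, refl_refl, refl_rt_self,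
      smul_eq_mul]
    module
  | some j =>
    simp only [affineReflection, affAct, affRefl_some, ratio_reflectionPerm, ← ev_refl, hsub,
      refl_refl]

/-! ### Words in the affine Weyl group and the exchange argument -/

/-- The product of a word in the simple affine reflections. -/
def affWord (h : ℤ) (l : List (Option b.support)) : Equiv.Perm (b.support → ℤ) :=
  (l.map (affRefl b h)).prod

/-- The action of a word on affine roots. -/
def affActWord (l : List (Option b.support)) (a : ι × ℤ) : ι × ℤ :=
  l.foldl (fun a j => affAct b j a) a

/-- The left fold lets the first letter act first on affine roots, so `affActWord` is the pullback
of affine functions along `affWord`. -/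
theorem affVal_affActWord (h : ℤ) (l : List (Option b.support)) (a : ι × ℤ) (x : b.support → ℤ) :
    affVal b h (affActWord b l a) x = affVal b h a (affWord b h l x) := by
  induction l generalizing a with
  | nil => rfl
  | cons j l ih =>
    change affVal b h (affActWord b l (affAct b j a)) x = _
    rw [ih, affVal_affAct]
    simp [affWord]

theorem affActWord_affNeg (l : List (Option b.support)) (a : ι × ℤ) :
    affActWord b l (affNeg P a) = affNeg P (affActWord b l a) := by
  induction l generalizing a with
  | nil => rfl
  | cons j l ih =>
    change affActWord b l (affAct b j (affNeg P a)) = affNeg P (affActWord b l (affAct b j a))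
    rw [affAct_affNeg, ih]

theorem affWord_affineReflection (h : ℤ) (l : List (Option b.support)) (a : ι × ℤ)
    (x : b.support → ℤ) : affWord b h l (affineReflection b h (affActWord b l a) x) =
      affineReflection b h a (affWord b h l x) := by
  induction l generalizing a with
  | nil => rfl
  | cons j l ih =>
    change affWord b h (j :: l) (affineReflection b h (affActWord b l (affAct b j a)) x) = _
    simp only [affWord, List.map_cons, List.prod_cons, Equiv.Perm.mul_apply] at ih ⊢
    rw [ih, affineReflection_affAct, affRefl_affRefl]

/-- A simple affine reflection makes only its own simple root negative (`affPos_affAct`). At the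
letter where the sign changes, the root must have become the simple root of that letter. -/
theorem exists_affActWord_eq_affSimple {l : List (Option b.support)} {a : ι × ℤ}
    (ha : AffPos b a) (hl : ¬ AffPos b (affActWord b l a)) :
    ∃ u k v, l = u ++ k :: v ∧ affActWord b u a = affSimple b k := by
  induction l generalizing a with
  | nil => exact absurd ha hl
  | cons j l ih =>
    by_cases h : a = affSimple b j
    · exact ⟨[], j, l, rfl, h⟩
    · obtain ⟨u, k, v, rfl, hu⟩ := ih (affPos_affAct b ha h) hl
      exact ⟨j :: u, k, v, rfl, hu⟩

/-- The integral weights in the open alcove of level `h`. -/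
def alcove (h : ℤ) : Set (b.support → ℤ) := {x | (∀ j, 0 < x j) ∧ ev b (highestRoot b) x < h}

/-- On the alcove every pairing with a root is smaller than h in absolute value, so a nonzero level
n decides the sign of ⟨x, α⟩ − nh. Hence the convention that negative levels are positive. -/
theorem affVal_pos_of_mem_alcove {h : ℤ} {x : b.support → ℤ} (hx : x ∈ alcove b h) {a : ι × ℤ}
    (ha : AffPos b a) : 0 < affVal b h a x := by
  have hθ : pr b (highestRoot b) x < h := by rw [pr_highestRoot]; exact_mod_cast hx.2
  rcases ha with ha | ⟨ha, hp⟩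
  · have h1 := pr_le_highestRoot b (P.reflectionPerm a.1 a.1) fun j => (hx.1 j).le
    rw [pr_neg] at h1
    have h2 : (a.2 : ℚ) ≤ -1 := by exact_mod_cast (by omega : a.2 ≤ -1)
    have h3 : 0 < pr b (highestRoot b) x := pr_pos b (isPos_highestRoot b) hx.1
    rw [affVal]
    nlinarith
  · rw [affVal, ha]
    simpa using pr_pos b hp hx.1

theorem affPos_iff_of_mem_alcove {h : ℤ} {x : b.support → ℤ} (hx : x ∈ alcove b h) (a : ι × ℤ) :
    AffPos b a ↔ 0 < affVal b h a x := by
  refine ⟨affVal_pos_of_mem_alcove b hx, fun h1 => ?_⟩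
  by_contra h2
  have := affVal_pos_of_mem_alcove b hx ((affPos_affNeg b a).2 h2)
  rw [affVal_affNeg] at this
  linarith

/-- An element of the affine Weyl group that maps a point of the alcove into the alcove is
trivial. -/
theorem affWord_eq_one {h : ℤ} {x : b.support → ℤ} (hx : x ∈ alcove b h)
    (l : List (Option b.support)) (hl : affWord b h l x ∈ alcove b h) : affWord b h l = 1 := by
  induction hn : l.length using Nat.strong_induction_on generalizing l with
  | _ n ih =>
    match l with
    | [] => rfl
    | j :: l =>
      -- Exchange argument. As x and its image both lie in the alcove, the rest of the word makes
      -- the simple root of the first letter j negative. It becomes the simple root of some letter k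
      -- after a prefix u, so s_j u = u s_k. The two letters then cancel and the word shortens by
      -- two.
      have h1 : ¬ AffPos b (affActWord b l (affSimple b j)) := by
        have h2 : AffPos b (affActWord b (j :: l) (affSimple b j)) := by
          rw [affPos_iff_of_mem_alcove b hx, affVal_affActWord]
          exact affVal_pos_of_mem_alcove b hl (affPos_affSimple b j)
        change AffPos b (affActWord b l (affAct b j (affSimple b j))) at h2
        rwa [affAct_affSimple, affActWord_affNeg, affPos_affNeg] at h2
      obtain ⟨u, k, v, rfl, hu⟩ := exists_affActWord_eq_affSimple b (affPos_affSimple b j) h1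
      have hcomm : affWord b h u * affRefl b h k = affRefl b h j * affWord b h u := by
        ext1 x
        simp only [Equiv.Perm.mul_apply]
        rw [← affineReflection_affSimple b h k, ← affineReflection_affSimple b h j, ← hu,
          affWord_affineReflection]
      have heq : affWord b h (j :: (u ++ k :: v)) = affWord b h (u ++ v) := by
        have : affWord b h (j :: (u ++ k :: v)) =
            affRefl b h j * affWord b h u * affRefl b h k * affWord b h v := by
          simp [affWord, mul_assoc]
        rw [this, ← hcomm, mul_assoc (affWord b h u), affRefl_mul_self]
        simp [affWord]
      rw [heq] at hl ⊢
      refine ih (u ++ v).length ?_ _ hl rfl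
      simp only [List.length_cons, List.length_append] at hn ⊢; omega

/-- The affine Weyl group of level `h`. -/
def affWeyl (h : ℤ) : Subgroup (Equiv.Perm (b.support → ℤ)) :=
  Subgroup.closure (Set.range (affRefl b h))

theorem exists_affWord_eq {h : ℤ} {g : Equiv.Perm (b.support → ℤ)} (hg : g ∈ affWeyl b h) :
    ∃ l, affWord b h l = g := by
  have hinv : ∀ j, (affRefl b h j)⁻¹ = affRefl b h j := fun j =>
    inv_eq_of_mul_eq_one_left (affRefl_mul_self b h j)
  induction hg using Subgroup.closure_induction with
  | mem x hx => obtain ⟨j, rfl⟩ := hx; exact ⟨[j], by simp [affWord]⟩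
  | one => exact ⟨[], rfl⟩
  | mul x y _ _ hx hy =>
    obtain ⟨l, rfl⟩ := hx
    obtain ⟨m, rfl⟩ := hy
    exact ⟨l ++ m, by simp [affWord]⟩
  | inv x _ hx =>
    obtain ⟨l, rfl⟩ := hx
    refine ⟨l.reverse, ?_⟩
    rw [affWord, affWord, List.prod_inv_reverse, List.map_map, List.map_reverse]
    congr 2
    exact List.map_congr_left fun j _ => (hinv j).symm

theorem eq_one_of_mem_affWeyl {h : ℤ} {x : b.support → ℤ} (hx : x ∈ alcove b h)
    {g : Equiv.Perm (b.support → ℤ)} (hg : g ∈ affWeyl b h) (hgx : g x ∈ alcove b h) : g = 1 := by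
  obtain ⟨l, rfl⟩ := exists_affWord_eq b hg
  exact affWord_eq_one b hx l hgx

/-! ### The finite Weyl group and the translations -/

/-- The finite Weyl group, acting on the integral weights. -/
def weyl : Subgroup (Equiv.Perm (b.support → ℤ)) :=
  Subgroup.closure (Set.range fun j : b.support => reflPerm b j)

theorem weyl_le_affWeyl (h : ℤ) : weyl b ≤ affWeyl b h :=
  Subgroup.closure_mono <| by rintro - ⟨j, rfl⟩; exact ⟨some j, rfl⟩

theorem reflPerm_mem_weyl (i : ι) : reflPerm b i ∈ weyl b := by
  have key : ∀ i j : ι, reflPerm b (P.reflectionPerm j i) =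
      reflPerm b j * reflPerm b i * reflPerm b j := by
    intro i j
    ext1 x
    simp only [Equiv.Perm.mul_apply, reflPerm_apply]
    apply wt_injective b
    simp only [wt_refl, RootPairing.reflection_reflectionPerm]
    rfl
  refine RootPairing.Base.induction_reflect (b := b) i (p := fun i => reflPerm b i ∈ weyl b)
    ?_ ?_ ?_
  · intro i hi
    rw [key]; exact mul_mem (mul_mem hi hi) hi
  · intro i hi
    exact Subgroup.subset_closure ⟨⟨i, hi⟩, rfl⟩
  · intro i j hi hj
    have hj' : reflPerm b j ∈ weyl b := Subgroup.subset_closure ⟨⟨j, hj⟩, rfl⟩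
    rw [key]; exact mul_mem (mul_mem hj' hi) hj'

theorem weyl_add {w : Equiv.Perm (b.support → ℤ)} (hw : w ∈ weyl b) (x y : b.support → ℤ) :
    w (x + y) = w x + w y := by
  induction hw using Subgroup.closure_induction generalizing x y with
  | mem w hw => obtain ⟨j, rfl⟩ := hw; exact refl_add b j x y
  | one => rfl
  | mul v w _ _ hv hw => simp only [Equiv.Perm.mul_apply, hw, hv]
  | inv w _ hw => rw [Equiv.Perm.inv_eq_iff_eq, hw]; simp

/-- The elements of the Weyl group, as additive automorphisms. -/
def weylHom {w : Equiv.Perm (b.support → ℤ)} (hw : w ∈ weyl b) :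
    (b.support → ℤ) →+ (b.support → ℤ) := AddMonoidHom.mk' w (weyl_add b hw)

theorem weyl_zero {w : Equiv.Perm (b.support → ℤ)} (hw : w ∈ weyl b) : w 0 = 0 :=
  (weylHom b hw).map_zero

theorem weyl_neg {w : Equiv.Perm (b.support → ℤ)} (hw : w ∈ weyl b) (x : b.support → ℤ) :
    w (-x) = -w x := (weylHom b hw).map_neg x

theorem weyl_sub {w : Equiv.Perm (b.support → ℤ)} (hw : w ∈ weyl b) (x y : b.support → ℤ) :
    w (x - y) = w x - w y := (weylHom b hw).map_sub x y

/-- The lattice spanned by the multiples by `h` of the simple coroots. -/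
def coLattice (h : ℤ) : AddSubgroup (b.support → ℤ) :=
  AddSubgroup.closure (Set.range fun j : b.support => (h * ratio b j) • rt b j)

/-- The vectors `ratio b i • rt b i` represent the coroots in the normalised form, so they expand as
the coroots do. The difference of the two sides is orthogonal to itself, and the form is definite.
-/
theorem ratio_smul_rt_eq_sum (i : ι) :
    (ratio b i : ℤ) • rt b i = ∑ j : b.support, cocoef b i j • ((ratio b j : ℤ) • rt b j) := by
  rw [← sub_eq_zero]
  set z := (ratio b i : ℤ) • rt b i - ∑ j : b.support, cocoef b i j • ((ratio b j : ℤ) • rt b j)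
    with hz
  have key : ∀ (i : ι) (x : b.support → ℤ),
      2 * form b x ((ratio b i : ℤ) • rt b i) = ev b i x * len b (highestRoot b) := by
    intro i x
    have h1 := two_form_rt b i x
    rw [map_zsmul, smul_eq_mul, ← ratio_mul_len b i, len]
    linear_combination (ratio b i : ℤ) * h1
  by_contra hne
  have hpos := form_self_pos b hne
  have h0 : 2 * form b z z = 0 := by
    nth_rw 2 [hz]
    rw [map_sub, mul_sub, key, map_sum, Finset.mul_sum, ev_apply, Finset.sum_mul, sub_eq_zero]
    refine Finset.sum_congr rfl fun j _ => ?_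
    have h2 := key j z
    rw [ev_simple] at h2
    rw [map_zsmul, smul_eq_mul]
    linear_combination -cocoef b i j * h2
  omega

theorem smul_ratio_smul_rt_mem (h : ℤ) (i : ι) :
    (h * ratio b i) • rt b i ∈ coLattice b h := by
  rw [mul_smul, ratio_smul_rt_eq_sum, Finset.smul_sum]
  refine AddSubgroup.sum_mem _ fun j _ => ?_
  rw [smul_comm, ← mul_smul h]
  exact AddSubgroup.zsmul_mem _ (AddSubgroup.subset_closure (Set.mem_range_self j)) _

theorem weyl_mem_coLattice {h : ℤ} {w : Equiv.Perm (b.support → ℤ)} (hw : w ∈ weyl b)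
    {v : b.support → ℤ} (hv : v ∈ coLattice b h) : w v ∈ coLattice b h := by
  have key : ∀ (k : b.support) {v : b.support → ℤ}, v ∈ coLattice b h →
      refl b k v ∈ coLattice b h := by
    intro k v hv
    induction hv using AddSubgroup.closure_induction with
    | mem v hv =>
      obtain ⟨j, rfl⟩ := hv
      simp only
      rw [refl_zsmul, ← rt_reflectionPerm, ← ratio_reflectionPerm b k j]
      exact smul_ratio_smul_rt_mem b h _
    | zero => rw [refl]; simp
    | add x y _ _ hx hy => rw [refl_add]; exact add_mem hx hy
    | neg x _ hx =>
      rw [← neg_one_zsmul, refl_zsmul]; exact AddSubgroup.zsmul_mem _ hx _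
  induction hw using Subgroup.closure_induction'' generalizing v with
  | one => exact hv
  | mem w hw => obtain ⟨j, rfl⟩ := hw; exact key j hv
  | inv_mem w hw =>
    obtain ⟨j, rfl⟩ := hw
    exact key j hv
  | mul x y _ _ hx hy => exact hx (hy hv)

/-- Translation by hθ is the product of the reflections in two parallel hyperplanes. Conjugating by
the Weyl group gives hα for every long root α, and by `ratio_smul_rt_mem` the long roots span the
vectors representing the coroots. -/
theorem addRight_mem_affWeyl {h : ℤ} {v : b.support → ℤ} (hv : v ∈ coLattice b h) :
    Equiv.addRight v ∈ affWeyl b h := by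
  have hadd : ∀ {u v : b.support → ℤ}, Equiv.addRight u ∈ affWeyl b h →
      Equiv.addRight v ∈ affWeyl b h → Equiv.addRight (u + v) ∈ affWeyl b h := by
    intro u v hu hv
    have : Equiv.addRight (u + v) = Equiv.addRight v * Equiv.addRight u := by
      ext1 x; simp [add_assoc]
    rw [this]; exact mul_mem hv hu
  have hneg : ∀ {u : b.support → ℤ}, Equiv.addRight u ∈ affWeyl b h →
      Equiv.addRight (-u) ∈ affWeyl b h := by
    intro u hu
    have : Equiv.addRight (-u) = (Equiv.addRight u)⁻¹ := by
      ext1 x; rw [Equiv.Perm.eq_inv_iff_eq]; simp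
    rw [this]; exact inv_mem hu
  have hzero : Equiv.addRight (0 : b.support → ℤ) ∈ affWeyl b h := by
    have : Equiv.addRight (0 : b.support → ℤ) = 1 := by ext1 x; simp
    rw [this]; exact one_mem _
  have hmul : ∀ {w}, w ∈ weyl b → ∀ {v}, Equiv.addRight v ∈ affWeyl b h →
      Equiv.addRight (w v) ∈ affWeyl b h := by
    intro w hw v hv
    have hw' := weyl_le_affWeyl b h hw
    have : Equiv.addRight (w v) = w * Equiv.addRight v * w⁻¹ := by
      ext1 x
      simp only [Equiv.Perm.mul_apply, Equiv.coe_addRight]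
      rw [weyl_add b hw]; simp
    rw [this]
    exact mul_mem (mul_mem hw' hv) (inv_mem hw')
  have hlong : ∀ k, IsLongRoot b k → Equiv.addRight (h • rt b k) ∈ affWeyl b h := by
    intro k hk
    induction hk with
    | highest =>
      have : Equiv.addRight (h • rt b (highestRoot b)) =
          affRefl b h none * reflPerm b (highestRoot b) := by
        ext1 x
        simp only [Equiv.Perm.mul_apply, Equiv.coe_addRight, affRefl_none, reflPerm_apply,
          refl_refl]
      rw [this]
      exact mul_mem (Subgroup.subset_closure ⟨none, rfl⟩)
        (weyl_le_affWeyl b h (reflPerm_mem_weyl b _))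
    | step j k hj hk ih =>
      rw [rt_reflectionPerm, ← refl_zsmul]
      exact hmul (reflPerm_mem_weyl b j) ih
  have hspan : ∀ v ∈ AddSubgroup.closure (rt b '' {k | IsLongRoot b k}),
      Equiv.addRight (h • v) ∈ affWeyl b h := by
    intro v hv
    induction hv using AddSubgroup.closure_induction with
    | mem v hv => obtain ⟨k, hk, rfl⟩ := hv; exact hlong k hk
    | zero => rw [smul_zero]; exact hzero
    | add x y _ _ hx hy => rw [smul_add]; exact hadd hx hy
    | neg x _ hx => rw [smul_neg]; exact hneg hx
  induction hv using AddSubgroup.closure_induction with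
  | mem v hv =>
    obtain ⟨j, rfl⟩ := hv
    simp only
    rw [mul_smul, natCast_zsmul]
    exact hspan _ (ratio_smul_rt_mem b j)
  | zero => exact hzero
  | add x y _ _ hx hy => exact hadd hx hy
  | neg x _ hx => exact hneg hx

theorem exists_weyl_of_mem_affWeyl {h : ℤ} {g : Equiv.Perm (b.support → ℤ)}
    (hg : g ∈ affWeyl b h) : ∃ w ∈ weyl b, ∃ v ∈ coLattice b h, ∀ x, g x = w x + v := by
  induction hg using Subgroup.closure_induction with
  | mem g hg =>
    obtain ⟨j, rfl⟩ := hg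
    cases j with
    | none =>
      refine ⟨reflPerm b (highestRoot b), reflPerm_mem_weyl b _, h • rt b (highestRoot b), ?_,
        fun x => rfl⟩
      have := smul_ratio_smul_rt_mem b h (highestRoot b)
      rwa [ratio_highestRoot, Nat.cast_one, mul_one] at this
    | some j =>
      exact ⟨reflPerm b j, reflPerm_mem_weyl b _, 0, zero_mem _, fun x => (add_zero _).symm⟩
  | one => exact ⟨1, one_mem _, 0, zero_mem _, fun x => (add_zero _).symm⟩
  | mul f g _ _ hf hg =>
    obtain ⟨w, hw, v, hv, h1⟩ := hf
    obtain ⟨w', hw', v', hv', h2⟩ := hg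
    refine ⟨w * w', mul_mem hw hw', w v' + v, add_mem (weyl_mem_coLattice b hw hv') hv, fun x => ?_⟩
    rw [Equiv.Perm.mul_apply, h1, h2, weyl_add b hw, add_assoc]; rfl
  | inv g _ hg =>
    obtain ⟨w, hw, v, hv, h1⟩ := hg
    refine ⟨w⁻¹, inv_mem hw, -(w⁻¹ v), neg_mem (weyl_mem_coLattice b (inv_mem hw) hv), fun x => ?_⟩
    rw [Equiv.Perm.inv_eq_iff_eq, h1, weyl_add b hw, weyl_neg b hw]
    simp

/-! ### Moving a weight into the chamber or the alcove -/

/-- The Weyl vector, in coordinates. -/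
def rho : b.support → ℤ := fun _ => 1

/-- The squared distance to r drops exactly when x and r lie strictly on opposite sides of the
hyperplane where the coroot takes the value m. Both descent arguments below rest on this. -/
theorem form_reflection_sub_rho (i : ι) (m : ℤ) (x r : b.support → ℤ) :
    form b (x - (ev b i x - m) • rt b i - r) (x - (ev b i x - m) • rt b i - r) =
      form b (x - r) (x - r) + (ev b i x - m) * (ev b i r - m) * len b i := by
  have h1 := two_form_rt b i (x - r)
  have e : x - (ev b i x - m) • rt b i - r = (x - r) - (ev b i x - m) • rt b i := by abel
  rw [e]
  generalize hc : ev b i x - m = c at *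
  have hev : ev b i (x - r) = c - (ev b i r - m) := by rw [map_sub]; omega
  rw [hev] at h1
  clear e hev
  generalize x - r = y at *
  simp only [map_sub, map_zsmul, LinearMap.sub_apply, LinearMap.smul_apply, smul_eq_mul]
  rw [form_comm b (rt b i) y, len]
  linear_combination (-c) * h1

/-- The squared distance to r takes values in the natural numbers, so an orbit has a nearest point.
-/
theorem exists_minimal (G : Subgroup (Equiv.Perm (b.support → ℤ))) (x r : b.support → ℤ) :
    ∃ g ∈ G, ∀ f ∈ G, form b (g x - r) (g x - r) ≤ form b (f (g x) - r) (f (g x) - r) := by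
  obtain ⟨g, hg, hmin⟩ := (Nat.lt_wfRel.wf.onFun (f := fun g : Equiv.Perm (b.support → ℤ) =>
    (form b (g x - r) (g x - r)).toNat)).has_min (G : Set (Equiv.Perm (b.support → ℤ)))
    ⟨1, one_mem G⟩
  refine ⟨g, hg, fun f hf => ?_⟩
  have h1 := hmin (f * g) (mul_mem hf hg)
  have h2 := form_self_nonneg b (g x - r)
  have h3 := form_self_nonneg b (f (g x) - r)
  simp only [Function.onFun, Equiv.Perm.mul_apply] at h1
  change ¬ (form b (f (g x) - r) (f (g x) - r)).toNat < (form b (g x - r) (g x - r)).toNat at h1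
  omega

/-- The point of the orbit nearest to ϱ cannot be separated from ϱ by a wall. -/
theorem exists_weyl_nonneg (x : b.support → ℤ) : ∃ w ∈ weyl b, ∀ j, 0 ≤ w x j := by
  obtain ⟨w, hw, hmin⟩ := exists_minimal b (weyl b) x (rho b)
  refine ⟨w, hw, fun j => ?_⟩
  by_contra! hneg
  have h1 := hmin _ (reflPerm_mem_weyl b j)
  have h2 := form_reflection_sub_rho b j 0 (w x) (rho b)
  simp only [sub_zero] at h2
  rw [reflPerm_apply, refl, h2, ev_simple, ev_simple] at h1
  have h3 := len_pos b j
  simp only [rho] at h1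
  nlinarith

/-- As for the finite Weyl group, with one more wall. The hypothesis puts ϱ strictly on the inner
side of that wall. -/
theorem exists_affWeyl_mem_closure {h : ℤ} (hρ : ev b (highestRoot b) (rho b) < h)
    (x : b.support → ℤ) :
    ∃ g ∈ affWeyl b h, (∀ j, 0 ≤ g x j) ∧ ev b (highestRoot b) (g x) ≤ h := by
  obtain ⟨g, hg, hmin⟩ := exists_minimal b (affWeyl b h) x (rho b)
  refine ⟨g, hg, fun j => ?_, ?_⟩
  · by_contra! hneg
    have h1 := hmin _ (weyl_le_affWeyl b h (reflPerm_mem_weyl b j))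
    have h2 := form_reflection_sub_rho b j 0 (g x) (rho b)
    simp only [sub_zero] at h2
    rw [reflPerm_apply, refl, h2, ev_simple, ev_simple] at h1
    have h3 := len_pos b j
    simp only [rho] at h1
    nlinarith
  · by_contra! hlt
    have h1 := hmin (affRefl b h none) (Subgroup.subset_closure ⟨none, rfl⟩)
    have h2 := form_reflection_sub_rho b (highestRoot b) h (g x) (rho b)
    have e : affRefl b h none (g x) =
        g x - (ev b (highestRoot b) (g x) - h) • rt b (highestRoot b) := by
      rw [affRefl_none, refl]; module
    rw [e, h2] at h1
    have h3 := len_pos b (highestRoot b)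
    have h4 : (ev b (highestRoot b) (g x) - h) * (ev b (highestRoot b) (rho b) - h) < 0 :=
      mul_neg_of_pos_of_neg (by omega) (by omega)
    nlinarith

/-- Points of the alcove are distinct modulo the Weyl group and the translations. -/
theorem weyl_alcove_injective {h : ℤ} {w w' : Equiv.Perm (b.support → ℤ)} (hw : w ∈ weyl b)
    (hw' : w' ∈ weyl b) {x x' : b.support → ℤ} (hx : x ∈ alcove b h) (hx' : x' ∈ alcove b h)
    (hxx : w x - w' x' ∈ coLattice b h) : w = w' ∧ x = x' := by
  -- This element of the affine Weyl group maps x to x', so it is the identity. Its value at 0 shows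
  -- that the translation part vanishes, and then w = w'.
  set g : Equiv.Perm (b.support → ℤ) := w'⁻¹ * Equiv.addRight (-(w x - w' x')) * w with hg
  have hgm : g ∈ affWeyl b h := mul_mem (mul_mem (weyl_le_affWeyl b h (inv_mem hw'))
    (addRight_mem_affWeyl b (neg_mem hxx))) (weyl_le_affWeyl b h hw)
  have hgx : g x = x' := by
    simp [hg]
  have h1 := eq_one_of_mem_affWeyl b hx hgm (hgx ▸ hx')
  have hxx' : x = x' := by rw [← hgx, h1]; rfl
  have h0 : w'⁻¹ (w 0 + -(w x - w' x')) = 0 := by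
    have := congrArg (fun f : Equiv.Perm (b.support → ℤ) => f 0) h1
    exact this
  rw [weyl_zero b hw, zero_add, Equiv.Perm.inv_eq_iff_eq, weyl_zero b hw', neg_eq_zero] at h0
  refine ⟨?_, hxx'⟩
  rw [hg, h0, neg_zero] at h1
  have h2 : w'⁻¹ * w = 1 := by
    rw [← h1]; ext1 y; simp
  exact (inv_mul_eq_one.1 h2).symm

/-! ### The Weyl denominator -/

open Classical in
/-- The positive roots. -/
def posRoots : Finset ι := Finset.univ.filter b.IsPos

theorem mem_posRoots {i : ι} : i ∈ posRoots b ↔ b.IsPos i := by simp [posRoots]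

/-- The Weyl vector minus a sum of positive roots. -/
def rhoSub (S : Finset ι) : b.support → ℤ := rho b - ∑ i ∈ S, rt b i

open Classical in
/-- The coefficients of the Weyl denominator. -/
def denom (x : b.support → ℤ) : ℤ :=
  ∑ S ∈ (posRoots b).powerset, if rhoSub b S = x then (-1) ^ S.card else 0

theorem refl_sum (i : ι) (S : Finset ι) (f : ι → b.support → ℤ) :
    refl b i (∑ k ∈ S, f k) = ∑ k ∈ S, refl b i (f k) :=
  map_sum (weylHom b (reflPerm_mem_weyl b i)) f S

theorem refl_sub (i : ι) (x y : b.support → ℤ) : refl b i (x - y) = refl b i x - refl b i y :=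
  weyl_sub b (reflPerm_mem_weyl b i) x y

theorem refl_rho (j : b.support) : refl b j (rho b) = rho b - rt b j := by
  rw [refl, ev_simple, rho, one_smul]

open Classical in
theorem refl_rhoSub (j : b.support) (S : Finset ι) :
    refl b j (rhoSub b S) = rhoSub b (S.image (P.reflectionPerm j)) - rt b j := by
  rw [rhoSub, refl_sub, refl_rho, refl_sum, rhoSub,
    Finset.sum_image fun _ _ _ _ h => (P.reflectionPerm j).injective h]
  simp only [rt_reflectionPerm]; abel

open Classical in
theorem image_posRoots_erase (j : b.support) :
    ((posRoots b).erase j).image (P.reflectionPerm j) = (posRoots b).erase j := by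
  have key : ∀ i ∈ (posRoots b).erase j, P.reflectionPerm j i ∈ (posRoots b).erase j := by
    intro i hi
    rw [Finset.mem_erase, mem_posRoots] at hi ⊢
    refine ⟨fun h => ?_, RootPairing.Base.IsPos.reflectionPerm hi.2 j.2 hi.1⟩
    have h1 := RootPairing.Base.IsPos.reflectionPerm hi.2 j.2 hi.1
    have h2 := congrArg (P.reflectionPerm j) h
    rw [RootPairing.reflectionPerm_self] at h2
    rw [h2] at hi
    exact not_isPos_neg b (RootPairing.Base.isPos_of_mem_support j.2) hi.2
  ext i
  refine ⟨fun h => ?_, fun h => ?_⟩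
  · obtain ⟨k, hk, rfl⟩ := Finset.mem_image.1 h
    exact key k hk
  · exact Finset.mem_image.2 ⟨_, key i h, RootPairing.reflectionPerm_self _ _ _⟩

-- Group the subsets S of the positive roots other than α_j with S ∪ {α_j}. The simple reflection
-- permutes the other positive roots and exchanges, up to sign, the two members of each group.
open Classical in
theorem denom_refl (j : b.support) (x : b.support → ℤ) : denom b (refl b j x) = -denom b x := by
  have hj : (j : ι) ∈ posRoots b :=
    (mem_posRoots b).2 (RootPairing.Base.isPos_of_mem_support j.2)
  set Q := (posRoots b).erase j with hQ
  have hsplit : ∀ y, denom b y = ∑ S ∈ Q.powerset,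
      ((if rhoSub b S = y then (-1) ^ S.card else 0) -
        if rhoSub b S - rt b j = y then (-1) ^ S.card else 0) := by
    intro y
    rw [denom, ← Finset.insert_erase hj, Finset.sum_powerset_insert (Finset.notMem_erase _ _),
      ← Finset.sum_add_distrib]
    refine Finset.sum_congr rfl fun S hS => ?_
    have hjS : (j : ι) ∉ S := fun h => Finset.notMem_erase _ _ (Finset.mem_powerset.1 hS h)
    have e : rhoSub b (insert (j : ι) S) = rhoSub b S - rt b j := by
      rw [rhoSub, rhoSub, Finset.sum_insert hjS]; abel
    rw [e, Finset.card_insert_of_notMem hjS, pow_succ]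
    split_ifs <;> ring
  have himg : ∀ S ∈ Q.powerset, S.image (P.reflectionPerm j) ∈ Q.powerset := by
    intro S hS
    rw [Finset.mem_powerset] at hS ⊢
    rw [hQ, ← image_posRoots_erase b j]
    exact Finset.image_subset_image hS
  have hinv : ∀ S : Finset ι, (S.image (P.reflectionPerm j)).image (P.reflectionPerm j) = S := by
    intro S
    rw [Finset.image_image]
    have : (P.reflectionPerm j : ι → ι) ∘ P.reflectionPerm j = id := by
      ext i; exact RootPairing.reflectionPerm_self _ _ _
    rw [this, Finset.image_id]
  rw [hsplit, hsplit, ← Finset.sum_neg_distrib]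
  refine Finset.sum_nbij' (fun S => S.image (P.reflectionPerm j))
    (fun S => S.image (P.reflectionPerm j)) himg himg (fun S _ => hinv S) (fun S _ => hinv S) ?_
  intro S _
  have hiff : ∀ y z, y = refl b j z ↔ refl b j y = z := fun y z =>
    ⟨fun h => by rw [h, refl_refl], fun h => by rw [← h, refl_refl]⟩
  have e1 : rhoSub b S = refl b j x ↔ rhoSub b (S.image (P.reflectionPerm j)) - rt b j = x := by
    rw [hiff, refl_rhoSub]
  have e2 : rhoSub b S - rt b j = refl b j x ↔ rhoSub b (S.image (P.reflectionPerm j)) = x := by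
    rw [hiff, refl_sub, refl_rt_self, refl_rhoSub, sub_neg_eq_add, sub_add_cancel]
  simp only [e1, e2, Finset.card_image_of_injective _ (P.reflectionPerm j).injective]
  ring

/-- Only squares of coefficients are needed later, which avoids introducing the sign character of
the Weyl group. -/
theorem denom_weyl {w : Equiv.Perm (b.support → ℤ)} (hw : w ∈ weyl b) (x : b.support → ℤ) :
    denom b (w x) ^ 2 = denom b x ^ 2 := by
  induction hw using Subgroup.closure_induction generalizing x with
  | mem w hw =>
    obtain ⟨j, rfl⟩ := hw
    rw [reflPerm_apply, denom_refl, neg_sq]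
  | one => rfl
  | mul f g _ _ hf hg => rw [Equiv.Perm.mul_apply, hf, hg]
  | inv f _ hf =>
    have := hf (f⁻¹ x)
    rw [← this]; simp

theorem ev_nonneg_of_isPos {i : ι} (hi : b.IsPos i) {x : b.support → ℤ} (hx : ∀ j, 0 ≤ x j) :
    0 ≤ ev b i x := by
  have h1 : 0 ≤ pr b i x := by
    rw [pr_eq_sum]
    exact Finset.sum_nonneg fun j _ => mul_nonneg (by exact_mod_cast coef_nonneg b hi j)
      (div_nonneg (by exact_mod_cast hx j) (by positivity))
  have h2 : (0 : ℚ) < ratio b i := by exact_mod_cast ratio_pos b i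
  rw [pr, le_div_iff₀ h2, zero_mul] at h1
  exact_mod_cast h1

theorem ev_pos_of_isPos {i : ι} (hi : b.IsPos i) {x : b.support → ℤ} (hx : ∀ j, 0 < x j) :
    0 < ev b i x := by
  have h1 := pr_pos b hi hx
  have h2 : (0 : ℚ) < ratio b i := by exact_mod_cast ratio_pos b i
  rw [pr, lt_div_iff₀ h2, zero_mul] at h1
  exact_mod_cast h1

/-- Let v be the sum of the roots in S. The coordinates of ϱ − v are at least 1, so −v is dominant
and (−v, v) ≥ 0, which forces v = 0. For nonempty S this contradicts (ϱ, v) > 0. -/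
theorem rhoSub_dominant {S : Finset ι} (hS : S ⊆ posRoots b) (hpos : ∀ j, 0 < rhoSub b S j) :
    S = ∅ := by
  set v := ∑ i ∈ S, rt b i with hv
  have hd : ∀ j, 0 ≤ (-v) j := by
    intro j
    have := hpos j
    rw [rhoSub, ← hv] at this
    simp only [Pi.sub_apply, rho, Pi.neg_apply] at this ⊢
    omega
  have h1 : 0 ≤ 2 * form b (-v) v := by
    rw [hv, map_sum, Finset.mul_sum]
    refine Finset.sum_nonneg fun i hi => ?_
    rw [two_form_rt]
    exact mul_nonneg (ev_nonneg_of_isPos b ((mem_posRoots b).1 (hS hi)) hd) (form_self_nonneg b _)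
  have hv0 : v = 0 := by
    by_contra hne
    have := form_self_pos b hne
    rw [map_neg, LinearMap.neg_apply] at h1
    omega
  by_contra hne
  have h2 : 0 < 2 * form b (rho b) v := by
    rw [hv, map_sum, Finset.mul_sum]
    refine Finset.sum_pos (fun i hi => ?_) (Finset.nonempty_iff_ne_empty.2 hne)
    rw [two_form_rt]
    exact mul_pos (ev_pos_of_isPos b ((mem_posRoots b).1 (hS hi)) fun _ => one_pos) (len_pos b i)
  rw [hv0, map_zero] at h2
  omega

open Classical in
theorem denom_of_pos {x : b.support → ℤ} (hx : ∀ j, 0 < x j) :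
    denom b x = if rho b = x then 1 else 0 := by
  rw [denom, Finset.sum_eq_single ∅]
  · simp [rhoSub]
  · intro S hS hne
    rw [if_neg]
    rintro rfl
    exact hne (rhoSub_dominant b (Finset.mem_powerset.1 hS) hx)
  · intro h; exact absurd (Finset.empty_mem_powerset _) h

theorem denom_weyl_rho {w : Equiv.Perm (b.support → ℤ)} (hw : w ∈ weyl b) :
    denom b (w (rho b)) ^ 2 = 1 := by
  rw [denom_weyl b hw, denom_of_pos b (x := rho b) (fun _ => one_pos), if_pos rfl, one_pow]

/-- Antisymmetry kills the coefficients on the walls. A weight with nonzero coefficient can thus be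
moved to a strictly dominant one, and the only such weight in the denominator is ϱ. -/
theorem exists_weyl_of_denom_ne_zero {x : b.support → ℤ} (hx : denom b x ≠ 0) :
    ∃ w ∈ weyl b, w (rho b) = x := by
  obtain ⟨w, hw, h1⟩ := exists_weyl_nonneg b x
  have h2 : denom b (w x) ≠ 0 := fun h0 => hx <| by
    have := denom_weyl b hw x
    rw [h0] at this
    simpa using this.symm
  have h3 : ∀ j, 0 < w x j := by
    refine fun j => lt_of_le_of_ne (h1 j) fun h0 => h2 ?_
    have h4 := denom_refl b j (w x)
    rw [refl, ev_simple, ← h0, zero_smul, sub_zero] at h4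
    omega
  rw [denom_of_pos b h3] at h2
  have h4 : rho b = w x := by by_contra h; exact h2 (if_neg h)
  exact ⟨w⁻¹, inv_mem hw, by rw [h4]; simp⟩

open Classical in
/-- The weights occurring in the Weyl denominator. -/
def denomSupport : Finset (b.support → ℤ) :=
  ((posRoots b).powerset.image (rhoSub b)).filter fun x => denom b x ≠ 0

theorem rho_mem_alcove {h : ℤ} (hh : ev b (highestRoot b) (rho b) < h) : rho b ∈ alcove b h :=
  ⟨fun _ => one_pos, hh⟩

theorem mem_denomSupport {x : b.support → ℤ} : x ∈ denomSupport b ↔ denom b x ≠ 0 := by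
  classical
  rw [denomSupport, Finset.mem_filter, and_iff_right_iff_imp]
  intro h
  obtain ⟨S, hS, h1⟩ := Finset.exists_ne_zero_of_sum_ne_zero h
  refine Finset.mem_image.2 ⟨S, hS, ?_⟩
  by_contra h2
  exact h1 (if_neg h2)

/-- The Weyl group is in bijection with the weights of the Weyl denominator. -/
def weylEquivDenomSupport : weyl b ≃ denomSupport b :=
  Equiv.ofBijective
    (fun w => ⟨w.1 (rho b), (mem_denomSupport b).2 fun h => by
      have := denom_weyl_rho b w.2
      rw [h] at this; norm_num at this⟩)
    ⟨fun w w' h => by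
      have h1 : w.1 (rho b) = w'.1 (rho b) := congrArg Subtype.val h
      -- The alcove of level ⟨ϱ, θ⟩ + 1 contains ϱ, so the result on alcoves shows that ϱ has
      -- trivial stabiliser.
      have h2 := rho_mem_alcove b (lt_add_one (ev b (highestRoot b) (rho b)))
      exact Subtype.ext (weyl_alcove_injective b w.2 w'.2 h2 h2 (by
        rw [h1, sub_self]; exact zero_mem _)).1,
    fun x => by
      obtain ⟨w, hw, h⟩ := exists_weyl_of_denom_ne_zero b ((mem_denomSupport b).1 x.2)
      exact ⟨⟨w, hw⟩, Subtype.ext h⟩⟩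

instance : Finite (weyl b) := Finite.of_equiv _ (weylEquivDenomSupport b).symm

theorem sum_denom_sq : ∑ x ∈ denomSupport b, denom b x ^ 2 = Nat.card (weyl b) := by
  rw [Nat.card_congr (weylEquivDenomSupport b), Nat.card_eq_fintype_card, Fintype.card_coe,
    Finset.card_eq_sum_ones, Nat.cast_sum]
  refine Finset.sum_congr rfl fun x hx => ?_
  obtain ⟨w, hw, rfl⟩ := exists_weyl_of_denom_ne_zero b ((mem_denomSupport b).1 hx)
  rw [denom_weyl_rho b hw, Nat.cast_one]

open Classical in
/-- A double sum over sets of positive roots. -/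
theorem sum_sum_rhoSub_eq : ∑ S ∈ (posRoots b).powerset, ∑ T ∈ (posRoots b).powerset,
    (if rhoSub b S = rhoSub b T then (-1 : ℤ) ^ S.card * (-1) ^ T.card else 0) =
      Nat.card (weyl b) := by
  rw [← sum_denom_sq]
  have h1 : ∀ x ∈ (posRoots b).powerset.image (rhoSub b), x ∉ denomSupport b →
      denom b x ^ 2 = 0 := by
    intro x _ hx
    rw [mem_denomSupport, not_not] at hx
    rw [hx]; rfl
  rw [Finset.sum_subset (show denomSupport b ⊆ _ from Finset.filter_subset _ _) h1]
  have h2 : ∀ x, denom b x ^ 2 = ∑ S ∈ (posRoots b).powerset with rhoSub b S = x,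
      (-1) ^ S.card * denom b (rhoSub b S) := by
    intro x
    rw [Finset.sum_filter, sq]
    nth_rw 1 [denom]
    rw [Finset.sum_mul]
    refine Finset.sum_congr rfl fun S _ => ?_
    split_ifs with h
    · rw [h]
    · rw [zero_mul]
  rw [Finset.sum_congr rfl fun x _ => h2 x,
    Finset.sum_fiberwise_of_maps_to fun S hS => Finset.mem_image_of_mem _ hS]
  refine Finset.sum_congr rfl fun S _ => ?_
  rw [denom, Finset.mul_sum]
  refine Finset.sum_congr rfl fun T _ => ?_
  by_cases h : rhoSub b S = rhoSub b T
  · rw [if_pos h, if_pos h.symm]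
  · rw [if_neg h, if_neg (Ne.symm h), mul_zero]

/-! ### Characters of the weight lattice modulo the coroot lattice -/

/-- The normalised form on the weight lattice. -/
def nform (x y : b.support → ℤ) : ℚ := 2 * form b x y / len b (highestRoot b)

theorem nform_comm (x y : b.support → ℤ) : nform b x y = nform b y x := by
  rw [nform, form_comm, nform]

theorem nform_add (x y z : b.support → ℤ) : nform b x (y + z) = nform b x y + nform b x z := by
  simp only [nform, map_add]; push_cast; ring

theorem nform_zero (x : b.support → ℤ) : nform b x 0 = 0 := by simp [nform]

theorem nform_rt (x : b.support → ℤ) (i : ι) : nform b x (rt b i) = pr b i x :=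
  (pr_eq_form b i x).symm

theorem nform_self_pos {x : b.support → ℤ} (hx : x ≠ 0) : 0 < nform b x x :=
  div_pos (mul_pos two_pos (by exact_mod_cast form_self_pos b hx))
    (by exact_mod_cast len_pos b (highestRoot b))

theorem exists_nform_coLattice (h : ℤ) (x : b.support → ℤ) {v : b.support → ℤ}
    (hv : v ∈ coLattice b h) : ∃ m : ℤ, nform b x v = h * m := by
  induction hv using AddSubgroup.closure_induction with
  | mem v hv =>
    obtain ⟨j, rfl⟩ := hv
    refine ⟨ev b j x, ?_⟩
    have h1 : (0 : ℚ) < ratio b j := by exact_mod_cast ratio_pos b j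
    have h2 := nform_rt b x j
    rw [nform, pr, eq_div_iff h1.ne'] at h2
    rw [← h2, nform, map_zsmul, smul_eq_mul]
    push_cast; ring
  | zero => exact ⟨0, by simp [nform]⟩
  | add u v _ _ hu hv =>
    obtain ⟨m, hm⟩ := hu
    obtain ⟨n, hn⟩ := hv
    exact ⟨m + n, by rw [nform_add, hm, hn]; push_cast; ring⟩
  | neg v _ hv =>
    obtain ⟨m, hm⟩ := hv
    refine ⟨-m, ?_⟩
    have := nform_add b x v (-v)
    rw [add_neg_cancel, nform_zero, hm] at this
    push_cast; linarith

/-- The character of the weight lattice attached to a weight. -/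
def character (h : ℤ) (x : b.support → ℤ) : AddChar (b.support → ℤ) ℂ where
  toFun y := Complex.exp (2 * Real.pi * Complex.I * ((nform b x y : ℚ) / (h : ℂ)))
  map_zero_eq_one' := by simp [nform_zero]
  map_add_eq_mul' y z := by
    rw [← Complex.exp_add, nform_add]; congr 1; push_cast; ring

theorem character_apply (h : ℤ) (x y : b.support → ℤ) : character b h x y =
    Complex.exp (2 * Real.pi * Complex.I * ((nform b x y : ℚ) / (h : ℂ))) := rfl

theorem character_comm (h : ℤ) (x y : b.support → ℤ) : character b h x y = character b h y x := by
  rw [character_apply, nform_comm, character_apply]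

theorem character_eq_one (h : ℤ) (x : b.support → ℤ) {v : b.support → ℤ}
    (hv : v ∈ coLattice b h) : character b h x v = 1 := by
  obtain ⟨m, hm⟩ := exists_nform_coLattice b h x hv
  rw [character_apply, Complex.exp_eq_one_iff]
  rcases eq_or_ne h 0 with rfl | hh
  · exact ⟨0, by simp⟩
  · refine ⟨m, ?_⟩
    have : (h : ℂ) ≠ 0 := by exact_mod_cast hh
    rw [hm]; push_cast; field_simp

/-- The character attached to a weight, on the quotient of the weight lattice. -/
def quotCharacter (h : ℤ) (x : b.support → ℤ) : AddChar ((b.support → ℤ) ⧸ coLattice b h) ℂ :=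
  AddChar.toAddMonoidHomEquiv.symm <|
    QuotientAddGroup.lift (coLattice b h) (AddChar.toAddMonoidHomEquiv (character b h x))
      fun _ hv => congrArg Additive.ofMul (character_eq_one b h x hv)

theorem quotCharacter_mk (h : ℤ) (x y : b.support → ℤ) :
    quotCharacter b h x (QuotientAddGroup.mk y) = character b h x y := rfl

/-- Evaluate the character at x itself: the exponent ⟨x, x⟩/h lies strictly between 0 and 1. This is
where h has to be large. -/
theorem quotCharacter_ne_zero {h : ℤ} {x : b.support → ℤ} (hx : x ≠ 0) (hh : nform b x x < h) :
    quotCharacter b h x ≠ 0 := by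
  intro h0
  have h1 : quotCharacter b h x (QuotientAddGroup.mk x) = 1 := by rw [h0]; rfl
  rw [quotCharacter_mk, character_apply, Complex.exp_eq_one_iff] at h1
  obtain ⟨n, hn⟩ := h1
  have hpos := nform_self_pos b hx
  have hh0 : (0 : ℚ) < h := hpos.trans hh
  have h2 : ((nform b x x : ℚ) : ℂ) / (h : ℂ) = n := by
    have h3 : (2 * Real.pi * Complex.I : ℂ) ≠ 0 := by simp [Real.pi_ne_zero]
    rw [mul_comm (n : ℂ)] at hn
    exact mul_left_cancel₀ h3 hn
  have h4 : nform b x x / h = n := by exact_mod_cast h2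
  rw [div_eq_iff hh0.ne'] at h4
  rw [h4] at hpos hh
  have h5 : (0 : ℚ) < n := pos_of_mul_pos_left hpos hh0.le
  have h6 : (n : ℚ) < 1 := by nlinarith
  have h7 : 0 < n := by exact_mod_cast h5
  have h8 : n < 1 := by exact_mod_cast h6
  omega

/-- The squared modulus of the Weyl denominator. -/
def rootProd (h : ℤ) (x : b.support → ℤ) : ℂ := ∏ i, (1 - character b h x (rt b i))

theorem character_rt (h : ℤ) (x : b.support → ℤ) (i : ι) : character b h x (rt b i) =
    Complex.exp (2 * Real.pi * Complex.I * ((pr b i x : ℚ) / (h : ℂ))) := by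
  rw [character_apply, nform_rt]

theorem rootProd_eq (h : ℤ) (x : b.support → ℤ) : rootProd b h x = ∏ i ∈ posRoots b,
    ((1 - character b h x (rt b i)) * (1 - character b h x (-rt b i))) := by
  classical
  rw [rootProd, ← Finset.prod_filter_mul_prod_filter_not Finset.univ b.IsPos,
    Finset.prod_mul_distrib]
  congr 1
  refine Finset.prod_nbij' (fun i => P.reflectionPerm i i) (fun i => P.reflectionPerm i i)
    ?_ ?_ ?_ ?_ ?_
  · intro i hi
    rw [mem_posRoots]
    exact (isPos_or_neg b i).resolve_left (Finset.mem_filter.1 hi).2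
  · intro i hi
    exact Finset.mem_filter.2 ⟨Finset.mem_univ _, not_isPos_neg b ((mem_posRoots b).1 hi)⟩
  · intro i _; exact neg_neg_eq i
  · intro i _; exact neg_neg_eq i
  · intro i _
    rw [rt_neg, neg_neg]

/-- The character is arbitrary, because the expansion is applied both to a character and to its
inverse. -/
theorem mul_prod_one_sub (ψ : AddChar (b.support → ℤ) ℂ) :
    ψ (rho b) * ∏ i ∈ posRoots b, (1 - ψ (-rt b i)) =
      ∑ S ∈ (posRoots b).powerset, (-1) ^ S.card * ψ (rhoSub b S) := by
  have h1 : ∀ S : Finset ι, ψ (∑ i ∈ S, -rt b i) = ∏ i ∈ S, ψ (-rt b i) := by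
    intro S
    induction S using Finset.cons_induction with
    | empty => simp
    | cons i S hi ih => rw [Finset.sum_cons, Finset.prod_cons, AddChar.map_add_eq_mul, ih]
  simp only [sub_eq_add_neg, Finset.prod_one_add, Finset.mul_sum]
  refine Finset.sum_congr rfl fun S _ => ?_
  rw [Finset.prod_neg, ← h1, rhoSub, sub_eq_add_neg (rho b), AddChar.map_add_eq_mul,
    Finset.sum_neg_distrib]
  ring

theorem rootProd_eq_sum (h : ℤ) (x : b.support → ℤ) : rootProd b h x =
    ∑ S ∈ (posRoots b).powerset, ∑ T ∈ (posRoots b).powerset,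
      (-1) ^ S.card * (-1) ^ T.card * character b h (rhoSub b S - rhoSub b T) x := by
  have h1 := mul_prod_one_sub b (character b h x)
  have h2 := mul_prod_one_sub b (character b h x)⁻¹
  have h3 : character b h x (rho b) * (character b h x)⁻¹ (rho b) = 1 := by
    rw [AddChar.inv_apply, ← AddChar.map_add_eq_mul, add_neg_cancel, AddChar.map_zero_eq_one]
  have h4 : rootProd b h x = (character b h x (rho b) *
      ∏ i ∈ posRoots b, (1 - character b h x (-rt b i))) * ((character b h x)⁻¹ (rho b) *
      ∏ i ∈ posRoots b, (1 - (character b h x)⁻¹ (-rt b i))) := by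
    rw [mul_mul_mul_comm, h3, one_mul, rootProd_eq, Finset.prod_mul_distrib, mul_comm]
    simp only [AddChar.inv_apply, neg_neg]
  rw [h4, h1, h2, Finset.sum_mul_sum]
  refine Finset.sum_congr rfl fun S _ => Finset.sum_congr rfl fun T _ => ?_
  rw [character_comm b h _ x, sub_eq_add_neg, AddChar.map_add_eq_mul, AddChar.inv_apply]
  ring

/-- The squared modulus of the Weyl denominator, on the quotient of the weight lattice. -/
def quotRootProd (h : ℤ) (x : (b.support → ℤ) ⧸ coLattice b h) : ℂ :=
  ∑ S ∈ (posRoots b).powerset, ∑ T ∈ (posRoots b).powerset,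
      (-1) ^ S.card * (-1) ^ T.card * quotCharacter b h (rhoSub b S - rhoSub b T) x

theorem quotRootProd_mk (h : ℤ) (x : b.support → ℤ) :
    quotRootProd b h (QuotientAddGroup.mk x) = rootProd b h x := by
  simp only [quotRootProd, quotCharacter_mk, rootProd_eq_sum]

theorem character_zero (h : ℤ) (y : b.support → ℤ) : character b h 0 y = 1 := by
  rw [character_comm, AddChar.map_zero_eq_one]

theorem quotCharacter_zero (h : ℤ) : quotCharacter b h 0 = 0 := by
  ext x
  obtain ⟨y, rfl⟩ := QuotientAddGroup.mk_surjective x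
  rw [quotCharacter_mk, character_zero]; rfl

/-- By orthogonality only the pairs S, T with equal `rhoSub` survive. Their signs add up to the sum
of the squared coefficients of the Weyl denominator, which is |W|. -/
theorem sum_quotRootProd {h : ℤ} [Fintype ((b.support → ℤ) ⧸ coLattice b h)]
    (hh : ∀ S ⊆ posRoots b, ∀ T ⊆ posRoots b,
      nform b (rhoSub b S - rhoSub b T) (rhoSub b S - rhoSub b T) < h) :
    ∑ x, quotRootProd b h x = (coLattice b h).index * Nat.card (weyl b) := by
  classical
  simp only [quotRootProd]
  rw [Finset.sum_comm]
  have h1 : ∀ S ∈ (posRoots b).powerset, ∀ T ∈ (posRoots b).powerset,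
      ∑ x, ((-1 : ℂ) ^ S.card * (-1) ^ T.card * quotCharacter b h (rhoSub b S - rhoSub b T) x) =
        (coLattice b h).index *
          ((if rhoSub b S = rhoSub b T then (-1 : ℤ) ^ S.card * (-1) ^ T.card else 0 : ℤ) : ℂ) := by
    intro S hS T hT
    rw [← Finset.mul_sum, AddChar.sum_eq_ite, AddSubgroup.index, Nat.card_eq_fintype_card]
    by_cases hST : rhoSub b S = rhoSub b T
    · rw [if_pos hST, if_pos (by rw [hST, sub_self, quotCharacter_zero])]
      push_cast; ring
    · rw [if_neg hST, if_neg (quotCharacter_ne_zero b (sub_ne_zero.2 hST)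
        (hh S (Finset.mem_powerset.1 hS) T (Finset.mem_powerset.1 hT)))]
      simp
  have h2 := sum_sum_rhoSub_eq b
  have h3 : ((Nat.card (weyl b) : ℤ) : ℂ) = Nat.card (weyl b) := by push_cast; rfl
  rw [← h3, ← h2]
  push_cast
  rw [Finset.mul_sum]
  refine Finset.sum_congr rfl fun S hS => ?_
  rw [Finset.sum_comm, Finset.mul_sum]
  refine Finset.sum_congr rfl fun T hT => ?_
  rw [h1 S hS T hT]
  push_cast; rfl

/-! ### Reduction to the alcove -/

theorem rootProd_weyl (h : ℤ) {w : Equiv.Perm (b.support → ℤ)} (hw : w ∈ weyl b)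
    (x : b.support → ℤ) : rootProd b h (w x) = rootProd b h x := by
  induction hw using Subgroup.closure_induction generalizing x with
  | mem w hw =>
    obtain ⟨j, rfl⟩ := hw
    simp only [rootProd, character_rt]
    refine Fintype.prod_equiv (P.reflectionPerm j) _ _ fun i => ?_
    rw [reflPerm_apply, pr_refl]
  | one => rfl
  | mul f g _ _ hf hg => rw [Equiv.Perm.mul_apply, hf, hg]
  | inv f _ hf =>
    rw [← hf (f⁻¹ x)]; simp

/-- On a wall of the closed alcove one of the factors 1 − exp(2πi⟨x, α⟩/h) is zero. -/
theorem mem_alcove_of_rootProd_ne_zero {h : ℤ} (hh : h ≠ 0) {x : b.support → ℤ}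
    (h1 : ∀ j, 0 ≤ x j)
    (h2 : ev b (highestRoot b) x ≤ h) (hx : rootProd b h x ≠ 0) : x ∈ alcove b h := by
  have h3 : ∀ i, character b h x (rt b i) ≠ 1 := fun i h4 =>
    hx (Finset.prod_eq_zero (Finset.mem_univ i) (by rw [h4, sub_self]))
  refine ⟨fun j => lt_of_le_of_ne (h1 j) fun h4 => h3 j ?_, lt_of_le_of_ne h2 fun h4 =>
    h3 (highestRoot b) ?_⟩
  · rw [character_rt, pr_simple, ← h4]; simp
  · have : (h : ℂ) ≠ 0 := by exact_mod_cast hh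
    rw [character_rt, pr_highestRoot, h4, Rat.cast_intCast, div_self this, mul_one,
      Complex.exp_two_pi_mul_I]

/-- The map from translates of the alcove by the Weyl group to the quotient of the lattice. -/
def fromAlcove (h : ℤ) (p : weyl b × alcove b h) : (b.support → ℤ) ⧸ coLattice b h :=
  QuotientAddGroup.mk (p.1.1 p.2.1)

theorem fromAlcove_injective (h : ℤ) : Function.Injective (fromAlcove b h) := by
  rintro ⟨⟨w, hw⟩, ⟨x, hx⟩⟩ ⟨⟨w', hw'⟩, ⟨x', hx'⟩⟩ hxx
  have h1 : w' x' - w x ∈ coLattice b h := by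
    have := QuotientAddGroup.eq.1 hxx
    rwa [neg_add_eq_sub] at this
  obtain ⟨rfl, rfl⟩ := weyl_alcove_injective b hw' hw hx' hx h1
  rfl

theorem finite_alcove (h : ℤ) [Finite ((b.support → ℤ) ⧸ coLattice b h)] :
    Finite (alcove b h) :=
  Finite.of_injective (fun x => fromAlcove b h (1, x)) fun _ _ hxy =>
    (Prod.ext_iff.1 (fromAlcove_injective b h hxy)).2

theorem sum_rootProd_alcove {h : ℤ} [Fintype ((b.support → ℤ) ⧸ coLattice b h)]
    [Fintype (alcove b h)] (hρ : ev b (highestRoot b) (rho b) < h)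
    (hh : ∀ S ⊆ posRoots b, ∀ T ⊆ posRoots b,
      nform b (rhoSub b S - rhoSub b T) (rhoSub b S - rhoSub b T) < h) :
    ∑ x : alcove b h, rootProd b h x = (coLattice b h).index := by
  have := Fintype.ofFinite (weyl b)
  have hpos : (Nat.card (weyl b) : ℂ) ≠ 0 := by exact_mod_cast Nat.card_pos.ne'
  have hh0 : h ≠ 0 := by
    have := hh ∅ (Finset.empty_subset _) ∅ (Finset.empty_subset _)
    rw [sub_self, nform_zero] at this
    exact_mod_cast this.ne'
  -- The Weyl translates of the alcove embed in the quotient. A class outside their image can be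
  -- moved to the boundary of the alcove, where the summand vanishes.
  have key : ∑ p : weyl b × alcove b h, rootProd b h p.2 = ∑ x, quotRootProd b h x := by
    refine Fintype.sum_of_injective (fromAlcove b h) (fromAlcove_injective b h) _ _ ?_ ?_
    · intro q hq
      by_contra hne
      obtain ⟨x, rfl⟩ := QuotientAddGroup.mk_surjective q
      rw [quotRootProd_mk] at hne
      obtain ⟨g, hg, h1, h2⟩ := exists_affWeyl_mem_closure b hρ x
      obtain ⟨w, hw, v, hv, h3⟩ := exists_weyl_of_mem_affWeyl b hg
      have h4 : (QuotientAddGroup.mk (g x) : (b.support → ℤ) ⧸ coLattice b h) =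
          QuotientAddGroup.mk (w x) := by
        rw [QuotientAddGroup.eq, h3]
        have := neg_mem hv
        convert this using 1; abel
      have h5 : rootProd b h (g x) = rootProd b h x := by
        rw [← quotRootProd_mk, h4, quotRootProd_mk, rootProd_weyl b h hw]
      have h6 := mem_alcove_of_rootProd_ne_zero b hh0 h1 h2 (h5 ▸ hne)
      refine hq ⟨(⟨w⁻¹, inv_mem hw⟩, ⟨g x, h6⟩), ?_⟩
      rw [fromAlcove, QuotientAddGroup.eq]
      have e : w⁻¹ (g x) = x + w⁻¹ v := by
        rw [h3, weyl_add b (inv_mem hw)]; simp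
      simp only [e]
      have := neg_mem (weyl_mem_coLattice b (inv_mem hw) hv)
      convert this using 1; abel
    · rintro ⟨⟨w, hw⟩, x⟩
      rw [fromAlcove, quotRootProd_mk, rootProd_weyl b h hw]
  rw [sum_quotRootProd b hh, Fintype.sum_prod_type] at key
  simp only [Finset.sum_const, nsmul_eq_mul, Finset.card_univ, ← Nat.card_eq_fintype_card] at key
  rw [mul_comm] at key
  exact mul_right_cancel₀ hpos key

theorem exists_bound : ∃ h₀ : ℤ, ∀ h ≥ h₀, ev b (highestRoot b) (rho b) < h ∧
    ∀ S ⊆ posRoots b, ∀ T ⊆ posRoots b,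
      nform b (rhoSub b S - rhoSub b T) (rhoSub b S - rhoSub b T) < h := by
  obtain ⟨c, hc⟩ := (Set.toFinite (Set.range fun p : Finset ι × Finset ι =>
    nform b (rhoSub b p.1 - rhoSub b p.2) (rhoSub b p.1 - rhoSub b p.2))).bddAbove
  refine ⟨max (ev b (highestRoot b) (rho b) + 1) (⌊c⌋ + 1), fun h hh => ⟨?_, fun S _ T _ => ?_⟩⟩
  · exact lt_of_lt_of_le (lt_add_one _) ((le_max_left _ _).trans hh)
  · refine (hc ⟨(S, T), rfl⟩).trans_lt ((Int.lt_floor_add_one c).trans_le ?_)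
    exact_mod_cast (le_max_right _ _).trans hh

/-! ### The index of the coroot lattice -/

theorem linearIndependent_rt : LinearIndependent ℤ fun j : b.support => rt b j := by
  refine LinearIndependent.of_comp (wt b) ?_
  have h1 : (wt b : (b.support → ℤ) → M) ∘ (fun j : b.support => rt b j) =
      fun j : b.support => P.root j := funext fun j => wt_rt b j
  rw [h1]
  exact b.linearIndepOn_root.restrict_scalars' ℤ

open Classical in
/-- The matrix of the coroot lattice in the basis of fundamental weights. -/
def latticeMatrix : Matrix b.support b.support ℤ := Matrix.of fun j k => ratio b j * rt b j k

open Classical in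
theorem index_coLattice {h : ℕ} (hh : 0 < h) : (coLattice b h).index =
    h ^ Fintype.card b.support * (latticeMatrix b).det.natAbs := by
  have hli : LinearIndependent ℤ fun j : b.support => ((h : ℤ) * ratio b j) • rt b j := by
    have hli := linearIndependent_rt b
    rw [Fintype.linearIndependent_iff] at hli ⊢
    intro c hc j
    simp only [← mul_smul] at hc
    have h1 := hli _ hc j
    have h2 : ((h : ℤ) * ratio b j) ≠ 0 :=
      mul_ne_zero (by exact_mod_cast hh.ne') (by exact_mod_cast (ratio_pos b j).ne')
    exact (mul_eq_zero.1 h1).resolve_right h2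
  have h1 := Submodule.natAbs_det_basis_change (Pi.basisFun ℤ b.support) _ (Module.Basis.span hli)
  have h2 : (coLattice b h).index = Nat.card ((b.support → ℤ) ⧸
      Submodule.span ℤ (Set.range fun j : b.support => ((h : ℤ) * ratio b j) • rt b j)) := by
    rw [coLattice, ← Submodule.span_int_eq_addSubgroupClosure]; rfl
  rw [h2, ← h1, Module.Basis.det_apply]
  have h3 : (Pi.basisFun ℤ b.support).toMatrix (Subtype.val ∘ Module.Basis.span hli) =
      ((h : ℤ) • latticeMatrix b).transpose := by
    ext i j
    simp only [Module.Basis.toMatrix_apply, Function.comp_apply, Module.Basis.span_apply,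
      Pi.basisFun_repr, Matrix.transpose_apply, Matrix.smul_apply, latticeMatrix, Matrix.of_apply,
      Pi.smul_apply, smul_eq_mul]
    ring
  rw [h3, Matrix.det_transpose, Matrix.det_smul, Int.natAbs_mul, Int.natAbs_pow, Int.natAbs_natCast]

theorem fundamentalForm_wt (x y : b.support → ℤ) :
    fundamentalForm b (wt b x) (wt b y) = (nform b x y : ℂ) := by
  rw [fundamentalForm, LinearMap.smul_apply, LinearMap.smul_apply, ← cast_form, ← wt_rt b,
    ← cast_form, nform, len, smul_eq_mul]
  push_cast; ring

theorem fundamentalForm_wt_root (x : b.support → ℤ) (i : ι) :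
    fundamentalForm b (wt b x) (P.root i) = (pr b i x : ℂ) := by
  rw [← wt_rt b, fundamentalForm_wt, nform_rt]

theorem nform_sum (x : b.support → ℤ) (S : Finset b.support) (f : b.support → b.support → ℤ) :
    nform b x (∑ j ∈ S, f j) = ∑ j ∈ S, nform b x (f j) := by
  induction S using Finset.cons_induction with
  | empty => simp [nform_zero]
  | cons i S hi ih => rw [Finset.sum_cons, Finset.sum_cons, nform_add, ih]

theorem nform_zsmul (x y : b.support → ℤ) (n : ℤ) : nform b x (n • y) = n * nform b x y := by
  simp only [nform, map_zsmul, smul_eq_mul]; push_cast; ring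

-- The rows of `latticeMatrix` are the coroots in the basis of fundamental weights, and ⟨ω_i, α_k^∨⟩
-- = δ_ik. Hence the Gram matrix of the fundamental weights inverts its transpose.
open Classical in
theorem formDet_mul_det : formDet b * ((latticeMatrix b).det : ℂ) = 1 := by
  have hw : ∀ i : b.support, fundamentalWeight b i = wt b (Pi.single i 1) := by
    intro i
    refine eq_of_coroot'_eq b fun j => ?_
    rw [coroot'_simple_wt, coroot'_fundamentalWeight, Pi.single_apply]
    split_ifs <;> simp
  have h1 : formDet b = Matrix.det (Matrix.of fun i j : b.support =>
      (nform b (Pi.single i 1) (Pi.single j 1) : ℂ)) := by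
    rw [formDet]
    congr 1
    ext i j
    rw [Matrix.of_apply, Matrix.of_apply, hw, hw, fundamentalForm_wt]
  have h2 : ((latticeMatrix b).det : ℂ) =
      ((latticeMatrix b).transpose.map (Int.castRingHom ℂ)).det := by
    rw [Matrix.transpose_map, Matrix.det_transpose]
    exact RingHom.map_det (Int.castRingHom ℂ) (latticeMatrix b)
  rw [h1, h2, ← Matrix.det_mul]
  rw [← Matrix.det_one (n := b.support) (R := ℂ)]
  congr 1
  ext i k
  rw [Matrix.mul_apply]
  simp only [Matrix.of_apply, Matrix.map_apply, Matrix.transpose_apply, latticeMatrix]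
  have h3 : ((ratio b k : ℤ) • rt b k : b.support → ℤ) =
      ∑ j, ((ratio b k : ℤ) * rt b k j) • Pi.single j 1 := by
    funext l
    simp [Finset.sum_apply, Pi.single_apply]
  have h4 : nform b (Pi.single i 1) ((ratio b k : ℤ) • rt b k) = if i = k then 1 else 0 := by
    have h5 : (ratio b k : ℚ) ≠ 0 := by exact_mod_cast (ratio_pos b k).ne'
    rw [nform_zsmul, nform_rt, pr_simple, Pi.single_apply]
    by_cases h : i = k
    · rw [if_pos h, if_pos h.symm]; push_cast; field_simp
    · rw [if_neg h, if_neg (Ne.symm h)]; simp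
  rw [h3, nform_sum] at h4
  simp only [nform_zsmul] at h4
  have h6 : ((if i = k then 1 else 0 : ℚ) : ℂ) = (1 : Matrix b.support b.support ℂ) i k := by
    rw [Matrix.one_apply]; split_ifs <;> simp
  rw [← h6, ← h4]
  push_cast
  exact Finset.sum_congr rfl fun j _ => by simp; ring

-- The matrix is a positive multiple of E Eᵀ, the Gram matrix of the coroots, so its determinant is
-- nonnegative. This removes the absolute value from the index.
open Classical in
theorem latticeMatrix_det_pos : 0 < (latticeMatrix b).det := by
  have hne : (latticeMatrix b).det ≠ 0 := fun h => by
    have := formDet_mul_det b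
    rw [h] at this; simp at this
  refine lt_of_le_of_ne ?_ hne.symm
  set E : Matrix b.support ι ℝ := Matrix.of fun j i => (ratio b j * ev b i (rt b j) : ℤ) with hE
  have hK : (0 : ℝ) < len b (highestRoot b) := by exact_mod_cast len_pos b (highestRoot b)
  have h1 : (latticeMatrix b).map (Int.castRingHom ℝ) =
      (2 / (len b (highestRoot b) : ℝ)) • (E * E.conjTranspose) := by
    ext j k
    rw [Matrix.smul_apply, Matrix.mul_apply]
    have h2 : (∑ i, E j i * E.conjTranspose i k) =
        ((ratio b j * ratio b k * form b (rt b j) (rt b k) : ℤ) : ℝ) := by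
      rw [form_apply, Finset.mul_sum]
      push_cast
      refine Finset.sum_congr rfl fun i _ => ?_
      simp only [hE, Matrix.conjTranspose_apply, Matrix.of_apply, star_trivial]
      push_cast; ring
    have h3 := two_form_rt b k (rt b j)
    have h4 := ratio_mul_len b k
    have h5 : (ratio b k : ℤ) * (2 * form b (rt b j) (rt b k)) =
        rt b j k * len b (highestRoot b) := by
      rw [h3, ← h4, ev_simple, len]; ring
    have h6 : (ratio b k : ℝ) * (2 * (form b (rt b j) (rt b k) : ℤ)) =
        rt b j k * len b (highestRoot b) := by exact_mod_cast h5
    rw [h2, Matrix.map_apply, latticeMatrix, Matrix.of_apply, smul_eq_mul, div_mul_eq_mul_div,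
      eq_div_iff hK.ne']
    push_cast
    simp only [eq_intCast, Int.cast_mul, Int.cast_natCast]
    linear_combination -(ratio b j : ℝ) * h6
  have h2 : ((latticeMatrix b).det : ℝ) = ((latticeMatrix b).map (Int.castRingHom ℝ)).det :=
    RingHom.map_det (Int.castRingHom ℝ) (latticeMatrix b)
  have h3 : (0 : ℝ) ≤ ((latticeMatrix b).det : ℝ) := by
    rw [h2, h1, Matrix.det_smul]
    exact mul_nonneg (by positivity) (Matrix.posSemidef_self_mul_conjTranspose E).det_nonneg
  exact_mod_cast h3

theorem formDet_ne_zero : formDet b ≠ 0 := left_ne_zero_of_mul_eq_one (formDet_mul_det b)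

theorem index_mul_formDet {h : ℕ} (hh : 0 < h) :
    ((coLattice b h).index : ℂ) * formDet b = (h : ℂ) ^ Fintype.card b.support := by
  classical
  have h1 : (((latticeMatrix b).det.natAbs : ℕ) : ℂ) = (latticeMatrix b).det := by
    have : (((latticeMatrix b).det.natAbs : ℕ) : ℤ) = (latticeMatrix b).det :=
      Int.natAbs_of_nonneg (latticeMatrix_det_pos b).le
    rw [← Int.cast_natCast, this]
  rw [index_coLattice b hh]
  push_cast
  rw [h1, mul_assoc, mul_comm ((latticeMatrix b).det : ℂ), formDet_mul_det, mul_one]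

theorem finite_quotient {h : ℕ} (hh : 0 < h) : Finite ((b.support → ℤ) ⧸ coLattice b h) := by
  have h1 : (coLattice b h).index ≠ 0 := by
    rw [index_coLattice b hh]
    exact mul_ne_zero (pow_ne_zero _ hh.ne')
      (Int.natAbs_ne_zero.2 (latticeMatrix_det_pos b).ne')
  exact Nat.finite_of_card_ne_zero h1

/-! ### The global dimension -/

theorem dualCoxeterNumber_eq : (dualCoxeterNumber b : ℤ) = ev b (highestRoot b) (rho b) + 1 := by
  have h1 : b.flip.height (highestRoot b) = ev b (highestRoot b) (rho b) := by
    rw [height_eq_sum_coef, ev_apply]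
    exact Finset.sum_congr rfl fun j _ => (mul_one _).symm
  have h2 := ev_pos_of_isPos b (isPos_highestRoot b) (x := rho b) fun _ => one_pos
  rw [dualCoxeterNumber, h1]; omega

theorem weight_eq_wt (n : b.support → ℕ) : weight b n = wt b fun j => n j := by
  rw [weight, wt_apply]
  refine Finset.sum_congr rfl fun j _ => ?_
  rw [natCast_zsmul, Nat.cast_smul_eq_nsmul]

theorem weylVector_eq_wt : weylVector b = wt b (rho b) := by
  rw [weylVector, wt_apply]
  simp [rho]

theorem mem_simpleObjects {k : ℕ} {n : b.support → ℕ} :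
    n ∈ simpleObjects b k ↔ ev b (highestRoot b) (fun j => (n j : ℤ)) ≤ k := by
  have h1 : fundamentalForm b (weight b n) (P.root (highestRoot b)) =
      (ev b (highestRoot b) (fun j => (n j : ℤ)) : ℂ) := by
    rw [weight_eq_wt, fundamentalForm_wt_root, pr_highestRoot]; simp
  have h2 : 0 ≤ ev b (highestRoot b) (fun j => (n j : ℤ)) :=
    ev_nonneg_of_isPos b (isPos_highestRoot b) fun j => by positivity
  rw [simpleObjects, Set.mem_ofPred_eq, h1]
  constructor
  · rintro ⟨m, hm, h3⟩
    have : ev b (highestRoot b) (fun j => (n j : ℤ)) = m := by exact_mod_cast h3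
    omega
  · intro h3
    refine ⟨(ev b (highestRoot b) (fun j => (n j : ℤ))).toNat, by omega, ?_⟩
    have : (((ev b (highestRoot b) (fun j => (n j : ℤ))).toNat : ℕ) : ℤ) =
        ev b (highestRoot b) (fun j => (n j : ℤ)) := by omega
    exact_mod_cast this.symm

/-- The shift by the Weyl vector. -/
def shift (n : b.support → ℕ) : b.support → ℤ := (fun j => (n j : ℤ)) + rho b

/-- As g = ⟨ϱ, θ⟩ + 1, the condition ⟨n, θ⟩ ≤ k becomes the strict inequality ⟨n + ϱ, θ⟩ < g + k. -/
theorem bijOn_shift (k : ℕ) : Set.BijOn (shift b) (simpleObjects b k)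
    (alcove b ((dualCoxeterNumber b + k : ℕ) : ℤ)) := by
  have hg := dualCoxeterNumber_eq b
  refine ⟨fun n hn => ⟨fun j => ?_, ?_⟩, fun m _ n _ h => ?_, fun x hx => ?_⟩
  · simp only [shift, Pi.add_apply, rho]; positivity
  · rw [mem_simpleObjects] at hn
    rw [shift, map_add]; push_cast; omega
  · funext j
    have := congrFun h j
    simpa [shift] using this
  · have h1 : shift b (fun j => (x j - 1).toNat) = x := by
      funext j
      have := hx.1 j
      simp only [shift, Pi.add_apply, rho]; omega
    refine ⟨fun j => (x j - 1).toNat, ?_, h1⟩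
    rw [mem_simpleObjects]
    have h2 := hx.2
    rw [← h1, shift, map_add] at h2
    push_cast at h2; omega

/-- The argument π/h lies in the principal range, so q^x = exp(iπx/h). With z = q^x, (z − z⁻¹)² =
−(1 − z²)(1 − z⁻²). -/
theorem qNumber_rootOfUnity_sq {h : ℕ} (hh : 2 ≤ h) (x : ℚ) :
    qNumber (Complex.exp (((Real.pi / (h : ℝ) : ℝ) : ℂ) * Complex.I)) x ^ 2 =
      -((1 - Complex.exp (2 * Real.pi * Complex.I * (x / (h : ℂ)))) *
        (1 - Complex.exp (-(2 * Real.pi * Complex.I * (x / (h : ℂ))))) /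
      (Complex.exp (((Real.pi / (h : ℝ) : ℝ) : ℂ) * Complex.I) -
        (Complex.exp (((Real.pi / (h : ℝ) : ℝ) : ℂ) * Complex.I))⁻¹) ^ 2) := by
  set t : ℝ := Real.pi / (h : ℝ) with ht
  have hh0 : (0 : ℝ) < h := by positivity
  have ht0 : 0 < t := by positivity
  have ht1 : t ≤ Real.pi := div_le_self Real.pi_pos.le (by exact_mod_cast (by omega : 1 ≤ h))
  have hlog : Complex.log (Complex.exp ((t : ℂ) * Complex.I)) = t * Complex.I :=
    Complex.log_exp (by simp; linarith) (by simpa using ht1)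
  have hpow : ∀ c : ℂ, Complex.exp ((t : ℂ) * Complex.I) ^ c = Complex.exp (t * Complex.I * c) :=
    fun c => by rw [Complex.cpow_def_of_ne_zero (Complex.exp_ne_zero _), hlog]
  set z := Complex.exp (t * Complex.I * x) with hz
  have h1 : Complex.exp (t * Complex.I * -(x : ℂ)) = z⁻¹ := by
    rw [hz, ← Complex.exp_neg]; congr 1; ring
  have h2 : Complex.exp (2 * Real.pi * Complex.I * (x / (h : ℂ))) = z ^ 2 := by
    rw [hz, ← Complex.exp_nat_mul, ht]; congr 1; push_cast; ring
  have hz0 : z ≠ 0 := Complex.exp_ne_zero _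
  rw [qNumber, hpow, hpow, h1, Complex.exp_neg, h2, div_pow, ← neg_div]
  congr 1
  field_simp; ring

/-- The signs and the squares of q − q⁻¹ cancel between numerator and denominator, root by root. -/
theorem qdim_sq (k : ℕ) (n : b.support → ℕ) : qdim b k n ^ 2 =
    rootProd b (dualCoxeterNumber b + k : ℕ) (shift b n) /
      rootProd b (dualCoxeterNumber b + k : ℕ) (rho b) := by
  have hg := dualCoxeterNumber_eq b
  have hg2 := ev_pos_of_isPos b (isPos_highestRoot b) (x := rho b) fun _ => one_pos
  have hh : 2 ≤ dualCoxeterNumber b + k := by omega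
  have h1 : weight b n + weylVector b = wt b (shift b n) := by
    rw [weight_eq_wt, weylVector_eq_wt, shift, map_add]
  have hneg : ∀ (x : b.support → ℤ) i, character b (dualCoxeterNumber b + k : ℕ) x (-rt b i) =
      Complex.exp (-(2 * Real.pi * Complex.I * ((pr b i x : ℚ) /
        ((dualCoxeterNumber b + k : ℕ) : ℂ)))) := by
    intro x i
    rw [AddChar.map_neg_eq_inv, character_rt, ← Complex.exp_neg, Int.cast_natCast]
  have hpos : ∀ (x : b.support → ℤ) i, character b (dualCoxeterNumber b + k : ℕ) x (rt b i) =
      Complex.exp (2 * Real.pi * Complex.I * ((pr b i x : ℚ) /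
        ((dualCoxeterNumber b + k : ℕ) : ℂ))) := by
    intro x i
    rw [character_rt, Int.cast_natCast]
  have hq : (Complex.exp (((Real.pi / ((dualCoxeterNumber b + k : ℕ) : ℝ) : ℝ) : ℂ) * Complex.I) -
      (Complex.exp (((Real.pi / ((dualCoxeterNumber b + k : ℕ) : ℝ) : ℝ) : ℂ) * Complex.I))⁻¹) ^ 2
        ≠ 0 := by
    set t : ℝ := Real.pi / ((dualCoxeterNumber b + k : ℕ) : ℝ) with ht
    have hr : (2 : ℝ) ≤ ((dualCoxeterNumber b + k : ℕ) : ℝ) := by exact_mod_cast hh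
    have ht0 : 0 < t := div_pos Real.pi_pos (by linarith)
    have ht1 : t < Real.pi := by
      rw [ht, div_lt_iff₀ (by linarith)]; nlinarith [Real.pi_pos]
    rw [← Complex.exp_neg, ← neg_mul]
    refine pow_ne_zero _ fun h0 => ?_
    have h2 := Complex.two_sin (t : ℂ)
    have h3 : Complex.exp (-(t : ℂ) * Complex.I) - Complex.exp ((t : ℂ) * Complex.I) = 0 := by
      linear_combination -h0
    rw [h3, zero_mul] at h2
    have h4 : Complex.sin (t : ℂ) = 0 := by simpa using h2
    have h5 : Real.sin t = 0 := by exact_mod_cast h4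
    exact (Real.sin_pos_of_pos_of_lt_pi ht0 ht1).ne' h5
  rw [qdim, rootProd_eq, rootProd_eq, ← Finset.prod_pow, ← Finset.prod_div_distrib, posRoots]
  refine Finset.prod_congr rfl fun i _ => ?_
  rw [h1, weylVector_eq_wt, fundamentalForm_wt_root, fundamentalForm_wt_root, rootOfUnity_eq,
    div_pow, qNumber_rootOfUnity_sq hh, qNumber_rootOfUnity_sq hh, neg_div_neg_eq,
    div_div_div_cancel_right₀ hq, hpos, hpos, hneg, hneg]

theorem globalDim_eq {k : ℕ} (h1 : ev b (highestRoot b) (rho b) < (dualCoxeterNumber b + k : ℕ))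
    (h2 : ∀ S ⊆ posRoots b, ∀ T ⊆ posRoots b, nform b (rhoSub b S - rhoSub b T)
      (rhoSub b S - rhoSub b T) < ((dualCoxeterNumber b + k : ℕ) : ℤ)) :
    globalDim b k = ((dualCoxeterNumber b + k : ℕ) : ℂ) ^ Fintype.card b.support / formDet b /
      rootProd b (dualCoxeterNumber b + k : ℕ) (rho b) := by
  have hh : 0 < dualCoxeterNumber b + k := by rw [dualCoxeterNumber]; omega
  have := finite_quotient b hh
  have := finite_alcove b ((dualCoxeterNumber b + k : ℕ) : ℤ)
  have := Fintype.ofFinite (alcove b ((dualCoxeterNumber b + k : ℕ) : ℤ))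
  have := Fintype.ofFinite ((b.support → ℤ) ⧸ coLattice b ((dualCoxeterNumber b + k : ℕ) : ℤ))
  have h3 := sum_rootProd_alcove b h1 h2
  rw [globalDim, finsum_mem_eq_of_bijOn (shift b) (bijOn_shift b k)
    (g := fun x => rootProd b (dualCoxeterNumber b + k : ℕ) x /
      rootProd b (dualCoxeterNumber b + k : ℕ) (rho b)) fun n _ => qdim_sq b k n,
    ← finsum_set_coe_eq_finsum_mem, finsum_eq_sum_of_fintype, ← Finset.sum_div, h3,
    ← index_mul_formDet b hh, mul_div_cancel_right₀ _ (formDet_ne_zero b)]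

/-! ### Asymptotics of the global dimension -/

/-- This is the derivative of exp(ct) at t = 0, along t = 1/(g+k). -/
theorem tendsto_mul_one_sub_exp (c : ℂ) (g : ℕ) : Filter.Tendsto
    (fun k : ℕ => ((g + k : ℕ) : ℂ) * (1 - Complex.exp (c / ((g + k : ℕ) : ℂ)))) Filter.atTop
    (nhds (-c)) := by
  have h1 : HasDerivAt (fun t : ℂ => Complex.exp (c * t)) c 0 := by
    have := ((hasDerivAt_id (0 : ℂ)).const_mul c).cexp
    simpa using this
  have h2 := hasDerivAt_iff_tendsto_slope_zero.1 h1
  have h3 : Filter.Tendsto (fun k : ℕ => (((g + k : ℕ) : ℂ))⁻¹) Filter.atTop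
      (nhdsWithin 0 {0}ᶜ) := by
    refine tendsto_nhdsWithin_iff.2 ⟨?_, ?_⟩
    · have h4 : Filter.Tendsto (fun k : ℕ => g + k) Filter.atTop Filter.atTop :=
        Filter.tendsto_atTop_mono (fun k => Nat.le_add_left k g) Filter.tendsto_id
      exact (tendsto_inv_atTop_nhds_zero_nat (𝕜 := ℂ)).comp h4
    · filter_upwards [Filter.eventually_gt_atTop 0] with k hk
      have : ((g + k : ℕ) : ℂ) ≠ 0 := by exact_mod_cast (by omega : g + k ≠ 0)
      simpa using this
  have h4 := (h2.comp h3).neg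
  refine h4.congr fun k => ?_
  simp only [Function.comp_apply, zero_add, mul_zero, Complex.exp_zero, inv_inv, smul_eq_mul]
  rw [div_eq_mul_inv]; ring

theorem rootProd_rho_tendsto : Filter.Tendsto
    (fun k : ℕ => ((dualCoxeterNumber b + k : ℕ) : ℂ) ^ (2 * (posRoots b).card) *
      rootProd b (dualCoxeterNumber b + k : ℕ) (rho b)) Filter.atTop
    (nhds ((2 * Real.pi : ℂ) ^ (2 * (posRoots b).card) *
      ((∏ i ∈ posRoots b, pr b i (rho b) : ℚ) : ℂ) ^ 2)) := by
  have h1 : ∀ i, Filter.Tendsto (fun k : ℕ => ((dualCoxeterNumber b + k : ℕ) : ℂ) ^ 2 *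
      ((1 - character b (dualCoxeterNumber b + k : ℕ) (rho b) (rt b i)) *
        (1 - character b (dualCoxeterNumber b + k : ℕ) (rho b) (-rt b i)))) Filter.atTop
      (nhds ((2 * Real.pi : ℂ) ^ 2 * ((pr b i (rho b) : ℚ) : ℂ) ^ 2)) := by
    intro i
    have h2 := (tendsto_mul_one_sub_exp (2 * Real.pi * Complex.I * (pr b i (rho b) : ℚ))
      (dualCoxeterNumber b)).mul
        (tendsto_mul_one_sub_exp (-(2 * Real.pi * Complex.I * (pr b i (rho b) : ℚ)))
          (dualCoxeterNumber b))
    have h3 : -(2 * Real.pi * Complex.I * ((pr b i (rho b) : ℚ) : ℂ)) *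
        -(-(2 * Real.pi * Complex.I * ((pr b i (rho b) : ℚ) : ℂ))) =
        (2 * Real.pi : ℂ) ^ 2 * ((pr b i (rho b) : ℚ) : ℂ) ^ 2 := by
      linear_combination (-(2 * Real.pi : ℂ) ^ 2 * ((pr b i (rho b) : ℚ) : ℂ) ^ 2) * Complex.I_sq
    rw [h3] at h2
    refine h2.congr fun k => ?_
    rw [AddChar.map_neg_eq_inv, character_rt, ← Complex.exp_neg, Int.cast_natCast, neg_div,
      mul_div_assoc]
    ring
  have h2 := tendsto_finsetProd (posRoots b) fun i _ => h1 i
  have h3 : ∏ i ∈ posRoots b, ((2 * Real.pi : ℂ) ^ 2 * ((pr b i (rho b) : ℚ) : ℂ) ^ 2) =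
      (2 * Real.pi : ℂ) ^ (2 * (posRoots b).card) *
      ((∏ i ∈ posRoots b, pr b i (rho b) : ℚ) : ℂ) ^ 2 := by
    rw [Finset.prod_mul_distrib, Finset.prod_const, ← pow_mul, Finset.prod_pow]
    push_cast; rfl
  rw [h3] at h2
  refine h2.congr fun k => ?_
  rw [Finset.prod_mul_distrib, Finset.prod_const, ← pow_mul, rootProd_eq]

theorem natCast_add_isEquivalent (g : ℕ) : Asymptotics.IsEquivalent Filter.atTop
    (fun k : ℕ => ((g + k : ℕ) : ℂ)) (fun k : ℕ => (k : ℂ)) := by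
  have h1 : Asymptotics.IsLittleO Filter.atTop (fun _ : ℕ => (g : ℂ)) (fun k : ℕ => (k : ℂ)) := by
    refine Asymptotics.isLittleO_const_left.2 (Or.inr ?_)
    have : (norm ∘ fun k : ℕ => (k : ℂ)) = fun k : ℕ => (k : ℝ) := by
      funext k; simp
    rw [this]
    exact tendsto_natCast_atTop_atTop
  have h2 := (Asymptotics.IsEquivalent.refl (u := fun k : ℕ => (k : ℂ))).add_isLittleO h1
  refine h2.congr_left (Filter.Eventually.of_forall fun k => ?_)
  simp [add_comm]

theorem globalDim_isEquivalent : Asymptotics.IsEquivalent Filter.atTop (globalDim b)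
    (fun k : ℕ => 1 / (formDet b * ((2 * Real.pi : ℂ) ^ (2 * (posRoots b).card) *
      ((∏ i ∈ posRoots b, pr b i (rho b) : ℚ) : ℂ) ^ 2)) *
        (k : ℂ) ^ (Fintype.card b.support + 2 * (posRoots b).card)) := by
  set C := (2 * Real.pi : ℂ) ^ (2 * (posRoots b).card) *
      ((∏ i ∈ posRoots b, pr b i (rho b) : ℚ) : ℂ) ^ 2 with hC
  have hC0 : C ≠ 0 := by
    refine mul_ne_zero (pow_ne_zero _ (by simp [Real.pi_ne_zero])) (pow_ne_zero _ ?_)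
    have : (∏ i ∈ posRoots b, pr b i (rho b)) ≠ 0 := Finset.prod_ne_zero_iff.2 fun i hi =>
      (pr_pos b ((mem_posRoots b).1 hi) fun _ => one_pos).ne'
    exact_mod_cast this
  have h1 := (Asymptotics.isEquivalent_const_iff_tendsto hC0).2 (rootProd_rho_tendsto b)
  have h2 := (natCast_add_isEquivalent (dualCoxeterNumber b)).pow
    (Fintype.card b.support + 2 * (posRoots b).card)
  have h3 := (Asymptotics.IsEquivalent.refl (u := fun _ : ℕ => 1 / formDet b)
    (l := Filter.atTop)).mul (h2.div h1)
  obtain ⟨h₀, hh₀⟩ := exists_bound b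
  refine (h3.congr_left ?_).congr_right ?_
  · filter_upwards [Filter.eventually_ge_atTop h₀.toNat] with k hk
    obtain ⟨h4, h5⟩ := hh₀ (dualCoxeterNumber b + k : ℕ) (by push_cast; omega)
    have h6 : ((dualCoxeterNumber b + k : ℕ) : ℂ) ≠ 0 := by
      have : dualCoxeterNumber b + k ≠ 0 := by rw [dualCoxeterNumber]; omega
      exact_mod_cast this
    rw [globalDim_eq b h4 (by exact_mod_cast h5)]
    simp only [Pi.mul_apply, Pi.div_apply, Pi.pow_apply]
    rw [pow_add, mul_comm (_ ^ (2 * (posRoots b).card)) (rootProd _ _ _),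
      mul_div_mul_right _ _ (pow_ne_zero _ h6), one_div_mul_eq_div, div_right_comm]
  · refine Filter.Eventually.of_forall fun k => ?_
    simp only [Pi.mul_apply, Pi.div_apply, Pi.pow_apply]
    rw [Function.const_apply, one_div_mul_eq_div, div_div, mul_comm C, one_div_mul_eq_div]

/-! ### Models of the positive roots -/

theorem ratio_mul_pairingIn (i j : ι) :
    (ratio b i : ℤ) * P.pairingIn ℤ i j = ratio b j * P.pairingIn ℤ j i := by
  have h1 := pairingIn_mul_len b i j
  have h2 := ratio_mul_len b i
  have h3 := ratio_mul_len b j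
  have h4 := len_pos b (highestRoot b)
  refine mul_right_cancel₀ h4.ne' ?_
  nth_rw 1 [← h3]
  rw [← h2]
  linear_combination (ratio b i : ℤ) * ratio b j * h1

theorem exists_simple_ratio_eq {i : ι} (hi : b.IsPos i) : ∃ j : b.support, ratio b j = ratio b i :=
  RootPairing.Base.IsPos.induction_on_reflect hi
    (p := fun i => ∃ j : b.support, ratio b j = ratio b i) (fun j hj => ⟨⟨j, hj⟩, rfl⟩)
    fun i j h _ => by rwa [ratio_reflectionPerm]

/-- The squared length ratios are determined by the Cartan matrix. -/
theorem ratio_eq_of_cartanMatrix {d : b.support → ℕ} (hd : ∀ j, 0 < d j) (hd1 : ∃ j, d j = 1)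
    (hdA : ∀ i j, (d i : ℤ) * b.cartanMatrix i j = d j * b.cartanMatrix j i) (j : b.support) :
    ratio b j = d j := by
  obtain ⟨k, hk⟩ := hd1
  obtain ⟨l, hl⟩ := exists_simple_ratio_eq b (isPos_highestRoot b)
  rw [ratio_highestRoot] at hl
  -- On a connected diagram a symmetrizer is unique up to a scalar. The scalar is 1 because both
  -- families consist of positive integers and take the value 1.
  have key : ∀ j : b.support, ratio b j = ratio b k * d j := by
    intro j
    refine RootPairing.Base.induction_on_cartanMatrix b (fun j => ratio b j = ratio b k * d j)
      (i := k) (by rw [hk, mul_one]) fun i j hi hji => ?_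
    have h1 := ratio_mul_pairingIn b j i
    have h2 := hdA j i
    have h3 : b.cartanMatrix j i = P.pairingIn ℤ j i := rfl
    have h4 : b.cartanMatrix i j = P.pairingIn ℤ i j := rfl
    rw [h3] at hji
    rw [h3, h4] at h2
    have h5 : (ratio b j : ℤ) = ratio b k * d j := by
      have h6 : (d i : ℤ) ≠ 0 := by exact_mod_cast (hd i).ne'
      refine mul_right_cancel₀ hji ?_
      rw [hi] at h1
      push_cast at h1
      linear_combination h1 - (ratio b k : ℤ) * h2
    exact_mod_cast h5
  have h1 := key l
  rw [hl] at h1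
  have h2 : ratio b k = 1 := Nat.eq_one_of_mul_eq_one_right h1.symm
  rw [key, h2, one_mul]

/-- A description of the positive roots in an additive group `V`: the simple roots are `a j`, the
simple coroots are `f j`, and the positive roots are the `v t` for `t ∈ T`. The functions `ht` and
`pr` are the pairings with the dual and with the usual Weyl vector. -/
structure RootModel (V τ : Type*) [AddCommGroup V] where
  T : Finset τ
  v : τ → V
  a : b.support → V
  f : b.support → V →+ ℤ
  ht : V →+ ℚ
  pr : V →+ ℚ
  d : b.support → ℕ
  top : τ
  f_a : ∀ i j, f j (a i) = b.cartanMatrix i j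
  ht_a : ∀ j, ht (a j) = 1
  pr_a : ∀ j, pr (a j) = 1 / d j
  d_pos : ∀ j, 0 < d j
  d_eq_one : ∃ j, d j = 1
  d_mul : ∀ i j, (d i : ℤ) * b.cartanMatrix i j = d j * b.cartanMatrix j i
  simple_mem : ∀ j, ∃ t ∈ T, v t = a j
  reflection_mem : ∀ t ∈ T, ∀ j, v t = a j ∨ ∃ t' ∈ T, v t' = v t - f j (v t) • a j
  ht_pos : ∀ t ∈ T, 0 < ht (v t)
  exists_f_pos : ∀ t ∈ T, ∃ j, 0 < f j (v t)
  injOn : Set.InjOn v T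
  top_mem : top ∈ T
  ht_le : ∀ t ∈ T, ht (v t) ≤ ht (v top)

namespace RootModel

variable {b} {V τ : Type*} [AddCommGroup V] (m : RootModel b V τ)

/-- The image of a root in the model. -/
def root (i : ι) : V := ∑ j, coef b i j • m.a j

theorem root_simple (j : b.support) : m.root j = m.a j := by
  classical
  rw [root, coef_simple]
  simp only [Pi.single_apply, ite_smul, one_smul, zero_smul]
  rw [Finset.sum_ite_eq' Finset.univ j, if_pos (Finset.mem_univ j)]

theorem f_root (i : ι) (k : b.support) : m.f k (m.root i) = P.pairingIn ℤ i k := by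
  rw [root, map_sum, pairingIn_eq_sum b]
  refine Finset.sum_congr rfl fun j _ => ?_
  rw [map_zsmul, m.f_a, smul_eq_mul]; rfl

theorem ht_root (i : ι) : m.ht (m.root i) = b.height i := by
  rw [root, map_sum, height_eq_sum_coef]
  push_cast
  refine Finset.sum_congr rfl fun j _ => ?_
  rw [map_zsmul, m.ht_a]; simp

theorem ratio_eq (j : b.support) : ratio b j = m.d j :=
  ratio_eq_of_cartanMatrix b m.d_pos m.d_eq_one m.d_mul j

theorem pr_root (i : ι) : m.pr (m.root i) = LieLevel.pr b i (rho b) := by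
  rw [root, map_sum, pr_eq_sum]
  refine Finset.sum_congr rfl fun j _ => ?_
  rw [map_zsmul, m.pr_a, m.ratio_eq]; simp [rho]

theorem root_injective : Function.Injective m.root := fun i i' h => by
  refine rt_injective b (funext fun k => ?_)
  rw [rt, rt, ← m.f_root, h, m.f_root]

theorem root_reflectionPerm (i : ι) (j : b.support) :
    m.root (P.reflectionPerm j i) = m.root i - m.f j (m.root i) • m.a j := by
  have h : coef b (P.reflectionPerm j i) = coef b i - P.pairingIn ℤ i j • coef b j := by
    have := coef_add_zsmul b (i := i) (j := j) (k := P.reflectionPerm j i)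
      (n := -P.pairingIn ℤ i j) (root_reflectionPerm_eq (P := P) j i)
    rw [this]; module
  rw [m.f_root, ← m.root_simple, root, h, root, root]
  simp only [Pi.sub_apply, Pi.smul_apply, sub_smul, Finset.sum_sub_distrib, smul_assoc,
    Finset.smul_sum]

/-- Positive roots are reached from simple ones by simple reflections, and the model together with
its negatives is closed under these. Positivity of the height selects the sign. -/
theorem exists_of_isPos {i : ι} (hi : b.IsPos i) : ∃ t ∈ m.T, m.v t = m.root i := by
  have h1 : ∃ t ∈ m.T, m.v t = m.root i ∨ m.v t = -m.root i := by
    refine RootPairing.Base.IsPos.induction_on_reflect hi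
      (p := fun i => ∃ t ∈ m.T, m.v t = m.root i ∨ m.v t = -m.root i) (fun j hj => ?_)
      fun i j ⟨t, ht, h⟩ hj => ?_
    · obtain ⟨t, ht, h⟩ := m.simple_mem ⟨j, hj⟩
      exact ⟨t, ht, Or.inl (h.trans (m.root_simple ⟨j, hj⟩).symm)⟩
    · have h2 := m.root_reflectionPerm i ⟨j, hj⟩
      have h3 : m.f ⟨j, hj⟩ (m.a ⟨j, hj⟩) = 2 := by
        rw [m.f_a]; exact b.cartanMatrix_apply_same _
      rcases m.reflection_mem t ht ⟨j, hj⟩ with h4 | ⟨t', ht', h4⟩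
      · refine ⟨t, ht, ?_⟩
        rcases h with h | h
        · right; rw [h2, ← h, h4, h3]; module
        · left
          have h5 : m.root i = -m.a ⟨j, hj⟩ := by rw [← h4, h, neg_neg]
          rw [h2, h4, h5, map_neg, h3]; module
      · refine ⟨t', ht', ?_⟩
        rcases h with h | h
        · left; rw [h2, h4, h]
        · right; rw [h2, h4, h, map_neg]; module
  obtain ⟨t, ht, h | h⟩ := h1
  · exact ⟨t, ht, h⟩
  · have h2 := m.ht_pos t ht
    rw [h, map_neg, m.ht_root] at h2
    rw [RootPairing.Base.isPos_iff] at hi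
    have : (0 : ℚ) < b.height i := by exact_mod_cast hi
    linarith

/-- Descent on the height: reflecting an element in a simple root with which it pairs positively
lowers the height and stays in the model, unless the element is that simple root. -/
theorem exists_isPos {t : τ} (ht : t ∈ m.T) : ∃ i, b.IsPos i ∧ m.root i = m.v t := by
  suffices h : ∃ i, m.root i = m.v t by
    obtain ⟨i, hi⟩ := h
    refine ⟨i, ?_, hi⟩
    have h1 := m.ht_pos t ht
    rw [← hi, m.ht_root] at h1
    rw [RootPairing.Base.isPos_iff]
    exact_mod_cast h1
  classical
  by_contra hne
  obtain ⟨s, hs, hmin⟩ := (m.T.filter fun t => ¬ ∃ i, m.root i = m.v t).exists_min_image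
    (fun t => m.ht (m.v t)) ⟨t, Finset.mem_filter.2 ⟨ht, hne⟩⟩
  obtain ⟨hsT, hs⟩ := Finset.mem_filter.1 hs
  obtain ⟨j, hj⟩ := m.exists_f_pos s hsT
  rcases m.reflection_mem s hsT j with h1 | ⟨s', hs', h1⟩
  · exact hs ⟨j, (m.root_simple j).trans h1.symm⟩
  · have h2 : m.f j (m.a j) = 2 := by rw [m.f_a]; exact b.cartanMatrix_apply_same _
    by_cases h3 : ∃ i, m.root i = m.v s'
    · obtain ⟨i, hi⟩ := h3
      refine hs ⟨P.reflectionPerm j i, ?_⟩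
      rw [m.root_reflectionPerm, hi, h1, map_sub, map_zsmul, h2, smul_eq_mul]
      module
    · have h4 := hmin s' (Finset.mem_filter.2 ⟨hs', h3⟩)
      rw [h1, map_sub, map_zsmul, m.ht_a] at h4
      have h5 : (0 : ℚ) < m.f j (m.v s) := by exact_mod_cast hj
      simp at h4
      omega

theorem prod_posRoots {G : Type*} [CommMonoid G] (g : V → G) :
    ∏ i ∈ posRoots b, g (m.root i) = ∏ t ∈ m.T, g (m.v t) := by
  classical
  rw [← Finset.prod_image (f := g) (g := m.root) m.root_injective.injOn,
    ← Finset.prod_image (f := g) (g := m.v) m.injOn]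
  congr 1
  ext x
  simp only [Finset.mem_image, mem_posRoots]
  constructor
  · rintro ⟨i, hi, rfl⟩; exact m.exists_of_isPos hi
  · rintro ⟨t, ht, rfl⟩; exact m.exists_isPos ht

theorem prod_pr : ∏ i ∈ posRoots b, LieLevel.pr b i (rho b) = ∏ t ∈ m.T, m.pr (m.v t) := by
  rw [← m.prod_posRoots]
  exact Finset.prod_congr rfl fun i _ => (m.pr_root i).symm

theorem card_posRoots : (posRoots b).card = m.T.card := by
  -- A product with all factors equal to the generator of `Multiplicative ℕ` counts its factors.
  have h := m.prod_posRoots fun _ => Multiplicative.ofAdd 1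
  simp only [Finset.prod_const] at h
  have h2 := congrArg Multiplicative.toAdd h
  simpa using h2

theorem coxeterNumber_eq : (coxeterNumber b : ℚ) = m.ht (m.v m.top) + 1 := by
  obtain ⟨t, ht, h1⟩ := m.exists_of_isPos (isPos_highestRoot b)
  obtain ⟨i, hi, h2⟩ := m.exists_isPos m.top_mem
  have h3 := m.ht_le t ht
  have h4 : (b.height i : ℚ) ≤ b.height (highestRoot b) := by
    exact_mod_cast height_le_highestRoot b i
  rw [← m.ht_root, ← m.ht_root, ← h1, h2] at h4
  have h5 := isPos_highestRoot b
  rw [RootPairing.Base.isPos_iff] at h5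
  have h6 : (((b.height (highestRoot b)).toNat : ℤ) : ℚ) = b.height (highestRoot b) := by
    rw [Int.toNat_of_nonneg h5.le]
  rw [coxeterNumber, Nat.cast_add, Nat.cast_one, ← Int.cast_natCast, h6, ← m.ht_root, ← h1]
  linarith

end RootModel

/-! ### Coordinates for the classical types -/

/-- The linear function on integer sequences with the first `n` weights `w`. -/
def weighted (n : ℕ) (w : ℕ → ℚ) : (ℕ → ℤ) →+ ℚ where
  toFun x := ∑ k ∈ Finset.range n, w k * x k
  map_zero' := by simp
  map_add' x y := by simp [mul_add, Finset.sum_add_distrib]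

theorem weighted_single {n k : ℕ} (w : ℕ → ℚ) (hk : k < n) :
    weighted n w (Pi.single k 1) = w k := by
  change ∑ l ∈ Finset.range n, w l * ((Pi.single k 1 : ℕ → ℤ) l : ℚ) = w k
  rw [Finset.sum_eq_single k]
  · simp
  · intro l _ hl; simp [hl]
  · intro h; exact absurd (Finset.mem_range.2 hk) h

/-- The coordinate vectors. -/
def unit (k : ℕ) : ℕ → ℤ := Pi.single k 1

theorem unit_apply (k l : ℕ) : unit k l = if l = k then 1 else 0 := by
  rw [unit, Pi.single_apply]

theorem weighted_unit {n k : ℕ} (w : ℕ → ℚ) (hk : k < n) : weighted n w (unit k) = w k :=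
  weighted_single w hk

/-- The function `x ↦ x (n + 1) - x n`. -/
def diffHom (n : ℕ) : (ℕ → ℤ) →+ ℤ :=
  Pi.evalAddMonoidHom (fun _ => ℤ) (n + 1) - Pi.evalAddMonoidHom (fun _ => ℤ) n

theorem diffHom_apply (n : ℕ) (x : ℕ → ℤ) : diffHom n x = x (n + 1) - x n := rfl

theorem swap_unit (n k : ℕ) : unit k - diffHom n (unit k) • (unit (n + 1) - unit n) =
    unit (Equiv.swap n (n + 1) k) := by
  rw [diffHom_apply, Equiv.swap_apply_def]
  funext l
  simp only [Pi.sub_apply, Pi.smul_apply, smul_eq_mul, unit_apply]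
  split_ifs <;> omega

/-- An adjacent transposition reverses the order of one pair only. This is why a simple reflection
makes no other positive root negative. -/
theorem swap_lt_swap {n i j : ℕ} (h : j < i) :
    Equiv.swap n (n + 1) j < Equiv.swap n (n + 1) i ∨ j = n ∧ i = n + 1 := by
  simp only [Equiv.swap_apply_def]
  split_ifs <;> omega

theorem swap_lt {n i r : ℕ} (hn : n + 1 < r) (h : i < r) : Equiv.swap n (n + 1) i < r := by
  simp only [Equiv.swap_apply_def]
  split_ifs <;> omega

theorem reflection_add {V : Type*} [AddCommGroup V] (f : V →+ ℤ) (a x y : V) :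
    x + y - f (x + y) • a = (x - f x • a) + (y - f y • a) := by
  rw [map_add]; module

theorem reflection_sub {V : Type*} [AddCommGroup V] (f : V →+ ℤ) (a x y : V) :
    x - y - f (x - y) • a = (x - f x • a) - (y - f y • a) := by
  rw [map_sub]; module

theorem reflection_zsmul {V : Type*} [AddCommGroup V] (f : V →+ ℤ) (a x : V) (c : ℤ) :
    c • x - f (c • x) • a = c • (x - f x • a) := by
  rw [map_zsmul]; module

theorem unit_sub_unit_injective {i j k l : ℕ} (h1 : j < i) (h2 : l < k)
    (h : unit i - unit j = unit k - unit l) : i = k ∧ j = l := by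
  have h3 := congrFun h i
  have h4 := congrFun h j
  simp only [Pi.sub_apply, unit_apply] at h3 h4
  split_ifs at h3 h4 <;> omega

/-- Pairs of natural numbers in decreasing order. -/
def pairs (r : ℕ) : Finset (Σ _ : ℕ, ℕ) := (Finset.range r).sigma fun i => Finset.range i

theorem mem_pairs {r : ℕ} {p : Σ _ : ℕ, ℕ} : p ∈ pairs r ↔ p.1 < r ∧ p.2 < p.1 := by
  simp [pairs]

theorem two_mul_card_pairs (r : ℕ) : 2 * (pairs r).card = r * (r - 1) := by
  rw [pairs, Finset.card_sigma]
  simp only [Finset.card_range]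
  rw [mul_comm, Finset.sum_range_id_mul_two]

theorem prod_pairs_succ (r : ℕ) (g : (Σ _ : ℕ, ℕ) → ℚ) : ∏ p ∈ pairs (r + 1), g p =
    (∏ p ∈ pairs r, g p) * ∏ j ∈ Finset.range r, g ⟨r, j⟩ := by
  rw [pairs, Finset.prod_sigma, Finset.prod_range_succ, pairs, Finset.prod_sigma]

theorem prod_range_sub (i : ℕ) : ∏ j ∈ Finset.range i, ((i : ℚ) - j) = i.factorial := by
  rw [← Finset.prod_range_reflect, ← Finset.prod_range_add_one_eq_factorial]
  push_cast
  refine Finset.prod_congr rfl fun j hj => ?_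
  have := Finset.mem_range.1 hj
  rw [Nat.sub_sub, Nat.cast_sub (by omega)]
  push_cast; ring

theorem prod_range_add (m n : ℕ) :
    (m.factorial : ℚ) * ∏ j ∈ Finset.range n, ((m : ℚ) + j + 1) = (m + n).factorial := by
  induction n with
  | zero => simp
  | succ n ih =>
    rw [Finset.prod_range_succ, ← mul_assoc, ih, ← add_assoc, Nat.factorial_succ]
    push_cast; ring

/-! ### Type `A` -/

theorem cartanMatrix_A_apply {r : ℕ} (i j : Fin r) :
    CartanMatrix.A r i j = diffHom j (unit (i + 1) - unit i) := by
  simp only [CartanMatrix.A, Matrix.of_apply, diffHom_apply, Pi.sub_apply, unit_apply, Fin.ext_iff]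
  split_ifs <;> omega

/-- The model of the positive roots in type `A`. -/
def rootModelA {r : ℕ} (hr : 1 ≤ r) (e : b.support ≃ Fin r)
    (he : ∀ i j, b.cartanMatrix i j = CartanMatrix.A r (e i) (e j)) :
    RootModel b (ℕ → ℤ) (Σ _ : ℕ, ℕ) where
  T := pairs (r + 1)
  v p := unit p.1 - unit p.2
  a j := unit (e j + 1) - unit (e j)
  f j := diffHom (e j)
  -- The roots only see differences of coordinates, so (0, 1, …, r) can serve as the Weyl vector.
  -- All roots have one length, so it is also its own dual.
  ht := weighted (r + 1) fun k => k
  pr := weighted (r + 1) fun k => k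
  d _ := 1
  top := ⟨r, 0⟩
  f_a i j := by rw [he, cartanMatrix_A_apply]
  ht_a j := by
    rw [map_sub, weighted_unit _ (by omega), weighted_unit _ (by omega)]; push_cast; ring
  pr_a j := by
    rw [map_sub, weighted_unit _ (by omega), weighted_unit _ (by omega)]; push_cast; ring
  d_pos _ := one_pos
  d_eq_one := ⟨e.symm ⟨0, hr⟩, rfl⟩
  d_mul i j := by
    rw [he, he, ← CartanMatrix.A_isSymm r |>.apply]
  simple_mem j := ⟨⟨e j + 1, e j⟩, mem_pairs.2 (by simp), rfl⟩
  reflection_mem := by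
    rintro ⟨i, k⟩ ht j
    obtain ⟨h1, h2⟩ := mem_pairs.1 ht
    simp only at h1 h2 ⊢
    rw [reflection_sub, swap_unit, swap_unit]
    rcases swap_lt_swap (n := (e j : ℕ)) h2 with h | ⟨rfl, rfl⟩
    · exact Or.inr ⟨⟨_, _⟩, mem_pairs.2 ⟨swap_lt (by omega) h1, h⟩, rfl⟩
    · exact Or.inl rfl
  ht_pos := by
    rintro ⟨i, k⟩ ht
    obtain ⟨h1, h2⟩ := mem_pairs.1 ht
    simp only at h1 h2 ⊢
    rw [map_sub, weighted_unit _ h1, weighted_unit _ (h2.trans h1), sub_pos]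
    exact_mod_cast h2
  exists_f_pos := by
    rintro ⟨i, k⟩ ht
    obtain ⟨h1, h2⟩ := mem_pairs.1 ht
    simp only at h1 h2 ⊢
    refine ⟨e.symm ⟨i - 1, by omega⟩, ?_⟩
    simp only [Equiv.apply_symm_apply, diffHom_apply, Pi.sub_apply, unit_apply]
    split_ifs <;> omega
  injOn := by
    rintro ⟨i, k⟩ ht ⟨i', k'⟩ ht' h
    obtain ⟨rfl, rfl⟩ := unit_sub_unit_injective (mem_pairs.1 ht).2 (mem_pairs.1 ht').2 h
    rfl
  top_mem := mem_pairs.2 ⟨Nat.lt_succ_self _, hr⟩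
  ht_le := by
    rintro ⟨i, k⟩ ht
    obtain ⟨h1, h2⟩ := mem_pairs.1 ht
    simp only at h1 h2 ⊢
    rw [map_sub, map_sub, weighted_unit _ h1, weighted_unit _ (h2.trans h1),
      weighted_unit _ (Nat.lt_succ_self _), weighted_unit _ (Nat.succ_pos _)]
    have h3 : (i : ℚ) ≤ r := by exact_mod_cast Nat.lt_succ_iff.1 h1
    have h4 : (0 : ℚ) ≤ k := by positivity
    push_cast; linarith

theorem prod_pairs_sub (r : ℕ) : ∏ p ∈ pairs (r + 1), ((p.1 : ℚ) - p.2) =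
    ((Multiset.range r).map fun i => ((i + 1).factorial : ℚ)).prod := by
  induction r with
  | zero => simp [pairs, Finset.prod_sigma]
  | succ r ih =>
    rw [prod_pairs_succ, ih, prod_range_sub, Multiset.range_succ, Multiset.map_cons,
      Multiset.prod_cons, mul_comm]

theorem typeA {r : ℕ} (hr : 1 ≤ r) (e : b.support ≃ Fin r)
    (he : ∀ i j, b.cartanMatrix i j = CartanMatrix.A r (e i) (e j)) :
    2 * (posRoots b).card = r * coxeterNumber b ∧
      ∏ i ∈ posRoots b, pr b i (rho b) = (SimpleLieType.A r hr).superfactorial := by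
  constructor
  · have h1 := (rootModelA b hr e he).coxeterNumber_eq
    have h2 : coxeterNumber b = r + 1 := by
      rw [rootModelA] at h1
      simp only at h1
      rw [map_sub, weighted_unit _ (Nat.lt_succ_self _), weighted_unit _ (Nat.succ_pos _)] at h1
      simp only [Nat.cast_zero, sub_zero] at h1
      exact_mod_cast h1
    rw [(rootModelA b hr e he).card_posRoots, h2]
    change 2 * (pairs (r + 1)).card = _
    rw [two_mul_card_pairs, mul_comm]; rfl
  · rw [(rootModelA b hr e he).prod_pr]
    simp only [SimpleLieType.superfactorial, SimpleLieType.exponents, Multiset.map_map,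
      Function.comp_def]
    rw [← prod_pairs_sub]
    refine Finset.prod_congr rfl fun p hp => ?_
    obtain ⟨h1, h2⟩ := mem_pairs.1 hp
    change weighted (r + 1) _ (unit p.1 - unit p.2) = _
    rw [map_sub, weighted_unit _ h1, weighted_unit _ (h2.trans h1)]

/-! ### Types `B` and `C` -/

/-- The simple roots in types `B` (`c = 1`) and `C` (`c = 2`), the node `0` being the special one. -/
def nodeBC (c : ℕ) : ℕ → ℕ → ℤ
  | 0 => (c : ℤ) • unit 0
  | n + 1 => unit (n + 1) - unit n

/-- The simple coroots in types `B` (`c = 2`) and `C` (`c = 1`). -/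
def conodeBC (c : ℕ) : ℕ → (ℕ → ℤ) →+ ℤ
  | 0 => (c : ℤ) • Pi.evalAddMonoidHom (fun _ => ℤ) 0
  | n + 1 => diffHom n

theorem conodeBC_zero_apply (c : ℕ) (x : ℕ → ℤ) : conodeBC c 0 x = c * x 0 := by
  simp [conodeBC]

theorem conodeBC_succ (c n : ℕ) : conodeBC c (n + 1) = diffHom n := rfl

/-- The relation c c' = 2 treats two types at once: (c, c') is (1, 2) in type B and (2, 1) in type
C. -/
theorem pos_of_mul_eq_two {c c' : ℕ} (hc : c * c' = 2) : 0 < c ∧ 0 < c' :=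
  ⟨Nat.pos_of_ne_zero (by rintro rfl; omega), Nat.pos_of_ne_zero (by rintro rfl; omega)⟩

/-- The numbering is reversed: the special node, which comes last in `CartanMatrix.B`, becomes node
0, so that the formulas for the simple roots do not involve the rank. -/
theorem cartanMatrix_B_apply {r : ℕ} (i j : Fin r) :
    CartanMatrix.B r i j = conodeBC 2 (r - 1 - j) (nodeBC 1 (r - 1 - i)) := by
  have hi := i.2
  have hj := j.2
  simp only [CartanMatrix.B, Matrix.of_apply, Fin.ext_iff]
  rcases hp : r - 1 - (i : ℕ) with _ | p <;> rcases hq : r - 1 - (j : ℕ) with _ | q <;>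
    simp only [nodeBC, conodeBC_zero_apply, conodeBC_succ, diffHom_apply, Pi.sub_apply, Pi.smul_apply,
      unit_apply, smul_eq_mul] <;> push_cast <;> split_ifs <;> omega

theorem cartanMatrix_C_apply {r : ℕ} (i j : Fin r) :
    CartanMatrix.C r i j = conodeBC 1 (r - 1 - j) (nodeBC 2 (r - 1 - i)) := by
  have hi := i.2
  have hj := j.2
  simp only [CartanMatrix.C, Matrix.of_apply, Fin.ext_iff]
  rcases hp : r - 1 - (i : ℕ) with _ | p <;> rcases hq : r - 1 - (j : ℕ) with _ | q <;>
    simp only [nodeBC, conodeBC_zero_apply, conodeBC_succ, diffHom_apply, Pi.sub_apply, Pi.smul_apply,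
      unit_apply, smul_eq_mul] <;> push_cast <;> split_ifs <;> omega

theorem unit_add_unit_injective {i j k l : ℕ} (h1 : j < i) (h2 : l < k)
    (h : unit i + unit j = unit k + unit l) : i = k ∧ j = l := by
  have h3 := congrFun h i
  have h4 := congrFun h j
  simp only [Pi.add_apply, unit_apply] at h3 h4
  split_ifs at h3 h4 <;> omega

theorem unit_sub_unit_ne_add {i j k l : ℕ} (h1 : j < i) : unit i - unit j ≠ unit k + unit l := by
  intro h
  have h3 := congrFun h j
  simp only [Pi.sub_apply, Pi.add_apply, unit_apply] at h3
  split_ifs at h3 <;> omega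

/-- Labels of the positive roots in types `B`, `C` and `D`. -/
abbrev Label := (Σ _ : ℕ, ℕ) ⊕ (Σ _ : ℕ, ℕ) ⊕ ℕ

/-- The positive root with a given label; the roots of the third family are multiples by `c`. -/
def labelRoot (c : ℕ) : Label → ℕ → ℤ
  | .inl p => unit p.1 - unit p.2
  | .inr (.inl p) => unit p.1 + unit p.2
  | .inr (.inr i) => (c : ℤ) • unit i

/-- The labels of the positive roots in types `B` and `C`. -/
def labelsBC (r : ℕ) : Finset Label := (pairs r).disjSum ((pairs r).disjSum (Finset.range r))

theorem exists_labelsBC {r c : ℕ} {x : ℕ → ℤ} : (∃ t ∈ labelsBC r, labelRoot c t = x) ↔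
    (∃ i j, j < i ∧ i < r ∧ x = unit i - unit j) ∨ (∃ i j, j < i ∧ i < r ∧ x = unit i + unit j) ∨
      ∃ i < r, x = (c : ℤ) • unit i := by
  constructor
  · rintro ⟨p | p | i, h, rfl⟩
    · simp only [labelsBC, Finset.inl_mem_disjSum, mem_pairs] at h
      exact Or.inl ⟨_, _, h.2, h.1, rfl⟩
    · simp only [labelsBC, Finset.inr_mem_disjSum, Finset.inl_mem_disjSum, mem_pairs] at h
      exact Or.inr (Or.inl ⟨_, _, h.2, h.1, rfl⟩)
    · simp only [labelsBC, Finset.inr_mem_disjSum, Finset.mem_range] at h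
      exact Or.inr (Or.inr ⟨_, h, rfl⟩)
  · rintro (⟨i, j, h1, h2, rfl⟩ | ⟨i, j, h1, h2, rfl⟩ | ⟨i, h, rfl⟩)
    · exact ⟨.inl ⟨i, j⟩, by simp [labelsBC, mem_pairs, h1, h2], rfl⟩
    · exact ⟨.inr (.inl ⟨i, j⟩), by simp [labelsBC, mem_pairs, h1, h2], rfl⟩
    · exact ⟨.inr (.inr i), by simp [labelsBC, h], rfl⟩

theorem labelRoot_mem {r c : ℕ} {t : Label} (ht : t ∈ labelsBC r) :
    (∃ i j, j < i ∧ i < r ∧ labelRoot c t = unit i - unit j) ∨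
      (∃ i j, j < i ∧ i < r ∧ labelRoot c t = unit i + unit j) ∨
      ∃ i < r, labelRoot c t = (c : ℤ) • unit i :=
  exists_labelsBC.1 ⟨t, ht, rfl⟩

theorem labelRoot_injOn {r c : ℕ} (hc : 0 < c) :
    Set.InjOn (labelRoot c) (labelsBC r : Set Label) := by
  have hmix : ∀ {i j k : ℕ}, j < i → unit i - unit j ≠ (c : ℤ) • unit k := by
    intro i j k h1 h
    have h3 := congrFun h j
    simp only [Pi.sub_apply, Pi.smul_apply, smul_eq_mul, unit_apply] at h3
    split_ifs at h3 <;> omega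
  have hmix' : ∀ {i j k : ℕ}, j < i → unit i + unit j ≠ (c : ℤ) • unit k := by
    intro i j k h1 h
    have h2 := congrFun h i
    have h3 := congrFun h j
    simp only [Pi.add_apply, Pi.smul_apply, smul_eq_mul, unit_apply] at h2 h3
    split_ifs at h2 h3 <;> omega
  rintro (⟨i, j⟩ | ⟨i, j⟩ | i) ht (⟨k, l⟩ | ⟨k, l⟩ | k) ht' h <;>
    simp only [labelsBC, Finset.mem_coe, Finset.inl_mem_disjSum, Finset.inr_mem_disjSum,
      mem_pairs, Finset.mem_range] at ht ht' <;> simp only [labelRoot] at h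
  · obtain ⟨rfl, rfl⟩ := unit_sub_unit_injective ht.2 ht'.2 h; rfl
  · exact absurd h (unit_sub_unit_ne_add ht.2)
  · exact absurd h (hmix ht.2)
  · exact absurd h.symm (unit_sub_unit_ne_add ht'.2)
  · obtain ⟨rfl, rfl⟩ := unit_add_unit_injective ht.2 ht'.2 h; rfl
  · exact absurd h (hmix' ht.2)
  · exact absurd h.symm (hmix ht'.2)
  · exact absurd h.symm (hmix' ht'.2)
  · have h3 := congrFun h i
    by_cases h4 : i = k
    · rw [h4]
    · simp [unit_apply, h4] at h3
      omega

theorem swap_mem_labelsBC {r c n : ℕ} (hn : n + 1 < r) {x : ℕ → ℤ}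
    (hx : ∃ t ∈ labelsBC r, labelRoot c t = x) : x = unit (n + 1) - unit n ∨
      ∃ t ∈ labelsBC r, labelRoot c t = x - diffHom n x • (unit (n + 1) - unit n) := by
  rcases exists_labelsBC.1 hx with ⟨i, j, h1, h2, rfl⟩ | ⟨i, j, h1, h2, rfl⟩ | ⟨i, h, rfl⟩
  · rw [reflection_sub, swap_unit, swap_unit]
    rcases swap_lt_swap (n := n) h1 with h | ⟨rfl, rfl⟩
    · exact Or.inr (exists_labelsBC.2 (Or.inl ⟨_, _, h, swap_lt hn h2, rfl⟩))
    · exact Or.inl rfl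
  · rw [reflection_add, swap_unit, swap_unit]
    refine Or.inr (exists_labelsBC.2 (Or.inr (Or.inl ?_)))
    rcases lt_or_gt_of_ne ((Equiv.swap n (n + 1)).injective.ne h1.ne) with h | h
    · exact ⟨_, _, h, swap_lt hn h2, rfl⟩
    · exact ⟨_, _, h, swap_lt hn (h1.trans h2), add_comm _ _⟩
  · rw [reflection_zsmul, swap_unit]
    exact Or.inr (exists_labelsBC.2 (Or.inr (Or.inr ⟨_, swap_lt hn h, rfl⟩)))

theorem conodeBC_zero_reflection {c c' : ℕ} (hc : c * c' = 2) (k : ℕ) :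
    unit k - conodeBC c' 0 (unit k) • nodeBC c 0 = if k = 0 then -unit 0 else unit k := by
  have h : (c : ℤ) * c' = 2 := by exact_mod_cast hc
  rw [conodeBC_zero_apply, nodeBC]
  funext l
  simp only [Pi.sub_apply, Pi.smul_apply, smul_eq_mul, unit_apply]
  rcases eq_or_ne k 0 with rfl | hk
  · simp only [if_true, Pi.neg_apply, unit_apply]
    split_ifs <;> linarith
  · simp [hk, hk.symm, unit_apply]

theorem reflection_mem_labelsBC {r c c' : ℕ} (hc : c * c' = 2) {x : ℕ → ℤ}
    (hx : ∃ t ∈ labelsBC r, labelRoot c t = x) : x = nodeBC c 0 ∨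
      ∃ t ∈ labelsBC r, labelRoot c t = x - conodeBC c' 0 x • nodeBC c 0 := by
  rcases exists_labelsBC.1 hx with ⟨i, j, h1, h2, rfl⟩ | ⟨i, j, h1, h2, rfl⟩ | ⟨i, h, rfl⟩
  · rw [reflection_sub, conodeBC_zero_reflection hc, conodeBC_zero_reflection hc,
      if_neg (by omega : i ≠ 0)]
    refine Or.inr (exists_labelsBC.2 ?_)
    split_ifs with hj
    · exact Or.inr (Or.inl ⟨i, 0, by omega, h2, sub_neg_eq_add _ _⟩)
    · exact Or.inl ⟨i, j, h1, h2, rfl⟩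
  · rw [reflection_add, conodeBC_zero_reflection hc, conodeBC_zero_reflection hc,
      if_neg (by omega : i ≠ 0)]
    refine Or.inr (exists_labelsBC.2 ?_)
    split_ifs with hj
    · exact Or.inl ⟨i, 0, by omega, h2, (sub_eq_add_neg _ _).symm⟩
    · exact Or.inr (Or.inl ⟨i, j, h1, h2, rfl⟩)
  · rcases eq_or_ne i 0 with rfl | hi
    · exact Or.inl rfl
    · rw [reflection_zsmul, conodeBC_zero_reflection hc, if_neg hi]
      exact Or.inr (exists_labelsBC.2 (Or.inr (Or.inr ⟨i, h, rfl⟩)))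

/-- The value of a linear function at a positive root. -/
def labelVal (c : ℕ) (w : ℕ → ℚ) : Label → ℚ
  | .inl p => w p.1 - w p.2
  | .inr (.inl p) => w p.1 + w p.2
  | .inr (.inr i) => c * w i

theorem map_labelRoot {r : ℕ} (c : ℕ) (w : ℕ → ℚ) {t : Label} (ht : t ∈ labelsBC r) :
    weighted r w (labelRoot c t) = labelVal c w t := by
  rcases t with ⟨i, j⟩ | ⟨i, j⟩ | i <;>
    simp only [labelsBC, Finset.inl_mem_disjSum, Finset.inr_mem_disjSum,
      mem_pairs, Finset.mem_range] at ht <;> simp only [labelRoot, labelVal]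
  · rw [map_sub, weighted_unit w ht.1, weighted_unit w (ht.2.trans ht.1)]
  · rw [map_add, weighted_unit w ht.1, weighted_unit w (ht.2.trans ht.1)]
  · rw [map_zsmul, weighted_unit w ht]; simp

/-- The model of the positive roots in types `B` and `C`. -/
def rootModelBC {r c c' : ℕ} (hr : 2 ≤ r) (hc : c * c' = 2) (e : b.support ≃ Fin r)
    (he : ∀ i j, b.cartanMatrix i j = conodeBC c' (r - 1 - e j) (nodeBC c (r - 1 - e i))) :
    RootModel b (ℕ → ℤ) Label where
  T := labelsBC r
  v := labelRoot c
  a j := nodeBC c (r - 1 - e j)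
  f j := conodeBC c' (r - 1 - e j)
  -- The weights are solved from the simple roots. The height is 1 on each difference of
  -- neighbouring units and on c times unit 0. The second functional is 1/c on the differences and
  -- c/2 = 1/c' on the special root.
  ht := weighted r fun k => k + 1 / c
  pr := weighted r fun k => k / c + 1 / 2
  d j := if r - 1 - e j = 0 then c' else c
  top := if c = 1 then .inr (.inl ⟨r - 1, r - 2⟩) else .inr (.inr (r - 1))
  f_a i j := (he i j).symm
  ht_a j := by
    have hc0 : (c : ℚ) ≠ 0 := by exact_mod_cast (pos_of_mul_eq_two hc).1.ne'
    rcases hp : r - 1 - (e j : ℕ) with _ | p <;> simp only [nodeBC]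
    · rw [map_zsmul, weighted_unit _ (by omega)]; simp [hc0]
    · rw [map_sub, weighted_unit _ (by omega), weighted_unit _ (by omega)]; push_cast; ring
  pr_a j := by
    have hc' : (c : ℚ) * c' = 2 := by exact_mod_cast hc
    have hc0 : (c' : ℚ) ≠ 0 := by exact_mod_cast (pos_of_mul_eq_two hc).2.ne'
    rcases hp : r - 1 - (e j : ℕ) with _ | p <;> simp only [nodeBC]
    · rw [map_zsmul, weighted_unit _ (by omega)]
      simp only [if_true, zsmul_eq_mul, Nat.cast_zero, zero_div, zero_add, Int.cast_natCast]
      field_simp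
      exact hc'
    · rw [map_sub, weighted_unit _ (by omega), weighted_unit _ (by omega)]
      simp only [Nat.succ_ne_zero, if_false]; push_cast; ring
  d_pos j := by
    split_ifs
    · exact (pos_of_mul_eq_two hc).2
    · exact (pos_of_mul_eq_two hc).1
  d_eq_one := by
    have : c = 1 ∨ c' = 1 := by
      have h1 : c ≤ 2 := Nat.le_of_dvd two_pos ⟨c', hc.symm⟩
      interval_cases c <;> omega
    rcases this with h | h
    · refine ⟨e.symm ⟨0, by omega⟩, ?_⟩
      simp only [Equiv.apply_symm_apply]
      rw [if_neg (by omega), h]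
    · refine ⟨e.symm ⟨r - 1, by omega⟩, ?_⟩
      simp only [Equiv.apply_symm_apply]
      rw [if_pos (by omega), h]
  d_mul i j := by
    have h : (c : ℤ) * c' = 2 := by exact_mod_cast hc
    rw [he, he]
    rcases hp : r - 1 - (e i : ℕ) with _ | p <;> rcases hq : r - 1 - (e j : ℕ) with _ | q <;>
      simp only [nodeBC, conodeBC_zero_apply, conodeBC_succ, diffHom_apply, Pi.sub_apply,
        Pi.smul_apply, unit_apply, smul_eq_mul, if_true, Nat.succ_ne_zero, if_false] <;>
      split_ifs <;> first | contradiction | omega | ring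
  simple_mem j := by
    refine exists_labelsBC.2 ?_
    rcases hp : r - 1 - (e j : ℕ) with _ | p
    · exact Or.inr (Or.inr ⟨0, by omega, rfl⟩)
    · exact Or.inl ⟨p + 1, p, by omega, by omega, rfl⟩
  reflection_mem t ht j := by
    rcases hp : r - 1 - (e j : ℕ) with _ | p
    · exact reflection_mem_labelsBC hc ⟨t, ht, rfl⟩
    · exact swap_mem_labelsBC (by omega) ⟨t, ht, rfl⟩
  ht_pos t ht := by
    have hc0 : (0 : ℚ) < c := Nat.cast_pos.2 (pos_of_mul_eq_two hc).1
    rw [map_labelRoot c _ ht]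
    rcases t with ⟨i, j⟩ | ⟨i, j⟩ | i <;> simp only [labelVal]
    · simp only [labelsBC, Finset.inl_mem_disjSum, mem_pairs] at ht
      have : (j : ℚ) < i := by exact_mod_cast ht.2
      linarith
    · positivity
    · positivity
  exists_f_pos t ht := by
    have hsurj : ∀ n < r, ∃ j, r - 1 - (e j : ℕ) = n := fun n hn =>
      ⟨e.symm ⟨r - 1 - n, by omega⟩, by simp only [Equiv.apply_symm_apply]; omega⟩
    obtain ⟨hc0, hc1⟩ := pos_of_mul_eq_two hc
    rcases labelRoot_mem (c := c) ht with ⟨i, j, h1, h2, h⟩ | ⟨i, j, h1, h2, h⟩ | ⟨j, h2, h⟩ <;>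
      rw [h]
    · obtain ⟨k, hk⟩ := hsurj i h2
      refine ⟨k, ?_⟩
      rw [hk]
      rcases i with _ | i
      · omega
      · simp only [conodeBC_succ, diffHom_apply, Pi.sub_apply, unit_apply]
        split_ifs <;> omega
    · obtain ⟨k, hk⟩ := hsurj j (h1.trans h2)
      refine ⟨k, ?_⟩
      rw [hk]
      rcases j with _ | j
      · rw [conodeBC_zero_apply]
        simp only [Pi.add_apply, unit_apply]
        split_ifs <;> omega
      · simp only [conodeBC_succ, diffHom_apply, Pi.add_apply, unit_apply]
        split_ifs <;> omega
    · obtain ⟨k, hk⟩ := hsurj j h2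
      refine ⟨k, ?_⟩
      rw [hk]
      rcases j with _ | j
      · rw [conodeBC_zero_apply]
        simp only [Pi.smul_apply, unit_apply, smul_eq_mul, if_true]
        positivity
      · simp only [conodeBC_succ, diffHom_apply, Pi.smul_apply, unit_apply, smul_eq_mul]
        split_ifs <;> omega
  injOn := labelRoot_injOn (pos_of_mul_eq_two hc).1
  top_mem := by
    split_ifs
    · simp only [labelsBC, Finset.inr_mem_disjSum, Finset.inl_mem_disjSum, mem_pairs]; omega
    · simp only [labelsBC, Finset.inr_mem_disjSum, Finset.mem_range]; omega
  ht_le t ht := by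
    have hr1 : ((r - 1 : ℕ) : ℚ) = r - 1 := by rw [Nat.cast_sub (by omega)]; simp
    have hr2 : ((r - 2 : ℕ) : ℚ) = r - 2 := by rw [Nat.cast_sub (by omega)]; simp
    have htop : weighted r (fun k => (k : ℚ) + 1 / c)
        (labelRoot c (if c = 1 then .inr (.inl ⟨r - 1, r - 2⟩) else .inr (.inr (r - 1)))) =
        2 * r - 1 := by
      have h1 : c ≤ 2 := Nat.le_of_dvd two_pos ⟨c', hc.symm⟩
      split_ifs with h
      · rw [map_labelRoot c _ (by
          simp only [labelsBC, Finset.inr_mem_disjSum, Finset.inl_mem_disjSum, mem_pairs]; omega)]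
        simp only [labelVal, h, hr1, hr2]; push_cast; ring
      · have h2 : c = 2 := by interval_cases c <;> omega
        rw [map_labelRoot c _ (by
          simp only [labelsBC, Finset.inr_mem_disjSum, Finset.mem_range]; omega)]
        simp only [labelVal, h2, hr1]; push_cast; ring
    have hc1 : (1 : ℚ) ≤ c := Nat.one_le_cast.2 (pos_of_mul_eq_two hc).1
    have hc2 : (c : ℚ) ≤ 2 := by exact_mod_cast Nat.le_of_dvd two_pos ⟨c', hc.symm⟩
    have hc3 : 1 / (c : ℚ) ≤ 1 := by rw [div_le_one (by linarith)]; exact hc1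
    rw [htop, map_labelRoot c _ ht]
    rcases t with ⟨i, j⟩ | ⟨i, j⟩ | i <;> simp only [labelVal] <;>
      simp only [labelsBC, Finset.inl_mem_disjSum, Finset.inr_mem_disjSum,
        mem_pairs, Finset.mem_range] at ht
    · have h1 : (i : ℚ) + 1 ≤ r := by exact_mod_cast ht.1
      have h2 : (0 : ℚ) ≤ j := by positivity
      have h3 : (2 : ℚ) ≤ r := by exact_mod_cast hr
      linarith
    · have h1 : (i : ℚ) + 1 ≤ r := by exact_mod_cast ht.1
      have h2 : (j : ℚ) + 1 ≤ i := by exact_mod_cast ht.2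
      linarith
    · have h1 : (i : ℚ) + 1 ≤ r := by exact_mod_cast ht
      have h2 : (c : ℚ) * (i + 1 / c) = c * i + 1 := by field_simp
      have h3 : (0 : ℚ) ≤ i := by positivity
      rw [h2]
      nlinarith

theorem rootModelBC_ht_top {r c c' : ℕ} (hr : 2 ≤ r) (hc : c * c' = 2) (e : b.support ≃ Fin r)
    (he : ∀ i j, b.cartanMatrix i j = conodeBC c' (r - 1 - e j) (nodeBC c (r - 1 - e i))) :
    coxeterNumber b = 2 * r := by
  have hr1 : ((r - 1 : ℕ) : ℚ) = r - 1 := by rw [Nat.cast_sub (by omega)]; simp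
  have hr2 : ((r - 2 : ℕ) : ℚ) = r - 2 := by rw [Nat.cast_sub (by omega)]; simp
  have h1 : c ≤ 2 := Nat.le_of_dvd two_pos ⟨c', hc.symm⟩
  have h2 := (rootModelBC b hr hc e he).coxeterNumber_eq
  have h3 := map_labelRoot c (fun k => (k : ℚ) + 1 / c) (rootModelBC b hr hc e he).top_mem
  have h4 : (coxeterNumber b : ℚ) = 2 * r := by
    rw [h2]
    refine (congrArg (· + 1) h3).trans ?_
    simp only [rootModelBC]
    interval_cases c
    · omega
    · simp only [if_true, labelVal, hr1, hr2]; push_cast; ring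
    · simp only [OfNat.ofNat_ne_one, if_false, labelVal, hr1]; push_cast; ring
  exact_mod_cast h4

theorem two_mul_card_labelsBC (r : ℕ) : 2 * (labelsBC r).card = r * (2 * r) := by
  have := two_mul_card_pairs r
  rw [labelsBC, Finset.card_disjSum, Finset.card_disjSum, Finset.card_range]
  rcases r with _ | r
  · simp_all
  · rw [Nat.add_sub_cancel] at this; nlinarith

theorem rootModelBC_prod {r c c' : ℕ} (hr : 2 ≤ r) (hc : c * c' = 2) (e : b.support ≃ Fin r)
    (he : ∀ i j, b.cartanMatrix i j = conodeBC c' (r - 1 - e j) (nodeBC c (r - 1 - e i))) :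
    ∏ i ∈ posRoots b, pr b i (rho b) = (∏ p ∈ pairs r, (((p.1 : ℚ) - p.2) / c)) *
      ((∏ p ∈ pairs r, (((p.1 : ℚ) + p.2) / c + 1)) * ∏ i ∈ Finset.range r, ((i : ℚ) + c / 2)) := by
  have hc0 : (c : ℚ) ≠ 0 := by exact_mod_cast (pos_of_mul_eq_two hc).1.ne'
  rw [(rootModelBC b hr hc e he).prod_pr]
  change ∏ t ∈ labelsBC r, weighted r (fun k => (k : ℚ) / c + 1 / 2) (labelRoot c t) = _
  rw [Finset.prod_congr rfl fun t ht => map_labelRoot c _ ht, labelsBC, Finset.prod_disjSum,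
    Finset.prod_disjSum]
  simp only [labelVal]
  congr 1
  · exact Finset.prod_congr rfl fun p _ => by ring
  congr 1
  · exact Finset.prod_congr rfl fun p _ => by ring
  · exact Finset.prod_congr rfl fun p _ => by field_simp

/-- The roots whose largest index is r contribute r! · ((2r)!/r!) · (r + 1/2) = (2r+1)!/2. -/
theorem prod_typeB (r : ℕ) : (∏ p ∈ pairs r, (((p.1 : ℚ) - p.2) / (1 : ℕ))) *
      ((∏ p ∈ pairs r, (((p.1 : ℚ) + p.2) / (1 : ℕ) + 1)) *
        ∏ i ∈ Finset.range r, ((i : ℚ) + (1 : ℕ) / 2)) =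
    ((Multiset.range r).map fun i => ((2 * i + 1).factorial : ℚ)).prod / 2 ^ r := by
  simp only [Nat.cast_one, div_one]
  induction r with
  | zero => simp [pairs, Finset.prod_sigma]
  | succ r ih =>
    rw [prod_pairs_succ, prod_pairs_succ, Finset.prod_range_succ, Multiset.range_succ,
      Multiset.map_cons, Multiset.prod_cons, pow_succ, prod_range_sub]
    have h := prod_range_add r r
    have h1 : ((2 * r + 1).factorial : ℚ) = (2 * r + 1) * (r + r).factorial := by
      rw [Nat.factorial_succ, two_mul]; push_cast; ring
    rw [eq_div_iff (by positivity)] at ih ⊢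
    rw [h1, ← h]
    simp only
    linear_combination (2 * r + 1) * (r.factorial : ℚ) *
      (∏ j ∈ Finset.range r, ((r : ℚ) + j + 1)) * ih

/-- The roots whose largest index is r contribute (2r+1)!/2^(2r), and the exponents 2r add up to r(r
− 1). -/
theorem prod_typeC (r : ℕ) : (∏ p ∈ pairs r, (((p.1 : ℚ) - p.2) / (2 : ℕ))) *
      ((∏ p ∈ pairs r, (((p.1 : ℚ) + p.2) / (2 : ℕ) + 1)) *
        ∏ i ∈ Finset.range r, ((i : ℚ) + (2 : ℕ) / 2)) =
    ((Multiset.range r).map fun i => ((2 * i + 1).factorial : ℚ)).prod / 2 ^ (r * (r - 1)) := by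
  push_cast
  induction r with
  | zero => simp [pairs, Finset.prod_sigma]
  | succ r ih =>
    rw [prod_pairs_succ, prod_pairs_succ, Finset.prod_range_succ, Multiset.range_succ,
      Multiset.map_cons, Multiset.prod_cons]
    have h1 : ∏ j ∈ Finset.range r, (((r : ℚ) - j) / 2) = r.factorial / 2 ^ r := by
      rw [Finset.prod_div_distrib, prod_range_sub, Finset.prod_const, Finset.card_range]
    have h2 : (r + 1) * r.factorial * ∏ j ∈ Finset.range r, (((r : ℚ) + j) / 2 + 1) =
        (2 * r + 1).factorial / 2 ^ r := by
      have h3 := prod_range_add (r + 1) r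
      have h4 : ∏ j ∈ Finset.range r, (((r : ℚ) + j) / 2 + 1) =
          (∏ j ∈ Finset.range r, (((r + 1 : ℕ) : ℚ) + j + 1)) / 2 ^ r := by
        have h6 : ∏ j ∈ Finset.range r, (((r : ℚ) + j) / 2 + 1) =
            ∏ j ∈ Finset.range r, ((((r + 1 : ℕ) : ℚ) + j + 1) / 2) :=
          Finset.prod_congr rfl fun j _ => by push_cast; ring
        rw [h6, Finset.prod_div_distrib, Finset.prod_const, Finset.card_range]
      have h5 : r + 1 + r = 2 * r + 1 := by ring
      rw [h4, ← mul_div_assoc, ← h5, ← h3, Nat.factorial_succ]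
      push_cast; ring
    have h3 : (r + 1) * (r + 1 - 1) = r * (r - 1) + r + r := by
      rcases r with _ | r
      · rfl
      · simp only [Nat.add_sub_cancel]; ring
    rw [eq_div_iff (by positivity)] at h2 ih
    rw [h1, h3, pow_add, pow_add, eq_div_iff (by positivity)]
    have h5 : (2 : ℚ) ^ r ≠ 0 := by positivity
    have h6 : (2 / 2 : ℚ) = 1 := by norm_num
    rw [← h2, ← ih]
    field_simp

theorem typeB {r : ℕ} (hr : 2 ≤ r) (e : b.support ≃ Fin r)
    (he : ∀ i j, b.cartanMatrix i j = CartanMatrix.B r (e i) (e j)) :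
    2 * (posRoots b).card = r * coxeterNumber b ∧
      ∏ i ∈ posRoots b, pr b i (rho b) = (SimpleLieType.B r hr).superfactorial := by
  have he' : ∀ i j, b.cartanMatrix i j = conodeBC 2 (r - 1 - e j) (nodeBC 1 (r - 1 - e i)) :=
    fun i j => (he i j).trans (cartanMatrix_B_apply _ _)
  constructor
  · rw [rootModelBC_ht_top b hr rfl e he', (rootModelBC b hr rfl e he').card_posRoots]
    exact two_mul_card_labelsBC r
  · rw [rootModelBC_prod b hr rfl e he', prod_typeB]
    simp only [SimpleLieType.superfactorial, SimpleLieType.exponents, Multiset.map_map,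
      Function.comp_def]

theorem typeC {r : ℕ} (hr : 2 ≤ r) (e : b.support ≃ Fin r)
    (he : ∀ i j, b.cartanMatrix i j = CartanMatrix.C r (e i) (e j)) :
    2 * (posRoots b).card = r * coxeterNumber b ∧
      ∏ i ∈ posRoots b, pr b i (rho b) = (SimpleLieType.C r hr).superfactorial := by
  have he' : ∀ i j, b.cartanMatrix i j = conodeBC 1 (r - 1 - e j) (nodeBC 2 (r - 1 - e i)) :=
    fun i j => (he i j).trans (cartanMatrix_C_apply _ _)
  constructor
  · rw [rootModelBC_ht_top b hr rfl e he', (rootModelBC b hr rfl e he').card_posRoots]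
    exact two_mul_card_labelsBC r
  · rw [rootModelBC_prod b hr rfl e he', prod_typeC]
    simp only [SimpleLieType.superfactorial, SimpleLieType.exponents, Multiset.map_map,
      Function.comp_def]

/-! ### Type `D` -/

/-- The simple roots in type `D`. -/
def nodeD : ℕ → ℕ → ℤ
  | 0 => unit 0 + unit 1
  | n + 1 => unit (n + 1) - unit n

/-- The simple coroots in type `D`. -/
def conodeD : ℕ → (ℕ → ℤ) →+ ℤ
  | 0 => Pi.evalAddMonoidHom (fun _ => ℤ) 0 + Pi.evalAddMonoidHom (fun _ => ℤ) 1
  | n + 1 => diffHom n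

theorem conodeD_zero_apply (x : ℕ → ℤ) : conodeD 0 x = x 0 + x 1 := rfl

theorem conodeD_succ (n : ℕ) : conodeD (n + 1) = diffHom n := rfl

theorem cartanMatrix_D_apply {r : ℕ} (hr : 3 ≤ r) (i j : Fin r) :
    CartanMatrix.D r i j = conodeD (r - 1 - j) (nodeD (r - 1 - i)) := by
  have hi := i.2
  have hj := j.2
  simp only [CartanMatrix.D, Matrix.of_apply, Fin.ext_iff, if_neg (by omega : ¬ r ≤ 2)]
  rcases hp : r - 1 - (i : ℕ) with _ | p <;> rcases hq : r - 1 - (j : ℕ) with _ | q <;>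
    simp only [nodeD, conodeD_zero_apply, conodeD_succ, diffHom_apply, Pi.sub_apply, Pi.add_apply,
      unit_apply] <;> split_ifs <;> first | contradiction | omega

/-- The labels of the positive roots in type `D`. -/
def labelsD (r : ℕ) : Finset Label := (pairs r).disjSum ((pairs r).disjSum ∅)

/-- Through this inclusion the injectivity and the evaluation of labels carry over from type B. -/
theorem labelsD_subset (r : ℕ) : labelsD r ⊆ labelsBC r :=
  Finset.disjSum_mono subset_rfl (Finset.disjSum_mono subset_rfl (Finset.empty_subset _))

theorem exists_labelsD {r : ℕ} {x : ℕ → ℤ} : (∃ t ∈ labelsD r, labelRoot 1 t = x) ↔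
    (∃ i j, j < i ∧ i < r ∧ x = unit i - unit j) ∨
      ∃ i j, j < i ∧ i < r ∧ x = unit i + unit j := by
  constructor
  · rintro ⟨p | p | i, h, rfl⟩
    · simp only [labelsD, Finset.inl_mem_disjSum, mem_pairs] at h
      exact Or.inl ⟨_, _, h.2, h.1, rfl⟩
    · simp only [labelsD, Finset.inr_mem_disjSum, Finset.inl_mem_disjSum, mem_pairs] at h
      exact Or.inr ⟨_, _, h.2, h.1, rfl⟩
    · simp [labelsD] at h
  · rintro (⟨i, j, h1, h2, rfl⟩ | ⟨i, j, h1, h2, rfl⟩)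
    · exact ⟨.inl ⟨i, j⟩, by simp [labelsD, mem_pairs, h1, h2], rfl⟩
    · exact ⟨.inr (.inl ⟨i, j⟩), by simp [labelsD, mem_pairs, h1, h2], rfl⟩

theorem swap_mem_labelsD {r n : ℕ} (hn : n + 1 < r) {x : ℕ → ℤ}
    (hx : ∃ t ∈ labelsD r, labelRoot 1 t = x) : x = unit (n + 1) - unit n ∨
      ∃ t ∈ labelsD r, labelRoot 1 t = x - diffHom n x • (unit (n + 1) - unit n) := by
  rcases exists_labelsD.1 hx with ⟨i, j, h1, h2, rfl⟩ | ⟨i, j, h1, h2, rfl⟩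
  · rw [reflection_sub, swap_unit, swap_unit]
    rcases swap_lt_swap (n := n) h1 with h | ⟨rfl, rfl⟩
    · exact Or.inr (exists_labelsD.2 (Or.inl ⟨_, _, h, swap_lt hn h2, rfl⟩))
    · exact Or.inl rfl
  · rw [reflection_add, swap_unit, swap_unit]
    refine Or.inr (exists_labelsD.2 (Or.inr ?_))
    rcases lt_or_gt_of_ne ((Equiv.swap n (n + 1)).injective.ne h1.ne) with h | h
    · exact ⟨_, _, h, swap_lt hn h2, rfl⟩
    · exact ⟨_, _, h, swap_lt hn (h1.trans h2), add_comm _ _⟩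

theorem conodeD_zero_reflection (k : ℕ) : unit k - conodeD 0 (unit k) • nodeD 0 =
    if k = 0 then -unit 1 else if k = 1 then -unit 0 else unit k := by
  rw [conodeD_zero_apply, nodeD]
  funext l
  rcases k with _ | _ | k <;>
    simp [unit_apply]

theorem reflection_mem_labelsD {r : ℕ} {x : ℕ → ℤ}
    (hx : ∃ t ∈ labelsD r, labelRoot 1 t = x) : x = nodeD 0 ∨
      ∃ t ∈ labelsD r, labelRoot 1 t = x - conodeD 0 x • nodeD 0 := by
  rcases exists_labelsD.1 hx with ⟨i, j, h1, h2, rfl⟩ | ⟨i, j, h1, h2, rfl⟩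
  · refine Or.inr (exists_labelsD.2 ?_)
    rw [reflection_sub, conodeD_zero_reflection, conodeD_zero_reflection]
    rcases i with _ | _ | i
    · omega
    · obtain rfl : j = 0 := by omega
      exact Or.inl ⟨1, 0, h1, h2, by simp; abel⟩
    · rcases j with _ | _ | j
      · exact Or.inr ⟨i + 2, 1, by omega, h2, by simp⟩
      · exact Or.inr ⟨i + 2, 0, by omega, h2, by simp⟩
      · exact Or.inl ⟨i + 2, j + 2, h1, h2, by simp⟩
  · rw [reflection_add, conodeD_zero_reflection, conodeD_zero_reflection]
    rcases i with _ | _ | i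
    · omega
    · obtain rfl : j = 0 := by omega
      exact Or.inl (by rw [nodeD, add_comm])
    · refine Or.inr (exists_labelsD.2 ?_)
      rcases j with _ | _ | j
      · exact Or.inl ⟨i + 2, 1, by omega, h2, by simp [sub_eq_add_neg]⟩
      · exact Or.inl ⟨i + 2, 0, by omega, h2, by simp [sub_eq_add_neg]⟩
      · exact Or.inr ⟨i + 2, j + 2, h1, h2, by simp⟩

/-- The model of the positive roots in type `D`. -/
def rootModelD {r : ℕ} (hr : 3 ≤ r) (e : b.support ≃ Fin r)
    (he : ∀ i j, b.cartanMatrix i j = CartanMatrix.D r (e i) (e j)) :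
    RootModel b (ℕ → ℤ) Label where
  T := labelsD r
  v := labelRoot 1
  a j := nodeD (r - 1 - e j)
  f j := conodeD (r - 1 - e j)
  ht := weighted r fun k => k
  pr := weighted r fun k => k
  d _ := 1
  top := .inr (.inl ⟨r - 1, r - 2⟩)
  f_a i j := by rw [he, cartanMatrix_D_apply hr]
  ht_a j := by
    rcases hp : r - 1 - (e j : ℕ) with _ | p <;> simp only [nodeD]
    · rw [map_add, weighted_unit _ (by omega), weighted_unit _ (by omega)]; simp
    · rw [map_sub, weighted_unit _ (by omega), weighted_unit _ (by omega)]; push_cast; ring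
  pr_a j := by
    rcases hp : r - 1 - (e j : ℕ) with _ | p <;> simp only [nodeD]
    · rw [map_add, weighted_unit _ (by omega), weighted_unit _ (by omega)]; simp
    · rw [map_sub, weighted_unit _ (by omega), weighted_unit _ (by omega)]; push_cast; ring
  d_pos _ := one_pos
  d_eq_one := ⟨e.symm ⟨0, by omega⟩, rfl⟩
  d_mul i j := by rw [he, he, ← CartanMatrix.D_isSymm r |>.apply]
  simple_mem j := by
    refine exists_labelsD.2 ?_
    rcases hp : r - 1 - (e j : ℕ) with _ | p
    · exact Or.inr ⟨1, 0, by omega, by omega, add_comm _ _⟩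
    · exact Or.inl ⟨p + 1, p, by omega, by omega, rfl⟩
  reflection_mem t ht j := by
    rcases hp : r - 1 - (e j : ℕ) with _ | p
    · exact reflection_mem_labelsD ⟨t, ht, rfl⟩
    · exact swap_mem_labelsD (by omega) ⟨t, ht, rfl⟩
  ht_pos t ht := by
    rw [map_labelRoot 1 _ (labelsD_subset r ht)]
    rcases t with ⟨i, j⟩ | ⟨i, j⟩ | i <;> simp only [labelVal]
    · simp only [labelsD, Finset.inl_mem_disjSum, mem_pairs] at ht
      have : (j : ℚ) < i := by exact_mod_cast ht.2
      linarith
    · simp only [labelsD, Finset.inl_mem_disjSum, Finset.inr_mem_disjSum, mem_pairs] at ht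
      have : (j : ℚ) < i := by exact_mod_cast ht.2
      have : (0 : ℚ) ≤ j := by positivity
      linarith
    · simp [labelsD] at ht
  exists_f_pos t ht := by
    have hsurj : ∀ n < r, ∃ j, r - 1 - (e j : ℕ) = n := fun n hn =>
      ⟨e.symm ⟨r - 1 - n, by omega⟩, by simp only [Equiv.apply_symm_apply]; omega⟩
    rcases exists_labelsD.1 ⟨t, ht, rfl⟩ with ⟨i, j, h1, h2, h⟩ | ⟨i, j, h1, h2, h⟩ <;> rw [h]
    · obtain ⟨k, hk⟩ := hsurj i h2
      refine ⟨k, ?_⟩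
      rw [hk]
      rcases i with _ | i
      · omega
      · simp only [conodeD_succ, diffHom_apply, Pi.sub_apply, unit_apply]
        split_ifs <;> omega
    · obtain ⟨k, hk⟩ := hsurj j (h1.trans h2)
      refine ⟨k, ?_⟩
      rw [hk]
      rcases j with _ | j
      · rw [conodeD_zero_apply]
        simp only [Pi.add_apply, unit_apply]
        split_ifs <;> omega
      · simp only [conodeD_succ, diffHom_apply, Pi.add_apply, unit_apply]
        split_ifs <;> omega
  injOn := (labelRoot_injOn one_pos).mono (by exact_mod_cast labelsD_subset r)
  top_mem := by
    simp only [labelsD, Finset.inr_mem_disjSum, Finset.inl_mem_disjSum, mem_pairs]; omega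
  ht_le t ht := by
    have htop : (.inr (.inl ⟨r - 1, r - 2⟩) : Label) ∈ labelsBC r := by
      simp only [labelsBC, Finset.inr_mem_disjSum, Finset.inl_mem_disjSum, mem_pairs]; omega
    rw [map_labelRoot 1 _ (labelsD_subset r ht), map_labelRoot 1 _ htop]
    rcases t with ⟨i, j⟩ | ⟨i, j⟩ | i <;> simp only [labelVal] <;>
      simp only [labelsD, Finset.inl_mem_disjSum, Finset.inr_mem_disjSum,
        mem_pairs, Finset.notMem_empty] at ht
    · have h1 : (i : ℚ) ≤ (r - 1 : ℕ) := by exact_mod_cast (by omega : i ≤ r - 1)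
      have h2 : (0 : ℚ) ≤ j := by positivity
      have h3 : (0 : ℚ) ≤ (r - 2 : ℕ) := by positivity
      linarith
    · have h1 : (i : ℚ) ≤ (r - 1 : ℕ) := by exact_mod_cast (by omega : i ≤ r - 1)
      have h2 : (j : ℚ) ≤ (r - 2 : ℕ) := by exact_mod_cast (by omega : j ≤ r - 2)
      linarith

/-- The rank is r + 1, and the extra r! belongs to the exponent r. Passing from r to r + 1
multiplies the product by (r+1)! · (2r+1)!/r!. -/
theorem prod_typeD (r : ℕ) :
    (∏ p ∈ pairs (r + 1), ((p.1 : ℚ) - p.2)) * ∏ p ∈ pairs (r + 1), ((p.1 : ℚ) + p.2) =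
      r.factorial * ((Multiset.range r).map fun i => ((2 * i + 1).factorial : ℚ)).prod := by
  induction r with
  | zero => simp [pairs, Finset.prod_sigma]
  | succ r ih =>
    rw [prod_pairs_succ, prod_pairs_succ _ fun p => (p.1 : ℚ) + p.2, Multiset.range_succ,
      Multiset.map_cons, Multiset.prod_cons, prod_range_sub]
    have h1 : (r.factorial : ℚ) * ∏ j ∈ Finset.range (r + 1), (((r + 1 : ℕ) : ℚ) + j) =
        (2 * r + 1).factorial := by
      have h2 := prod_range_add r (r + 1)
      rw [show r + (r + 1) = 2 * r + 1 by ring] at h2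
      rw [← h2]
      congr 1
      exact Finset.prod_congr rfl fun j _ => by push_cast; ring
    have h2 : (r.factorial : ℚ) ≠ 0 := by positivity
    rw [← h1]
    linear_combination ((r + 1).factorial : ℚ) *
      (∏ j ∈ Finset.range (r + 1), (((r + 1 : ℕ) : ℚ) + j)) * ih

theorem typeD {r : ℕ} (hr : 3 ≤ r) (e : b.support ≃ Fin r)
    (he : ∀ i j, b.cartanMatrix i j = CartanMatrix.D r (e i) (e j)) :
    2 * (posRoots b).card = r * coxeterNumber b ∧
      ∏ i ∈ posRoots b, pr b i (rho b) = (SimpleLieType.D r hr).superfactorial := by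
  obtain ⟨s, rfl⟩ : ∃ s, r = s + 1 := ⟨r - 1, by omega⟩
  have htop : (.inr (.inl ⟨s + 1 - 1, s + 1 - 2⟩) : Label) ∈ labelsBC (s + 1) := by
    simp only [labelsBC, Finset.inr_mem_disjSum, Finset.inl_mem_disjSum, mem_pairs]; omega
  constructor
  · have h1 := (rootModelD b hr e he).coxeterNumber_eq
    have h2 : coxeterNumber b = 2 * s := by
      have h3 := map_labelRoot 1 (fun k => (k : ℚ)) htop
      have h4 : (coxeterNumber b : ℚ) = ((s + 1 - 1 : ℕ) : ℚ) + ((s + 1 - 2 : ℕ) : ℚ) + 1 :=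
        h1.trans (congrArg (· + 1) h3)
      have h5 : coxeterNumber b = (s + 1 - 1) + (s + 1 - 2) + 1 := by exact_mod_cast h4
      omega
    rw [(rootModelD b hr e he).card_posRoots, h2]
    change 2 * (labelsD (s + 1)).card = _
    have h3 := two_mul_card_pairs (s + 1)
    rw [labelsD, Finset.card_disjSum, Finset.card_disjSum, Finset.card_empty]
    rw [Nat.add_sub_cancel] at h3
    nlinarith
  · rw [(rootModelD b hr e he).prod_pr]
    change ∏ t ∈ labelsD (s + 1), weighted (s + 1) (fun k => (k : ℚ)) (labelRoot 1 t) = _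
    rw [Finset.prod_congr rfl fun t ht => map_labelRoot 1 _ (labelsD_subset _ ht), labelsD,
      Finset.prod_disjSum, Finset.prod_disjSum, Finset.prod_empty, mul_one]
    simp only [labelVal]
    rw [prod_typeD]
    simp [SimpleLieType.superfactorial, SimpleLieType.exponents]

/-! ### The exceptional types -/

/-- The vector whose coordinates are the decimal digits of `c`, the lowest first. -/
def digitVec (n c : ℕ) (k : Fin n) : ℤ := (c / 10 ^ (k : ℕ) % 10 : ℕ)

/-- The linear function with coefficients `w`. -/
def linearFun {n : ℕ} (w : Fin n → ℚ) : (Fin n → ℤ) →+ ℚ where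
  toFun x := ∑ k, w k * x k
  map_zero' := by simp
  map_add' x y := by simp [mul_add, Finset.sum_add_distrib]

/-- The integral linear function with coefficients `w`. -/
def linearFunInt {n : ℕ} (w : Fin n → ℤ) : (Fin n → ℤ) →+ ℤ where
  toFun x := ∑ k, x k * w k
  map_zero' := by simp
  map_add' x y := by simp [add_mul, Finset.sum_add_distrib]

theorem linearFun_single {n : ℕ} (w : Fin n → ℚ) (j : Fin n) :
    linearFun w (Pi.single j 1) = w j := by
  change ∑ k, w k * ((Pi.single j 1 : Fin n → ℤ) k : ℚ) = w j
  rw [Finset.sum_eq_single j]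
  · simp
  · intro k _ hk; simp [hk]
  · simp

theorem linearFunInt_single {n : ℕ} (w : Fin n → ℤ) (j : Fin n) :
    linearFunInt w (Pi.single j 1) = w j := by
  change ∑ k, (Pi.single j 1 : Fin n → ℤ) k * w k = w j
  rw [Finset.sum_eq_single j]
  · simp
  · intro k _ hk; simp [hk]
  · simp

/-- The sum of the digits of `c` with weights `w`. -/
def digitSum {n : ℕ} (w : Fin n → ℕ) (c : ℕ) : ℕ := ∑ k, w k * (c / 10 ^ (k : ℕ) % 10)

/-- The digits of the members of `L` are the coefficients of the positive roots, for the Cartan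
matrix `A` with symmetrizer `d`. -/
structure IsRootCode {n : ℕ} (A : Matrix (Fin n) (Fin n) ℤ) (d : Fin n → ℕ) (L : List ℕ)
    (top : ℕ) : Prop where
  nodup : L.Nodup
  d_pos : ∀ j, 0 < d j
  d_eq_one : ∃ j, d j = 1
  d_mul : ∀ i j, (d i : ℤ) * A i j = d j * A j i
  simple_mem : ∀ j : Fin n, 10 ^ (j : ℕ) ∈ L ∧ digitVec n (10 ^ (j : ℕ)) = Pi.single j 1
  reflection_mem : ∀ c ∈ L, ∀ j : Fin n, c = 10 ^ (j : ℕ) ∨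
    -- The singleton list names the only candidate, the code of the reflected root, and keeps the
    -- existential decidable.
    ∃ c' ∈ [(c - (∑ k, digitVec n c k * A k j) * 10 ^ (j : ℕ)).toNat], c' ∈ L ∧
      ∀ k, digitVec n c' k = digitVec n c k - if k = j then ∑ k, digitVec n c k * A k j else 0
  exists_pos : ∀ c ∈ L, ∃ j, 0 < ∑ k, digitVec n c k * A k j
  eq_digitSum : ∀ c ∈ L, c = digitSum (fun k : Fin n => 10 ^ (k : ℕ)) c
  top_mem : top ∈ L
  digitSum_pos : ∀ c ∈ L, 0 < digitSum (fun _ : Fin n => 1) c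
  digitSum_le : ∀ c ∈ L, digitSum (fun _ : Fin n => 1) c ≤ digitSum (fun _ : Fin n => 1) top

theorem linearFun_digitVec {n : ℕ} (w : Fin n → ℕ) (D : ℚ) (c : ℕ) :
    linearFun (fun k => (w k : ℚ) / D) (digitVec n c) = digitSum w c / D := by
  change ∑ k, (w k : ℚ) / D * (digitVec n c k : ℚ) = _
  simp only [digitSum, digitVec, Nat.cast_sum, Finset.sum_div, Int.cast_natCast]
  refine Finset.sum_congr rfl fun k _ => ?_
  rw [Nat.cast_mul]; ring

theorem linearFun_one_digitVec {n : ℕ} (c : ℕ) :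
    linearFun (fun _ => 1) (digitVec n c) = digitSum (fun _ : Fin n => 1) c := by
  simpa using linearFun_digitVec (fun _ : Fin n => 1) 1 c

/-- The model of the positive roots given by a list of coefficients. -/
def rootModelCode {n : ℕ} {A : Matrix (Fin n) (Fin n) ℤ} {d : Fin n → ℕ} {L : List ℕ} {top : ℕ}
    (h : IsRootCode A d L top) (e : b.support ≃ Fin n)
    (he : ∀ i j, b.cartanMatrix i j = A (e i) (e j)) : RootModel b (Fin n → ℤ) ℕ where
  T := ⟨L, Multiset.coe_nodup.2 h.nodup⟩
  v := digitVec n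
  a j := Pi.single (e j) 1
  f j := linearFunInt fun k => A k (e j)
  ht := linearFun fun _ => 1
  pr := linearFun fun k => 1 / d k
  d j := d (e j)
  top := top
  f_a i j := by rw [linearFunInt_single, he]
  ht_a j := linearFun_single _ _
  pr_a j := linearFun_single _ _
  d_pos j := h.d_pos _
  d_eq_one := by
    obtain ⟨j, hj⟩ := h.d_eq_one
    exact ⟨e.symm j, by rwa [e.apply_symm_apply]⟩
  d_mul i j := by rw [he, he]; exact h.d_mul _ _
  simple_mem j := ⟨_, (h.simple_mem (e j)).1, (h.simple_mem (e j)).2⟩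
  reflection_mem c hc j := by
    rcases h.reflection_mem c hc (e j) with h1 | ⟨c', -, h1, h2⟩
    · exact Or.inl (by rw [h1]; exact (h.simple_mem (e j)).2)
    · refine Or.inr ⟨c', h1, funext fun k => ?_⟩
      rw [h2, Pi.sub_apply, Pi.smul_apply, Pi.single_apply, smul_eq_mul, mul_ite, mul_one, mul_zero]
      rfl
  ht_pos c hc := by
    rw [linearFun_one_digitVec]
    exact_mod_cast h.digitSum_pos c hc
  exists_f_pos c hc := by
    obtain ⟨j, hj⟩ := h.exists_pos c hc
    exact ⟨e.symm j, by rw [e.apply_symm_apply]; exact hj⟩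
  injOn := by
    intro c hc c' hc' hcc
    rw [h.eq_digitSum c hc, h.eq_digitSum c' hc', digitSum, digitSum]
    refine Finset.sum_congr rfl fun k _ => ?_
    have h1 := congrFun hcc k
    simp only [digitVec, Nat.cast_inj] at h1
    rw [h1]
  top_mem := h.top_mem
  ht_le c hc := by
    rw [linearFun_one_digitVec, linearFun_one_digitVec]
    exact_mod_cast h.digitSum_le c hc

theorem IsRootCode.two_mul_card {n : ℕ} {A : Matrix (Fin n) (Fin n) ℤ} {d : Fin n → ℕ}
    {L : List ℕ} {top : ℕ} (h : IsRootCode A d L top) (e : b.support ≃ Fin n)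
    (he : ∀ i j, b.cartanMatrix i j = A (e i) (e j))
    (hL : 2 * L.length = n * (digitSum (fun _ : Fin n => 1) top + 1)) :
    2 * (posRoots b).card = n * coxeterNumber b := by
  have h1 := (rootModelCode b h e he).coxeterNumber_eq
  have h2 : (rootModelCode b h e he).ht ((rootModelCode b h e he).v (rootModelCode b h e he).top) =
      digitSum (fun _ : Fin n => 1) top := linearFun_one_digitVec top
  rw [h2] at h1
  have h3 : coxeterNumber b = digitSum (fun _ : Fin n => 1) top + 1 := by exact_mod_cast h1
  rw [h3, ← hL, (rootModelCode b h e he).card_posRoots]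
  rfl

/-- The values 1/d k on the simple roots are written as w k / D with a common denominator, so that
the product becomes an identity of natural numbers that the kernel can decide. -/
theorem IsRootCode.prod_pr {n : ℕ} {A : Matrix (Fin n) (Fin n) ℤ} {d : Fin n → ℕ}
    {L : List ℕ} {top : ℕ} (h : IsRootCode A d L top) (e : b.support ≃ Fin n)
    (he : ∀ i j, b.cartanMatrix i j = A (e i) (e j)) {w : Fin n → ℕ} {D K F : ℕ} (hD : 0 < D)
    (hK : 0 < K) (hw : ∀ k, w k * d k = D)
    (hL : (L.map (digitSum w)).prod * K = F * D ^ L.length) :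
    ∏ i ∈ posRoots b, pr b i (rho b) = (F : ℚ) / K := by
  have h1 : ∀ c, (rootModelCode b h e he).pr ((rootModelCode b h e he).v c) = digitSum w c / D := by
    intro c
    rw [← linearFun_digitVec]
    refine DFunLike.congr_fun (congrArg linearFun (funext fun k => ?_)) _
    have h2 : (d k : ℚ) ≠ 0 := by exact_mod_cast (h.d_pos k).ne'
    have h3 : (w k : ℚ) * d k = D := by exact_mod_cast hw k
    have h4 : (D : ℚ) ≠ 0 := by exact_mod_cast hD.ne'
    rw [div_eq_div_iff h2 h4, h3, one_mul]
  rw [(rootModelCode b h e he).prod_pr, Finset.prod_congr rfl fun c _ => h1 c,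
    Finset.prod_div_distrib, Finset.prod_const]
  have h2 : ∏ c ∈ (rootModelCode b h e he).T, (digitSum w c : ℚ) = (L.map (digitSum w)).prod := by
    rw [← Nat.cast_prod]; rfl
  have h3 : (rootModelCode b h e he).T.card = L.length := rfl
  rw [h2, h3, div_eq_div_iff (by positivity) (by positivity)]
  exact_mod_cast hL

/-- The coefficients of the positive roots of `E₈`. -/
def codeE₈ : List ℕ :=
  [1, 10, 100, 101, 1000, 1010, 1100, 1101, 1110, 1111, 10000, 11000, 11010, 11100, 11101, 11110,
    11111, 12110, 12111, 12211, 100000, 110000, 111000, 111010, 111100, 111101, 111110, 111111,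
    112110, 112111, 112211, 122110, 122111, 122211, 123211, 123221, 1000000, 1100000, 1110000,
    1111000, 1111010, 1111100, 1111101, 1111110, 1111111, 1112110, 1112111, 1112211, 1122110,
    1122111, 1122211, 1123211, 1123221, 1222110, 1222111, 1222211, 1223211, 1223221, 1233211,
    1233221, 1234221, 1234321, 1234322, 10000000, 11000000, 11100000, 11110000, 11111000, 11111010,
    11111100, 11111101, 11111110, 11111111, 11112110, 11112111, 11112211, 11122110, 11122111,
    11122211, 11123211, 11123221, 11222110, 11222111, 11222211, 11223211, 11223221, 11233211,
    11233221, 11234221, 11234321, 11234322, 12222110, 12222111, 12222211, 12223211, 12223221,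
    12233211, 12233221, 12234221, 12234321, 12234322, 12333211, 12333221, 12334221, 12334321,
    12334322, 12344221, 12344321, 12344322, 12345321, 12345322, 12345331, 12345332, 12345422,
    12345432, 12346432, 12356432, 12456432, 13456432, 23456432]

/-- The coefficients of the positive roots of `F₄`. -/
def codeF₄ : List ℕ :=
  [1, 10, 11, 100, 110, 111, 210, 211, 221, 1000, 1100, 1110, 1111, 1210, 1211, 1221, 1321, 2210,
    2211, 2221, 2321, 2421, 2431, 2432]

theorem isRootCode_E₈ : IsRootCode CartanMatrix.E₈ (fun _ => 1) codeE₈ 23456432 := by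
  constructor <;> decide +kernel

/-- The list is increasing, so the roots without component along the last node of E₈ are the codes
below 10^7, its first 63 entries. In the same way the first 36 entries, below 10^6, give E₆. -/
theorem isRootCode_E₇ : IsRootCode CartanMatrix.E₇ (fun _ => 1) (codeE₈.take 63) 1234322 := by
  constructor <;> decide +kernel

theorem isRootCode_E₆ : IsRootCode CartanMatrix.E₆ (fun _ => 1) (codeE₈.take 36) 123221 := by
  constructor <;> decide +kernel

theorem isRootCode_F₄ : IsRootCode CartanMatrix.F₄ ![1, 1, 2, 2] codeF₄ 2432 := by
  constructor <;> decide +kernel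

theorem isRootCode_G₂ : IsRootCode CartanMatrix.G₂ ![1, 3] [1, 10, 11, 21, 31, 32] 32 := by
  constructor <;> decide +kernel

theorem IsRootCode.typeE {n : ℕ} {A : Matrix (Fin n) (Fin n) ℤ} {L : List ℕ} {top : ℕ}
    (h : IsRootCode A (fun _ => 1) L top) (e : b.support ≃ Fin n)
    (he : ∀ i j, b.cartanMatrix i j = A (e i) (e j)) (m : Multiset ℕ)
    (hL : 2 * L.length = n * (digitSum (fun _ : Fin n => 1) top + 1))
    (hm : (L.map (digitSum fun _ : Fin n => 1)).prod = (m.map Nat.factorial).prod) :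
    2 * (posRoots b).card = n * coxeterNumber b ∧
      ∏ i ∈ posRoots b, pr b i (rho b) = (m.map fun s => (s.factorial : ℚ)).prod := by
  refine ⟨h.two_mul_card b e he hL, ?_⟩
  rw [h.prod_pr b e he (w := fun _ => 1) (D := 1) (K := 1) (F := (m.map Nat.factorial).prod)
    one_pos one_pos (fun _ => rfl) (by rw [hm, one_pow]), Nat.cast_one, div_one,
    Nat.cast_multiset_prod, Multiset.map_map]
  rfl

theorem typeF₄ (e : b.support ≃ Fin 4)
    (he : ∀ i j, b.cartanMatrix i j = CartanMatrix.F₄ (e i) (e j)) :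
    2 * (posRoots b).card = 4 * coxeterNumber b ∧
      ∏ i ∈ posRoots b, pr b i (rho b) = SimpleLieType.F₄.superfactorial := by
  refine ⟨isRootCode_F₄.two_mul_card b e he (by decide +kernel), ?_⟩
  rw [isRootCode_F₄.prod_pr b e he (w := ![2, 2, 1, 1]) (D := 2) (K := 2 ^ 12)
    (F := Nat.factorial 1 * Nat.factorial 5 * Nat.factorial 7 * Nat.factorial 11)
    two_pos (by norm_num) (by decide) (by decide +kernel)]
  simp [SimpleLieType.superfactorial, SimpleLieType.exponents]
  norm_num [Nat.factorial]

theorem typeG₂ (e : b.support ≃ Fin 2)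
    (he : ∀ i j, b.cartanMatrix i j = CartanMatrix.G₂ (e i) (e j)) :
    2 * (posRoots b).card = 2 * coxeterNumber b ∧
      ∏ i ∈ posRoots b, pr b i (rho b) = SimpleLieType.G₂.superfactorial := by
  refine ⟨isRootCode_G₂.two_mul_card b e he (by decide +kernel), ?_⟩
  rw [isRootCode_G₂.prod_pr b e he (w := ![3, 1]) (D := 3) (K := 3 ^ 3)
    (F := Nat.factorial 1 * Nat.factorial 5) three_pos (by norm_num) (by decide)
    (by decide +kernel)]
  simp [SimpleLieType.superfactorial, SimpleLieType.exponents]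
  norm_num

/-! ### All types together, and the number of roots -/

/-- The number of roots, and the product of the heights of the positive roots. -/
theorem card_posRoots_and_prod (X : SimpleLieType) (e : b.support ≃ Fin X.rank)
    (he : ∀ i j, b.cartanMatrix i j = X.cartanMatrix (e i) (e j)) :
    2 * (posRoots b).card = X.rank * coxeterNumber b ∧
      ∏ i ∈ posRoots b, pr b i (rho b) = X.superfactorial :=
  match X, e, he with
  | .A _ hr, e, he => typeA b hr e he
  | .B _ hr, e, he => typeB b hr e he
  | .C _ hr, e, he => typeC b hr e he
  | .D _ hr, e, he => typeD b hr e he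
  | .E₆, e, he => isRootCode_E₆.typeE b e he _ (by decide +kernel) (by decide +kernel)
  | .E₇, e, he => isRootCode_E₇.typeE b e he _ (by decide +kernel) (by decide +kernel)
  | .E₈, e, he => isRootCode_E₈.typeE b e he _ (by decide +kernel) (by decide +kernel)
  | .F₄, e, he => typeF₄ b e he
  | .G₂, e, he => typeG₂ b e he

/-- Half of the roots are positive. -/
theorem card_eq_two_mul_card_posRoots : Fintype.card ι = 2 * (posRoots b).card := by
  classical
  have h1 : Finset.univ = posRoots b ∪ (posRoots b).image fun i => P.reflectionPerm i i := by
    ext i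
    simp only [Finset.mem_univ, true_iff, Finset.mem_union, Finset.mem_image]
    rcases isPos_or_neg b i with h | h
    · exact Or.inl ((mem_posRoots b).2 h)
    · exact Or.inr ⟨_, (mem_posRoots b).2 h, neg_neg_eq i⟩
  have h2 : Disjoint (posRoots b) ((posRoots b).image fun i => P.reflectionPerm i i) := by
    rw [Finset.disjoint_left]
    intro i hi hi'
    obtain ⟨j, hj, rfl⟩ := Finset.mem_image.1 hi'
    exact not_isPos_neg b ((mem_posRoots b).1 hj) ((mem_posRoots b).1 hi)
  have h3 : Function.Injective fun i : ι => P.reflectionPerm i i :=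
    Function.LeftInverse.injective (g := fun i => P.reflectionPerm i i) neg_neg_eq
  rw [← Finset.card_univ, h1, Finset.card_union_of_disjoint h2,
    Finset.card_image_of_injective _ h3, two_mul]

/-- For the root system of a Cartan subalgebra the coweight space is the subalgebra itself, so this
computes the rank r. -/
theorem finrank_coweight : Module.finrank ℂ N = Fintype.card b.support :=
  Module.finrank_eq_card_basis b.toCoweightBasis

end LieLevel

/-! ### The dimension of a Lie algebra from its root spaces -/

section RootSpaces

open LieAlgebra LieAlgebra.IsKilling LieModule

/-- The root space decomposition, on the level of dimensions. -/
theorem LieAlgebra.IsKilling.finrank_eq_finrank_add_card {K L : Type*} [Field K] [CharZero K]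
    [LieRing L] [LieAlgebra K L] [FiniteDimensional K L] [IsKilling K L] (H : LieSubalgebra K L)
    [H.IsCartanSubalgebra] [IsTriangularizable K H L]
    [Nontrivial H] :
    Module.finrank K L = Module.finrank K H + Fintype.card H.root := by
  classical
  have hds := DirectSum.isInternal_submodule_of_iSupIndep_of_iSup_eq_top
    (LieSubmodule.iSupIndep_toSubmodule.mpr <| iSupIndep_genWeightSpace' K H L)
    (LieSubmodule.iSup_toSubmodule_eq_top.mpr <| iSup_genWeightSpace_eq_top' K H L)
  have h1 : Module.finrank K L = ∑ χ : Weight K H L, Module.finrank K (genWeightSpace L χ) := by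
    rw [← (LinearEquiv.ofBijective (DirectSum.coeLinearMap _) hds).finrank_eq,
      Module.finrank_directSum]
    rfl
  have h2 : ∑ χ ∈ H.root, Module.finrank K (genWeightSpace L (χ : Weight K H L)) =
      Fintype.card H.root := by
    rw [Fintype.card_coe, Finset.card_eq_sum_ones]
    refine Finset.sum_congr rfl fun χ hχ => finrank_rootSpace_eq_one χ ?_
    simpa using hχ
  have h3 : Finset.univ.filter (fun χ : Weight K H L => ¬ χ.IsNonZero) = {0} := by
    ext χ; simp [Weight.isZero_iff_eq_zero]
  have h4 : Module.finrank K (genWeightSpace L (0 : Weight K H L)) = Module.finrank K H := by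
    change Module.finrank K (rootSpace H (0 : H → K)) = _
    rw [rootSpace_zero_eq]; rfl
  rw [h1, ← Finset.sum_filter_add_sum_filter_not Finset.univ
    (fun χ : Weight K H L => χ.IsNonZero), h3, Finset.sum_singleton, h4, add_comm]
  congr 1

end RootSpaces

/-! ### The main theorem -/

theorem mainTheorem4 {L : Type*} [LieRing L] [LieAlgebra ℂ L] [FiniteDimensional ℂ L]
    [LieAlgebra.IsSimple ℂ L] (H : LieSubalgebra ℂ L) [H.IsCartanSubalgebra]
    (b : (LieAlgebra.IsKilling.rootSystem H).Base)
    (X : SimpleLieType) (e : b.support ≃ Fin X.rank)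
    (he : ∀ i j, b.cartanMatrix i j = X.cartanMatrix (e i) (e j)) :
    Filter.Tendsto X.quantumSuperfactorial (nhdsWithin 1 {1}ᶜ) (nhds (X.superfactorial : ℂ)) ∧
    Filter.Tendsto (fun k : ℕ => X.quantumSuperfactorial (LieLevel.rootOfUnity b k)) Filter.atTop
      (nhds (X.superfactorial : ℂ)) ∧
    Asymptotics.IsEquivalent Filter.atTop (fun k : ℕ => LieLevel.globalDim b k)
      (fun k : ℕ => 1 / (2 ^ (Module.finrank ℂ H * LieLevel.coxeterNumber b) * LieLevel.formDet b *
          (Real.pi : ℂ) ^ (Module.finrank ℂ H * LieLevel.coxeterNumber b) *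
          (X.superfactorial : ℂ) ^ 2) * (k : ℂ) ^ Module.finrank ℂ L) := by
  refine ⟨X.quantumSuperfactorial_tendsto,
    X.quantumSuperfactorial_tendsto.comp (LieLevel.rootOfUnity_tendsto b), ?_⟩
  obtain ⟨h1, h2⟩ := LieLevel.card_posRoots_and_prod b X e he
  have h3 : Module.finrank ℂ H = Fintype.card b.support := LieLevel.finrank_coweight b
  have h4 : Fintype.card b.support = X.rank := by rw [Fintype.card_congr e, Fintype.card_fin]
  have : Nontrivial H := RootPairing.IsIrreducible.nontrivial' (LieAlgebra.IsKilling.rootSystem H)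
  have h5 : Module.finrank ℂ L = Fintype.card b.support + 2 * (LieLevel.posRoots b).card := by
    rw [LieAlgebra.IsKilling.finrank_eq_finrank_add_card H, h3,
      LieLevel.card_eq_two_mul_card_posRoots b]
  have h6 := LieLevel.globalDim_isEquivalent b
  rw [h2, ← h5] at h6
  -- The exponent rγ is the number of roots 2N. After that only (2π)^(2N) = 2^(2N) π^(2N) separates
  -- the two expressions.
  rw [h3, h4, ← h1]
  convert h6 using 4
  rw [mul_pow]
  ring

end
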